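/- **Proposition (Universal Weitzenböck Formula).** Let $M$ be a smooth Riemannian manifold of dimension $n$ (Hausdorff, second countable, without boundary) with Levi-Civita connection $\nabla$, let $G\subset\mathbf{SO}(n)$ be a closed connected subgroup with Lie algebra $\mathfrak g_{\mathbb R}\subset\mathfrak{so}(n)$, and let $P$ be a smooth reduction to $G$ of the orthonormal frame bundle of $M$ to which $\nabla$ restricts; for example, $G$ is the (connected) holonomy group of $M$ and $P$ the holonomy reduction. Write $T_{\mathbb R}=\mathbb R^n$ and $T=\mathbb C^n$ for the holonomy representation of $G$ and its complexification, with standard orthonormal basis $t_1,\dots,t_n$. Let $V_\lambda$ be an irreducible finite-dimensional smooth unitary complex representation of $G$, and let $V_\lambda M=P\times_G V_\lambda$, with the connection induced by $\nabla$. Let $$T\otimes V_\lambda=\bigoplus_\varepsilon V_{\lambda+\varepsilon}$$ be an orthogonal decomposition into irreducible subrepresentations, with orthogonal projections $\mathrm{pr}_\varepsilon$. The Stein–Weiss operators are $$T_\varepsilon:\Gamma(V_\lambda M)\to\Gamma(V_{\lambda+\varepsilon}M),\qquad T_\varepsilon\psi=\mathrm{pr}_\varepsilon(\nabla\psi).$$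 Identify $\mathfrak{so}(n)$ with $\Lambda^2T_{\mathbb R}$ by $\langle X,a\wedge b\rangle=\langle Xa,b\rangle$, with the induced scalar product $\langle X,Y\rangle=-\tfrac12\mathrm{tr}(XY)$. Let $\mathfrak h\subset\mathfrak g_{\mathbb R}$ be an ideal, $\mathrm{pr}_{\mathfrak h}:\Lambda^2T_{\mathbb R}\to\mathfrak h$ the orthogonal projection and $\{X_\alpha\}$ any orthonormal basis of $\mathfrak h$. The conformal weight operator on $T\otimes V_\lambda$ is given by $$B^{\mathfrak h}(t_\nu\otimes v)=\sum_\mu t_\mu\otimes \mathrm{pr}_{\mathfrak h}(t_\mu\wedge t_\nu)\,v ,$$ and the curvature endomorphism of $V_\lambda M$ is $$q^{\mathfrak h}(R)=\sum_\alpha X_\alpha\,R(X_\alpha),$$ where $R_{X,Y}=[\nabla_X,\nabla_Y]-\nabla_{[X,Y]}$, the curvature operator $R$ on $\Lambda^2TM$ is the linear map with $R(a\wedge b)=R_{a,b}$, and elements of $\mathfrak g_{\mathbb R}$ act on $V_\lambda$ by the differential of the representation. Then: 1. each $T_\varepsilon$ maps smooth sections to smooth sections and has a formal adjoint $T_\varepsilon^*:\Gamma(V_{\lambda+\varepsilon}M)\to\Gamma(V_\lambda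 M)$ with respect to the $L^2$ products defined by the Riemannian volume; 2. if $T_{\mathbb R}$ is an irreducible representation of $G$, or if the summands $V_{\lambda+\varepsilon}$ are pairwise non-isomorphic, then there are unique real numbers $b^{\mathfrak h}_\varepsilon$ such that $B^{\mathfrak h}$ acts on each $V_{\lambda+\varepsilon}$ as multiplication by $b^{\mathfrak h}_\varepsilon$; 3. whenever $B^{\mathfrak h}$ acts on each $V_{\lambda+\varepsilon}$ as multiplication by a real number $b^{\mathfrak h}_\varepsilon$ (in particular in the situation of 2.), one has on $\Gamma(V_\lambda M)$ $$q^{\mathfrak h}(R)\;=\;-\sum_{\varepsilon} b^{\mathfrak h}_\varepsilon\,T_\varepsilon^*\,T_\varepsilon .$$ -/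

import Mathlib

open Bundle MeasureTheory
open scoped Manifold ContDiff TensorProduct InnerProductSpace

noncomputable section

namespace Weitzenboeck

/-! ### Matrix groups, their Lie algebras and representations -/

section Algebra

variable {n : ℕ}

/-- The complexified holonomy representation space `T`, with its standard orthonormal
basis `t_μ` (the complexification of the standard basis of `ℝ^n`). -/
abbrev TSpace (n : ℕ) : Type := EuclideanSpace ℂ (Fin n)

/-- The basis vector `t_μ` of `T`. -/
def tVec (μ : Fin n) : TSpace n := EuclideanSpace.single μ 1

/-- The set of matrices of a subgroup `G` of `SO(n)`. -/
def matSet (G : Subgroup (Matrix.specialOrthogonalGroup (Fin n) ℝ)) :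
    Set (Matrix (Fin n) (Fin n) ℝ) :=
  {A | ∃ g ∈ G, (g : Matrix (Fin n) (Fin n) ℝ) = A}

/-- The Lie algebra of `G ⊆ SO(n)`: all matrices whose one-parameter group lies in `G`. -/
def lieAlg (G : Subgroup (Matrix.specialOrthogonalGroup (Fin n) ℝ)) :
    Set (Matrix (Fin n) (Fin n) ℝ) :=
  {X | ∀ t : ℝ, NormedSpace.exp (t • X) ∈ matSet G}

/-- `h` is an ideal of the Lie algebra of `G`. -/
structure IsIdeal (G : Subgroup (Matrix.specialOrthogonalGroup (Fin n) ℝ))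
    (h : Submodule ℝ (Matrix (Fin n) (Fin n) ℝ)) : Prop where
  subset : ∀ X ∈ h, X ∈ lieAlg G
  bracket_mem : ∀ X ∈ lieAlg G, ∀ Y ∈ h, X * Y - Y * X ∈ h

/-- The scalar product `⟨X, Y⟩ = ½ tr(Xᵀ Y)`; on `so(n) = Λ²` it is `-½ tr(X Y)`, the scalar
product given by the Gram determinant. -/
def soInner (X Y : Matrix (Fin n) (Fin n) ℝ) : ℝ :=
  (1 / 2 : ℝ) * (X.transpose * Y).trace

/-- `t_μ ∧ t_ν` as an element of `so(n)`, under the identification `⟨X, a ∧ b⟩ = ⟨X a, b⟩`, that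
is `(a ∧ b) c = ⟨a, c⟩ b - ⟨b, c⟩ a`. -/
def wedge (μ ν : Fin n) : Matrix (Fin n) (Fin n) ℝ :=
  Matrix.single ν μ 1 - Matrix.single μ ν 1

/-- Orthogonal projection onto `h`: the unique `Y ∈ h` with `A - Y` orthogonal to `h`. -/
def proj (h : Submodule ℝ (Matrix (Fin n) (Fin n) ℝ)) (A : Matrix (Fin n) (Fin n) ℝ) :
    Matrix (Fin n) (Fin n) ℝ :=
  Classical.epsilon fun Y => Y ∈ h ∧ ∀ Z ∈ h, soInner Z (A - Y) = 0

/-- `X` is an orthonormal basis of `h` for the scalar product of `Λ²`. -/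
structure IsOrthonormalBasis {d : ℕ} (h : Submodule ℝ (Matrix (Fin n) (Fin n) ℝ))
    (X : Fin d → Matrix (Fin n) (Fin n) ℝ) : Prop where
  span_eq : Submodule.span ℝ (Set.range X) = h
  inner_eq : ∀ α β, soInner (X α) (X β) = if α = β then 1 else 0

/-- The holonomy representation `ℝ^n` of `G`. -/
def realRep (G : Subgroup (Matrix.specialOrthogonalGroup (Fin n) ℝ)) :
    Representation ℝ G (Fin n → ℝ) where
  toFun g := Matrix.toLin' ((g : Matrix.specialOrthogonalGroup (Fin n) ℝ) :
    Matrix (Fin n) (Fin n) ℝ)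
  map_one' := by simp; rfl
  map_mul' g h := by simp [Matrix.toLin'_mul]; rfl

/-- The complexified holonomy representation `T` of `G`. -/
def complexRep (G : Subgroup (Matrix.specialOrthogonalGroup (Fin n) ℝ)) :
    Representation ℂ G (TSpace n) where
  toFun g := Matrix.toEuclideanLin (((g : Matrix.specialOrthogonalGroup (Fin n) ℝ) :
    Matrix (Fin n) (Fin n) ℝ).map Complex.ofRealHom)
  map_one' := by
    ext; simp
  map_mul' g h := by
    ext; simp [Matrix.map_mul]

variable {G : Subgroup (Matrix.specialOrthogonalGroup (Fin n) ℝ)}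
variable {V : Type*} [NormedAddCommGroup V] [InnerProductSpace ℂ V] [FiniteDimensional ℂ V]

/-- A representation of `G` as a function on matrices (with the value `0` outside `G`). -/
def onMatrices (ρ : Representation ℂ G V) : Matrix (Fin n) (Fin n) ℝ → (V →L[ℂ] V) :=
  Function.extend (fun g : G => ((g : Matrix.specialOrthogonalGroup (Fin n) ℝ) :
    Matrix (Fin n) (Fin n) ℝ)) (fun g => LinearMap.toContinuousLinearMap (ρ g)) 0

/-- The differential of `ρ`, `X ↦ d/dt|₀ ρ(exp(tX))`, for `X` in the Lie algebra of `G`. -/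
def differential (ρ : Representation ℂ G V) (X : Matrix (Fin n) (Fin n) ℝ) : V →L[ℂ] V :=
  deriv (fun t : ℝ => onMatrices ρ (NormedSpace.exp (t • X))) 0

section Smooth

attribute [local instance] Matrix.normedAddCommGroup Matrix.normedSpace

/-- `G` is connected: every element is joined to `1` by a `C¹` path in `G`. (For a closed
subgroup this is equivalent to topological connectedness.) -/
def IsPathConnectedGroup (G : Subgroup (Matrix.specialOrthogonalGroup (Fin n) ℝ)) : Prop :=
  ∀ A ∈ matSet G, ∃ γ : ℝ → Matrix (Fin n) (Fin n) ℝ,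
    ContDiff ℝ 1 γ ∧ (∀ t, γ t ∈ matSet G) ∧ γ 0 = 1 ∧ γ 1 = A

/-- `ρ` is a smooth unitary representation of the Lie group `G`. -/
structure IsUnitaryRep (ρ : Representation ℂ G V) : Prop where
  contDiffOn : ContDiffOn ℝ ∞ (onMatrices ρ) (matSet G)
  inner_map : ∀ (g : G) (v w : V), ⟪ρ g v, ρ g w⟫_ℂ = ⟪v, w⟫_ℂ

end Smooth

/-- The conformal weight operator `B^h (b ⊗ v) = ∑_μ t_μ ⊗ pr_h(t_μ ∧ b) v` on `T ⊗ V`. Here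
`Matrix.single μ ν 1` is the linear map of `T` that sends `t_ν` to `t_μ` and kills the other
basis vectors. -/
def conformalWeightOp (h : Submodule ℝ (Matrix (Fin n) (Fin n) ℝ)) (ρ : Representation ℂ G V) :
    (TSpace n ⊗[ℂ] V) →ₗ[ℂ] (TSpace n ⊗[ℂ] V) :=
  ∑ ν, ∑ μ, TensorProduct.map (Matrix.toEuclideanLin (Matrix.single μ ν (1 : ℂ)))
    (differential ρ (proj h (wedge μ ν))).toLinearMap

/-- `W` is an orthogonal decomposition of `T ⊗ V` into irreducible subrepresentations. -/
structure IsIrreducibleDecomposition {ι : Type*} {ρ : Representation ℂ G V}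
    (W : ι → Subrepresentation ((complexRep G).tprod ρ)) : Prop where
  irreducible : ∀ i, (W i).toRepresentation.IsIrreducible
  orthogonal : ∀ i j, i ≠ j → (W i).toSubmodule ⟂ (W j).toSubmodule
  iSup_eq_top : ⨆ i, (W i).toSubmodule = ⊤

/-- `b i` is the eigenvalue of the conformal weight operator on the summand `W i`. -/
def IsConformalWeights {ι : Type*} {ρ : Representation ℂ G V}
    (h : Submodule ℝ (Matrix (Fin n) (Fin n) ℝ))
    (W : ι → Subrepresentation ((complexRep G).tprod ρ)) (b : ι → ℝ) : Prop :=
  ∀ i, ∀ w ∈ (W i).toSubmodule, conformalWeightOp h ρ w = (b i : ℂ) • w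

end Algebra

/-! ### Riemannian geometry -/

section Geometry

variable {n : ℕ} {M : Type*} [TopologicalSpace M] [ChartedSpace (EuclideanSpace ℝ (Fin n)) M]

/-- The curvature `R(a, b) c = ∇_X ∇_Y Z - ∇_Y ∇_X Z - ∇_[X, Y] Z` at `x`, where `X`, `Y`, `Z` are
extensions of `a`, `b`, `c` to vector fields that are smooth near `x`. -/
def curvature [IsManifold (𝓡 n) ∞ M]
    (cov : CovariantDerivative (𝓡 n) (EuclideanSpace ℝ (Fin n))
      (TangentSpace (𝓡 n) : M → Type _))
    (x : M) (a b c : TangentSpace (𝓡 n) x) : TangentSpace (𝓡 n) x :=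
  let X : Π y : M, TangentSpace (𝓡 n) y := FiberBundle.extend (EuclideanSpace ℝ (Fin n)) a
  let Y : Π y : M, TangentSpace (𝓡 n) y := FiberBundle.extend (EuclideanSpace ℝ (Fin n)) b
  let Z : Π y : M, TangentSpace (𝓡 n) y := FiberBundle.extend (EuclideanSpace ℝ (Fin n)) c
  cov (fun y => cov Z y (Y y)) x (X x) - cov (fun y => cov Z y (X y)) x (Y x)
    - cov Z x (VectorField.mlieBracket (𝓡 n) X Y x)

/-- The frame `u · g`, with vectors `(u · g)_j = ∑_i g_ij u_i`. -/
def frameMul {x : M} (u : Fin n → TangentSpace (𝓡 n) x) (g : Matrix (Fin n) (Fin n) ℝ) :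
    Fin n → TangentSpace (𝓡 n) x :=
  fun j => ∑ i, g i j • u i

/-- `s` is a smooth frame field on the open set `U` with values in the family `P` of sets of
frames. -/
structure IsLocalSection [IsManifold (𝓡 n) ∞ M]
    (P : ∀ x : M, Set (Fin n → TangentSpace (𝓡 n) x))
    (U : Set M) (s : ∀ y : M, Fin n → TangentSpace (𝓡 n) y) : Prop where
  isOpen : IsOpen U
  mem : ∀ y ∈ U, s y ∈ P y
  contMDiffOn : ∀ j, ContMDiffOn (𝓡 n) ((𝓡 n).prod 𝓘(ℝ, EuclideanSpace ℝ (Fin n))) ∞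
    (fun y => (⟨y, s y j⟩ :
      TotalSpace (EuclideanSpace ℝ (Fin n)) (TangentSpace (𝓡 n) : M → Type _))) U

variable [RiemannianBundle (fun x : M => TangentSpace (𝓡 n) x)]

/-- The density `√det(g_ij)` of the Riemannian volume in the preferred chart at `x`. -/
def volumeDensity (x : M) (y : EuclideanSpace ℝ (Fin n)) : ℝ :=
  Real.sqrt (Matrix.det (Matrix.of fun i j : Fin n =>
    let φ := (extChartAt (𝓡 n) x).symm
    let e : Fin n → TangentSpace (𝓡 n) (φ y) := fun k =>
      mfderiv 𝓘(ℝ, EuclideanSpace ℝ (Fin n)) (𝓡 n) φ y (EuclideanSpace.single k (1 : ℝ))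
    ⟪e i, e j⟫_ℝ))

/-- The Riemannian volume measure: the smallest measure which on the domain of each chart is at
least `√det(g_ij) dx`. Since these local measures agree on overlaps, it is equal to
`√det(g_ij) dx` on each chart domain. -/
def riemannianVolume (n : ℕ) (M : Type*) [TopologicalSpace M]
    [ChartedSpace (EuclideanSpace ℝ (Fin n)) M]
    [RiemannianBundle (fun x : M => TangentSpace (𝓡 n) x)] [MeasurableSpace M] : Measure M :=
  ⨆ x : M, (((volume.restrict (extChartAt (𝓡 n) x).target).withDensity
    fun y => ENNReal.ofReal (volumeDensity x y)).map (extChartAt (𝓡 n) x).symm)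

variable [IsManifold (𝓡 n) ∞ M]

instance isContMDiffRiemannianBundle_one
    [IsContMDiffRiemannianBundle (𝓡 n) ∞ (EuclideanSpace ℝ (Fin n))
      (fun x : M => TangentSpace (𝓡 n) x)] :
    IsContMDiffRiemannianBundle (𝓡 n) 1 (EuclideanSpace ℝ (Fin n))
      (fun x : M => TangentSpace (𝓡 n) x) :=
  IsContMDiffRiemannianBundle.of_le (n := ∞) (by exact_mod_cast le_top)

/-- `cov` is the Levi-Civita connection: the metric, torsion-free (and smooth) one. -/
structure IsLeviCivita
    [IsContMDiffRiemannianBundle (𝓡 n) ∞ (EuclideanSpace ℝ (Fin n))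
      (fun x : M => TangentSpace (𝓡 n) x)]
    (cov : CovariantDerivative (𝓡 n) (EuclideanSpace ℝ (Fin n))
      (TangentSpace (𝓡 n) : M → Type _)) : Prop where
  metric : cov.IsMetricCompatible
  torsion_eq_zero : cov.torsion = 0
  smooth : CovariantDerivative.ContMDiffCovariantDerivative cov ∞

/-- The matrix `⟨s_i, ∇_a s_j⟩` at `x`: the pullback of the connection form by the orthonormal frame
field `s`, so that `∇_a s_j = ∑_i ω_ij(a) s_i`. -/
def connectionForm
    (cov : CovariantDerivative (𝓡 n) (EuclideanSpace ℝ (Fin n))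
      (TangentSpace (𝓡 n) : M → Type _))
    (s : ∀ y : M, Fin n → TangentSpace (𝓡 n) y) (x : M) (a : TangentSpace (𝓡 n) x) :
    Matrix (Fin n) (Fin n) ℝ :=
  Matrix.of fun i j => ⟪s x i, cov (fun y => s y j) x a⟫_ℝ

/-- A smooth reduction to `G ⊆ SO(n)` of the bundle of orthonormal frames of `M`, to which the
connection `cov` restricts (its connection form takes values in the Lie algebra of `G`). -/
structure ParallelReduction
    (cov : CovariantDerivative (𝓡 n) (EuclideanSpace ℝ (Fin n))
      (TangentSpace (𝓡 n) : M → Type _))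
    (G : Subgroup (Matrix.specialOrthogonalGroup (Fin n) ℝ)) where
  /-- the frames at `x` that belong to the reduction -/
  fiber : ∀ x : M, Set (Fin n → TangentSpace (𝓡 n) x)
  orthonormal : ∀ x, ∀ u ∈ fiber x, Orthonormal ℝ u
  frameMul_mem : ∀ x, ∀ u ∈ fiber x, ∀ g ∈ matSet G, frameMul u g ∈ fiber x
  transitive : ∀ x, ∀ u ∈ fiber x, ∀ v ∈ fiber x, ∃ g ∈ matSet G, v = frameMul u g
  exists_section : ∀ x : M, ∃ U s, IsLocalSection fiber U s ∧ x ∈ U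
  connectionForm_mem : ∀ U s, IsLocalSection fiber U s → ∀ x ∈ U, ∀ a : TangentSpace (𝓡 n) x,
    connectionForm cov s x a ∈ lieAlg G

variable {cov : CovariantDerivative (𝓡 n) (EuclideanSpace ℝ (Fin n))
  (TangentSpace (𝓡 n) : M → Type _)} {G : Subgroup (Matrix.specialOrthogonalGroup (Fin n) ℝ)}

/-- Functions of a frame with values in `V`; only the values on the frames of the reduction
matter. -/
abbrev FrameFun (n : ℕ) (M : Type*) [TopologicalSpace M]
    [ChartedSpace (EuclideanSpace ℝ (Fin n)) M] (V : Type*) :=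
  ∀ x : M, (Fin n → TangentSpace (𝓡 n) x) → V

variable {V : Type*} [NormedAddCommGroup V] [InnerProductSpace ℂ V]
variable {V' : Type*} [NormedAddCommGroup V'] [InnerProductSpace ℂ V']

/-- Smooth sections of the vector bundle `P ×_G V`, as `G`-equivariant smooth maps `P → V`. -/
structure IsSection (P : ParallelReduction cov G) (ρ : Representation ℂ G V)
    (ψ : FrameFun n M V) : Prop where
  equivariant : ∀ x, ∀ u ∈ P.fiber x, ∀ g : G,
    ψ x (frameMul u ((g : Matrix.specialOrthogonalGroup (Fin n) ℝ) :
      Matrix (Fin n) (Fin n) ℝ)) = ρ g⁻¹ (ψ x u)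
  smooth : ∀ U s, IsLocalSection P.fiber U s →
    ContMDiffOn (𝓡 n) 𝓘(ℝ, V) ∞ (fun y => ψ y (s y)) U

/-- The section has compact support in `M`. -/
def HasCompactSupp (P : ParallelReduction cov G) (ψ : FrameFun n M V) : Prop :=
  IsCompact (closure {x : M | ∃ u ∈ P.fiber x, ψ x u ≠ 0})

/-- Some frame of the reduction at `x`. -/
def someFrame (P : ParallelReduction cov G) (x : M) : Fin n → TangentSpace (𝓡 n) x :=
  Classical.epsilon fun u => u ∈ P.fiber x

/-- The pointwise Hermitian product of two sections. For a unitary representation it does not depend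
on the frame at which it is computed. -/
def pairing (P : ParallelReduction cov G) (ψ φ : FrameFun n M V) (x : M) : ℂ :=
  ⟪ψ x (someFrame P x), φ x (someFrame P x)⟫_ℂ

/-- `A` is the formal adjoint of the operator `D`, which maps sections of the bundle of `ρ` to
sections of the bundle of `ρ'`. -/
structure IsFormalAdjoint [MeasurableSpace M]
    (P : ParallelReduction cov G) (ρ : Representation ℂ G V)
    (ρ' : Representation ℂ G V') (D : FrameFun n M V → FrameFun n M V')
    (A : FrameFun n M V' → FrameFun n M V) : Prop where
  isSection : ∀ φ, IsSection P ρ' φ → IsSection P ρ (A φ)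
  integral_eq : ∀ φ ψ, IsSection P ρ' φ → IsSection P ρ ψ → HasCompactSupp P ψ →
    ∫ x, pairing P (D ψ) φ x ∂(riemannianVolume n M) =
      ∫ x, pairing P ψ (A φ) x ∂(riemannianVolume n M)

variable [FiniteDimensional ℂ V]

open Classical in
/-- The covariant derivative `∇_{u_μ} ψ`, seen in the frame `u` of the reduction. It is
`d(ψ ∘ s)(u_μ) + ω_s(u_μ) ψ` for a local section `s` of the reduction through `u`, whose choice
does not matter. -/
def covDeriv (P : ParallelReduction cov G) (ρ : Representation ℂ G V) (ψ : FrameFun n M V)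
    (x : M) (u : Fin n → TangentSpace (𝓡 n) x) (μ : Fin n) : V :=
  if h : ∃ s : ∀ y : M, Fin n → TangentSpace (𝓡 n) y,
      ∃ U, IsLocalSection P.fiber U s ∧ x ∈ U ∧ s x = u then
    mvfderiv (𝓡 n) (fun y => ψ y (h.choose y)) x (u μ)
      + differential ρ (connectionForm cov h.choose x (u μ)) (ψ x u)
  else 0

/-- `∇ψ = ∑_μ t_μ ⊗ ∇_{u_μ} ψ`, as a function on frames with values in `T ⊗ V`. -/
def nabla (P : ParallelReduction cov G) (ρ : Representation ℂ G V) (ψ : FrameFun n M V) :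
    FrameFun n M (TSpace n ⊗[ℂ] V) :=
  fun x u => ∑ μ, tVec μ ⊗ₜ[ℂ] covDeriv P ρ ψ x u μ

/-- The Stein-Weiss operator (generalized gradient) `ψ ↦ pr_W(∇ψ)` of a subrepresentation `W` of
`T ⊗ V`. -/
def steinWeiss (P : ParallelReduction cov G) (ρ : Representation ℂ G V)
    (W : Subrepresentation ((complexRep G).tprod ρ)) (ψ : FrameFun n M V) :
    FrameFun n M W.toSubmodule :=
  fun x u => W.toSubmodule.orthogonalProjectionOnto (nabla P ρ ψ x u)

/-- The curvature `R_{u_μ, u_ν}` in the frame `u`, with matrix `⟨u_i, R(u_μ, u_ν) u_j⟩`. -/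
def frameCurvature
    (cov : CovariantDerivative (𝓡 n) (EuclideanSpace ℝ (Fin n))
      (TangentSpace (𝓡 n) : M → Type _))
    (x : M) (u : Fin n → TangentSpace (𝓡 n) x) (μ ν : Fin n) : Matrix (Fin n) (Fin n) ℝ :=
  Matrix.of fun i j => ⟪u i, curvature cov x (u μ) (u ν) (u j)⟫_ℝ

/-- The curvature operator `Λ² → so(n)`, linear with `a ∧ b ↦ R_{a, b}`, in the frame `u`. -/
def curvatureOp
    (cov : CovariantDerivative (𝓡 n) (EuclideanSpace ℝ (Fin n))
      (TangentSpace (𝓡 n) : M → Type _))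
    (x : M) (u : Fin n → TangentSpace (𝓡 n) x) (X : Matrix (Fin n) (Fin n) ℝ) :
    Matrix (Fin n) (Fin n) ℝ :=
  (1 / 2 : ℝ) • ∑ μ, ∑ ν, soInner X (wedge μ ν) • frameCurvature cov x u μ ν

/-- The curvature endomorphism `q^h(R) = ∑_α X_α R(X_α)` acting on sections of the bundle of `ρ`, for
an orthonormal basis `X` of `h`. -/
def curvatureEndo
    (cov : CovariantDerivative (𝓡 n) (EuclideanSpace ℝ (Fin n))
      (TangentSpace (𝓡 n) : M → Type _))
    (ρ : Representation ℂ G V) {d : ℕ}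
    (X : Fin d → Matrix (Fin n) (Fin n) ℝ) (ψ : FrameFun n M V) : FrameFun n M V :=
  fun x u => ∑ α, differential ρ (X α) (differential ρ (curvatureOp cov x u (X α)) (ψ x u))

end Geometry

end Weitzenboeck

end

noncomputable section

namespace Weitzenboeck

open Filter Topology

/-! ### Closed matrix groups and their Lie algebras -/

/-! The formula is a pointwise identity between second covariant derivatives. The formal adjoint of
`ψ ↦ pr_ε ∇ψ` is `φ ↦ -∑_μ ι(u_μ) ∇_{u_μ} φ` (`codifferential`), and `pr_ε` is parallel. Since `∑
b_ε pr_ε = B`, the sum `-∑ b_ε T_ε^* T_ε ψ` equals `∑_{μ,ν} pr_h(t_μ ∧ t_ν) ∇²_{μ,ν} ψ = ∑_α X_α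
∑_{μ,ν} ⟨X_α, t_μ ∧ t_ν⟩ ∇²_{μ,ν} ψ`. The coefficients are skew in `μ, ν`, so only the commutator of
second derivatives survives. The Ricci identity `secondDeriv_sub` turns it into curvature, which
gives `∑_α X_α R(X_α)`; this is `curvatureEndo_eq`.

The algebra rests on `B = -∑_α X_α ⊗ X_α` (`contr_conformalWeightOp_eq`). An ideal is stable under
conjugation by the connected group (`conj_mem_ideal`), so the tensor `∑ X_α ⊗ X_α` is invariant
(`sum_conj_eq`) and `B` is equivariant; it is Hermitian because each `X_α` acts by skew operators.
`B` preserves each summand for one of two reasons. If the real holonomy representation is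
irreducible, `2B` is a scalar minus the Casimir operator of `T ⊗ V`. If there are no multiplicities,
the off-diagonal blocks of `B` vanish by Schur's lemma. Schur's lemma on a summand then gives a
scalar, which is real because `B` is Hermitian (`existsUnique_conformalWeights`).

For the adjoints, `⟨T_ε ψ, φ⟩ - ⟨ψ, T_ε^* φ⟩` is the divergence of a vector field
(`pairing_sub_pairing`). In a chart the Riemannian density is `1 / |det A|`, with `A` the matrix of
an orthonormal frame, and torsion-freeness identifies the coordinate divergence with the covariant
one (`sum_fderiv_frameMatrix`). The divergence theorem thus reduces to integration in `ℝ^n`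
(`integral_frameDivergence`), and a partition of unity makes it global. Formal adjoints are unique
on smooth sections (`IsFormalAdjoint.eq`), so the formula for the explicit adjoint holds for every
formal adjoint.

Throughout, `L` is a derivative of `ρ` at `1` within `G`, linear on all matrices but meaningful only
on the Lie algebra. Connection and curvature are therefore shown to take values there before `L` is
identified with the differential of `ρ`. -/

/-- If a curve in a closed multiplicative set has velocity `X` at `1`, then the one-parameter group
of `X` stays in that set. -/
theorem exp_smul_mem_of_hasDerivAt {𝔸 : Type*} [NormedRing 𝔸] [NormedAlgebra ℝ 𝔸]
    [CompleteSpace 𝔸] {S : Set 𝔸} (hS : IsClosed S) (hpow : ∀ a ∈ S, ∀ k : ℕ, a ^ k ∈ S)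
    {γ : ℝ → 𝔸} (hγ : ∀ t, γ t ∈ S) (h0 : γ 0 = 1) {X : 𝔸} (hd : HasDerivAt γ X 0) (t : ℝ) :
    NormedSpace.exp (t • X) ∈ S := by
  let _ : NormedAlgebra ℚ 𝔸 := NormedAlgebra.restrictScalars ℚ ℝ 𝔸
  -- The derivative of `exp` at `0` is the identity, so the inverse function theorem provides a
  -- local logarithm `lg` near `1`.
  have hexp : HasStrictFDerivAt (NormedSpace.exp : 𝔸 → 𝔸)
      ((ContinuousLinearEquiv.refl ℝ 𝔸 : 𝔸 ≃L[ℝ] 𝔸) : 𝔸 →L[ℝ] 𝔸) 0 := by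
    exact hasStrictFDerivAt_exp_zero (𝕂 := ℝ) (𝔸 := 𝔸)
  set lg := hexp.localInverse with hlg
  have hlg1 : HasStrictFDerivAt lg (ContinuousLinearMap.id ℝ 𝔸) 1 := by
    have := hexp.to_localInverse
    rwa [NormedSpace.exp_zero] at this
  have hlg0 : lg 1 = 0 := by
    have := hexp.localInverse_apply_image
    rwa [NormedSpace.exp_zero] at this
  have hinv : ∀ᶠ y in 𝓝 (1 : 𝔸), NormedSpace.exp (lg y) = y := by
    have := hexp.eventually_right_inverse
    rwa [NormedSpace.exp_zero] at this
  have hY : HasDerivAt (fun s => lg (γ s)) X 0 := by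
    have h1 : HasFDerivAt lg (ContinuousLinearMap.id ℝ 𝔸) (γ 0) := by
      rw [h0]; exact hlg1.hasFDerivAt
    exact h1.comp_hasDerivAt (0 : ℝ) hd
  -- `k log γ(t/k)` tends to `tX`, and its exponential is eventually `γ(t/k)^k`, which lies in the
  -- closed set.
  have hslope : Tendsto (fun k : ℕ => ((k : ℝ)) • lg (γ (t / k))) atTop (𝓝 (t • X)) := by
    have h2 : HasDerivAt (fun s : ℝ => lg (γ (t * s))) (t • X) 0 := by
      have h3 : HasDerivAt (fun s : ℝ => t * s) t 0 := by
        simpa using (hasDerivAt_id (0 : ℝ)).const_mul t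
      have h4 : HasDerivAt (fun s => lg (γ s)) X (t * 0) := by simpa using hY
      exact h4.scomp (0 : ℝ) h3
    have h5 := (hasDerivAt_iff_tendsto_slope_zero.1 h2)
    have h6 : Tendsto (fun k : ℕ => ((k : ℝ))⁻¹) atTop (𝓝[≠] 0) := by
      refine tendsto_nhdsWithin_iff.2 ⟨tendsto_inv_atTop_nhds_zero_nat, ?_⟩
      filter_upwards [eventually_gt_atTop 0] with k hk
      simp; omega
    refine (h5.comp h6).congr fun k => ?_
    simp [h0, hlg0, div_eq_mul_inv]
  have hcont : Tendsto (fun k : ℕ => NormedSpace.exp ((k : ℝ) • lg (γ (t / k)))) atTop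
      (𝓝 (NormedSpace.exp (t • X))) :=
    (NormedSpace.exp_continuous.tendsto _).comp hslope
  have htk : Tendsto (fun k : ℕ => γ (t / k)) atTop (𝓝 1) := by
    rw [← h0]
    exact hd.continuousAt.tendsto.comp (tendsto_const_div_atTop_nhds_zero_nat t)
  refine hS.mem_of_tendsto hcont ?_
  filter_upwards [htk.eventually hinv] with k hk
  have : NormedSpace.exp ((k : ℝ) • lg (γ (t / k))) = γ (t / k) ^ k := by
    rw [Nat.cast_smul_eq_nsmul, NormedSpace.exp_nsmul, hk]
  rw [this]
  exact hpow _ (hγ _) _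

section LieAlgebra

variable {n : ℕ} {G : Subgroup (Matrix.specialOrthogonalGroup (Fin n) ℝ)}

theorem one_mem_matSet : (1 : Matrix (Fin n) (Fin n) ℝ) ∈ matSet G := ⟨1, G.one_mem, rfl⟩

theorem coe_mem_matSet (g : G) :
    ((g : Matrix.specialOrthogonalGroup (Fin n) ℝ) : Matrix (Fin n) (Fin n) ℝ) ∈ matSet G :=
  ⟨g, g.2, rfl⟩

theorem mul_mem_matSet {A B : Matrix (Fin n) (Fin n) ℝ} (hA : A ∈ matSet G) (hB : B ∈ matSet G) :
    A * B ∈ matSet G := by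
  obtain ⟨a, ha, rfl⟩ := hA
  obtain ⟨b, hb, rfl⟩ := hB
  exact ⟨a * b, G.mul_mem ha hb, rfl⟩

theorem pow_mem_matSet {A : Matrix (Fin n) (Fin n) ℝ} (hA : A ∈ matSet G) (k : ℕ) :
    A ^ k ∈ matSet G := by
  induction k with
  | zero => simpa using one_mem_matSet
  | succ k ih => rw [pow_succ]; exact mul_mem_matSet ih hA

theorem transpose_mem_matSet {A : Matrix (Fin n) (Fin n) ℝ} (hA : A ∈ matSet G) :
    A.transpose ∈ matSet G := by
  obtain ⟨a, ha, rfl⟩ := hA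
  exact ⟨a⁻¹, G.inv_mem ha, rfl⟩

theorem transpose_mul_self_of_mem {A : Matrix (Fin n) (Fin n) ℝ} (hA : A ∈ matSet G) :
    A.transpose * A = 1 := by
  obtain ⟨a, ha, rfl⟩ := hA
  exact (Matrix.mem_orthogonalGroup_iff' _ _).1 (Matrix.mem_specialOrthogonalGroup_iff.1 a.2).1

theorem self_mul_transpose_of_mem {A : Matrix (Fin n) (Fin n) ℝ} (hA : A ∈ matSet G) :
    A * A.transpose = 1 := by
  obtain ⟨a, ha, rfl⟩ := hA
  exact (Matrix.mem_orthogonalGroup_iff _ _).1 (Matrix.mem_specialOrthogonalGroup_iff.1 a.2).1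

-- The Lie algebra is thereby the set of all velocities at `1` of curves in the closed group;
-- membership of sums and conjugates is then shown by exhibiting a curve.
attribute [local instance] Matrix.linftyOpNormedRing Matrix.linftyOpNormedAlgebra in
theorem mem_lieAlg_of_hasDerivAt (hG : IsClosed (matSet G))
    {γ : ℝ → Matrix (Fin n) (Fin n) ℝ} (hγ : ∀ t, γ t ∈ matSet G) (h0 : γ 0 = 1)
    {X : Matrix (Fin n) (Fin n) ℝ} (hd : HasDerivAt γ X 0) : X ∈ lieAlg G := fun t =>
  exp_smul_mem_of_hasDerivAt hG (fun _ ha k => pow_mem_matSet ha k) hγ h0 hd t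

attribute [local instance] Matrix.linftyOpNormedRing Matrix.linftyOpNormedAlgebra in
theorem hasDerivAt_exp_smul (X : Matrix (Fin n) (Fin n) ℝ) :
    HasDerivAt (fun t : ℝ => NormedSpace.exp (t • X)) X 0 := by
  let _ : NormedAlgebra ℚ (Matrix (Fin n) (Fin n) ℝ) := NormedAlgebra.restrictScalars ℚ ℝ _
  have h := hasDerivAt_exp_smul_const (𝕂 := ℝ) X (0 : ℝ)
  simp only [zero_smul, NormedSpace.exp_zero, one_mul] at h
  exact h

attribute [local instance] Matrix.linftyOpNormedRing Matrix.linftyOpNormedAlgebra in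
theorem conj_mem_lieAlg (hG : IsClosed (matSet G)) {A X : Matrix (Fin n) (Fin n) ℝ}
    (hA : A ∈ matSet G) (hX : X ∈ lieAlg G) : A * X * A.transpose ∈ lieAlg G := by
  refine mem_lieAlg_of_hasDerivAt hG
    (γ := fun t : ℝ => A * NormedSpace.exp (t • X) * A.transpose)
    (fun t => mul_mem_matSet (mul_mem_matSet hA (hX t)) (transpose_mem_matSet hA)) ?_
    (((hasDerivAt_exp_smul X).const_mul A).mul_const _)
  simp [self_mul_transpose_of_mem hA]

attribute [local instance] Matrix.linftyOpNormedRing Matrix.linftyOpNormedAlgebra in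
/-- The Lie algebra of a closed matrix group, as a subspace. -/
def lieSubmodule (hG : IsClosed (matSet G)) : Submodule ℝ (Matrix (Fin n) (Fin n) ℝ) where
  carrier := lieAlg G
  zero_mem' := fun t => by simpa using one_mem_matSet
  smul_mem' := fun c X hX t => by rw [smul_smul]; exact hX _
  add_mem' := by
    intro X Y hX hY
    refine mem_lieAlg_of_hasDerivAt hG
      (γ := fun t : ℝ => NormedSpace.exp (t • X) * NormedSpace.exp (t • Y))
      (fun t => mul_mem_matSet (hX t) (hY t)) (by simp) ?_
    have h := (hasDerivAt_exp_smul X).mul (hasDerivAt_exp_smul Y)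
    simp only [zero_smul, NormedSpace.exp_zero, one_mul, mul_one] at h
    exact h

attribute [local instance] Matrix.normedAddCommGroup Matrix.normedSpace in
theorem hasDerivAt_transpose {γ : ℝ → Matrix (Fin n) (Fin n) ℝ} {X : Matrix (Fin n) (Fin n) ℝ}
    {t : ℝ} (h : HasDerivAt γ X t) : HasDerivAt (fun s => (γ s).transpose) X.transpose t := by
  have hc : Continuous (Matrix.transposeLinearEquiv (Fin n) (Fin n) ℝ ℝ).toLinearMap :=
    continuous_id.matrix_transpose
  let T : Matrix (Fin n) (Fin n) ℝ →L[ℝ] Matrix (Fin n) (Fin n) ℝ := ⟨_, hc⟩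
  exact T.hasFDerivAt.comp_hasDerivAt t h

attribute [local instance] Matrix.linftyOpNormedRing Matrix.linftyOpNormedAlgebra in
theorem transpose_eq_neg_of_mem_lieAlg {X : Matrix (Fin n) (Fin n) ℝ} (hX : X ∈ lieAlg G) :
    X.transpose = -X := by
  have h1 := (hasDerivAt_exp_smul X).mul (hasDerivAt_transpose (hasDerivAt_exp_smul X))
  simp only [zero_smul, NormedSpace.exp_zero, one_mul, Matrix.transpose_one, mul_one] at h1
  have h2 : (fun t : ℝ => NormedSpace.exp (t • X) * (NormedSpace.exp (t • X)).transpose) =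
      fun _ => 1 := funext fun t => self_mul_transpose_of_mem (hX t)
  have h3 : HasDerivAt (fun _ : ℝ => (1 : Matrix (Fin n) (Fin n) ℝ)) (X + X.transpose) 0 := by
    rw [← h2]; exact h1
  exact (neg_eq_of_add_eq_zero_right (h3.unique (hasDerivAt_const _ _))).symm

attribute [local instance] Matrix.linftyOpNormedRing Matrix.linftyOpNormedAlgebra in
theorem hasDerivAt_conj_exp {X : Matrix (Fin n) (Fin n) ℝ} (hX : X ∈ lieAlg G)
    (Y : Matrix (Fin n) (Fin n) ℝ) :
    HasDerivAt (fun t : ℝ => NormedSpace.exp (t • X) * Y * (NormedSpace.exp (t • X)).transpose)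
      (X * Y - Y * X) 0 := by
  have h1 := ((hasDerivAt_exp_smul X).mul_const Y).mul
    (hasDerivAt_transpose (hasDerivAt_exp_smul X))
  simp only [zero_smul, NormedSpace.exp_zero, one_mul, Matrix.transpose_one, mul_one,
    transpose_eq_neg_of_mem_lieAlg hX, mul_neg, ← sub_eq_add_neg] at h1
  exact h1

/-- The derivative of a function with values in a subspace has values in that subspace. -/
theorem mem_of_hasDerivAt_of_forall_mem {E : Type*} [NormedAddCommGroup E] [NormedSpace ℝ E]
    [FiniteDimensional ℝ E] (S : Submodule ℝ E) {γ : ℝ → E} {X : E} {t : ℝ}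
    (hd : HasDerivAt γ X t) (h : ∀ s, γ s ∈ S) : X ∈ S := by
  have hS : IsClosed (S : Set E) := S.closed_of_finiteDimensional
  have h1 := hasDerivAt_iff_tendsto_slope.1 hd
  refine hS.mem_of_tendsto h1 (Eventually.of_forall fun s => ?_)
  exact S.smul_mem _ (S.sub_mem (h _) (h _))

-- The bracket is the velocity at `0` of `exp(tX) Y exp(tX)ᵀ`, a curve inside a linear subspace,
-- which is closed.
attribute [local instance] Matrix.linftyOpNormedRing Matrix.linftyOpNormedAlgebra in
theorem bracket_mem_lieAlg (hG : IsClosed (matSet G)) {X Y : Matrix (Fin n) (Fin n) ℝ}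
    (hX : X ∈ lieAlg G) (hY : Y ∈ lieAlg G) : X * Y - Y * X ∈ lieAlg G :=
  mem_of_hasDerivAt_of_forall_mem (lieSubmodule hG) (hasDerivAt_conj_exp hX Y)
    fun t => conj_mem_lieAlg hG (hX t) hY

end LieAlgebra

/-! ### The differential of a representation -/

section Differential

variable {n : ℕ} {G : Subgroup (Matrix.specialOrthogonalGroup (Fin n) ℝ)}
variable {V : Type*} [NormedAddCommGroup V] [InnerProductSpace ℂ V] [FiniteDimensional ℂ V]
variable {ρ : Representation ℂ G V}

theorem onMatrices_coe (ρ : Representation ℂ G V) (g : G) :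
    onMatrices ρ ((g : Matrix.specialOrthogonalGroup (Fin n) ℝ) : Matrix (Fin n) (Fin n) ℝ) =
      LinearMap.toContinuousLinearMap (ρ g) := by
  refine Function.Injective.extend_apply (fun a b hab => ?_) _ _ _
  exact Subtype.ext (Subtype.ext hab)

theorem onMatrices_one (ρ : Representation ℂ G V) : onMatrices ρ 1 = 1 := by
  have := onMatrices_coe ρ 1
  rw [map_one] at this
  exact this

theorem onMatrices_mul (ρ : Representation ℂ G V) {A B : Matrix (Fin n) (Fin n) ℝ}
    (hA : A ∈ matSet G) (hB : B ∈ matSet G) :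
    onMatrices ρ (A * B) = onMatrices ρ A * onMatrices ρ B := by
  obtain ⟨a, ha, rfl⟩ := hA
  obtain ⟨b, hb, rfl⟩ := hB
  have h1 := onMatrices_coe ρ ⟨a, ha⟩
  have h2 := onMatrices_coe ρ ⟨b, hb⟩
  have h3 := onMatrices_coe ρ (⟨a, ha⟩ * ⟨b, hb⟩)
  rw [map_mul] at h3
  simp only at h1 h2
  rw [h1, h2]
  exact h3

-- The smoothness of `ρ` enters only through such an `L`. Derivatives within `G` need not be unique
-- in the space of matrices, so `L` is a choice; it makes linearity of the differential automatic.
attribute [local instance] Matrix.normedAddCommGroup Matrix.normedSpace in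
theorem IsUnitaryRep.exists_hasFDerivWithinAt (hρ : IsUnitaryRep ρ) :
    ∃ L : Matrix (Fin n) (Fin n) ℝ →L[ℝ] (V →L[ℂ] V),
      HasFDerivWithinAt (onMatrices ρ) L (matSet G) 1 :=
  ⟨_, ((hρ.contDiffOn.differentiableOn (by simp)) 1 one_mem_matSet).hasFDerivWithinAt⟩

variable {L : Matrix (Fin n) (Fin n) ℝ →L[ℝ] (V →L[ℂ] V)}

attribute [local instance] Matrix.normedAddCommGroup Matrix.normedSpace in
theorem hasDerivAt_comp_of_mem {F : Type*} [NormedAddCommGroup F] [NormedSpace ℝ F]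
    {f : Matrix (Fin n) (Fin n) ℝ → F} {D : Matrix (Fin n) (Fin n) ℝ →L[ℝ] F}
    (hf : HasFDerivWithinAt f D (matSet G) 1)
    {γ : ℝ → Matrix (Fin n) (Fin n) ℝ} {X : Matrix (Fin n) (Fin n) ℝ}
    (hγ : ∀ t, γ t ∈ matSet G) (h0 : γ 0 = 1) (hd : HasDerivAt γ X 0) :
    HasDerivAt (fun t => f (γ t)) (D X) 0 := by
  rw [← h0] at hf
  rw [← hasDerivWithinAt_univ]
  exact hf.comp_hasDerivWithinAt 0 (s := Set.univ) (HasDerivAt.hasDerivWithinAt hd) fun t _ => hγ t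

theorem hasDerivAt_onMatrices (hL : HasFDerivWithinAt (onMatrices ρ) L (matSet G) 1)
    {γ : ℝ → Matrix (Fin n) (Fin n) ℝ} {X : Matrix (Fin n) (Fin n) ℝ}
    (hγ : ∀ t, γ t ∈ matSet G) (h0 : γ 0 = 1) (hd : HasDerivAt γ X 0) :
    HasDerivAt (fun t => onMatrices ρ (γ t)) (L X) 0 :=
  hasDerivAt_comp_of_mem hL hγ h0 hd

theorem differential_eq (hL : HasFDerivWithinAt (onMatrices ρ) L (matSet G) 1)
    {X : Matrix (Fin n) (Fin n) ℝ} (hX : X ∈ lieAlg G) : differential ρ X = L X :=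
  (hasDerivAt_onMatrices hL hX (by simp) (hasDerivAt_exp_smul X)).deriv

-- Two derivatives at `0` of one function are compared: `ρ(A exp(tX) Aᵀ) = ρ(A) ρ(exp(tX)) ρ(Aᵀ)`.
attribute [local instance] Matrix.linftyOpNormedRing Matrix.linftyOpNormedAlgebra in
theorem apply_conj (hL : HasFDerivWithinAt (onMatrices ρ) L (matSet G) 1)
    {A X : Matrix (Fin n) (Fin n) ℝ} (hA : A ∈ matSet G) (hX : X ∈ lieAlg G) :
    L (A * X * A.transpose) = onMatrices ρ A * L X * onMatrices ρ A.transpose := by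
  have h1 := hasDerivAt_onMatrices hL (γ := fun t : ℝ => A * NormedSpace.exp (t • X) * A.transpose)
    (fun t => mul_mem_matSet (mul_mem_matSet hA (hX t)) (transpose_mem_matSet hA))
    (by simp [self_mul_transpose_of_mem hA])
    (((hasDerivAt_exp_smul X).const_mul A).mul_const A.transpose)
  have h2 := hasDerivAt_onMatrices hL hX (by simp) (hasDerivAt_exp_smul X)
  have h3 := (h2.const_mul (onMatrices ρ A)).mul_const (onMatrices ρ A.transpose)
  refine h1.unique (h3.congr_of_eventuallyEq (Eventually.of_forall fun t => ?_))
  simp only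
  rw [onMatrices_mul ρ (mul_mem_matSet hA (hX t)) (transpose_mem_matSet hA),
    onMatrices_mul ρ hA (hX t)]

-- Differentiating `apply_conj` along `A = exp(tX)` at `t = 0` yields the bracket on both sides.
attribute [local instance] Matrix.normedAddCommGroup Matrix.normedSpace in
theorem apply_bracket (hL : HasFDerivWithinAt (onMatrices ρ) L (matSet G) 1)
    {X Y : Matrix (Fin n) (Fin n) ℝ} (hX : X ∈ lieAlg G) (hY : Y ∈ lieAlg G) :
    L (X * Y - Y * X) = L X * L Y - L Y * L X := by
  have h1 : HasDerivAt (fun t : ℝ => L (NormedSpace.exp (t • X) * Y *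
      (NormedSpace.exp (t • X)).transpose)) (L (X * Y - Y * X)) 0 :=
    L.hasFDerivAt.comp_hasDerivAt 0 (hasDerivAt_conj_exp hX Y)
  have h2 := hasDerivAt_onMatrices hL hX (by simp) (hasDerivAt_exp_smul X)
  have h3 := hasDerivAt_onMatrices hL (fun t => transpose_mem_matSet (hX t)) (by simp)
    (hasDerivAt_transpose (hasDerivAt_exp_smul X))
  have h4 := (h2.mul_const (L Y)).mul h3
  simp only [zero_smul, NormedSpace.exp_zero, Matrix.transpose_one, onMatrices_one, mul_one,
    one_mul, transpose_eq_neg_of_mem_lieAlg hX, map_neg, mul_neg, ← sub_eq_add_neg] at h4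
  refine h1.unique (h4.congr_of_eventuallyEq (Eventually.of_forall fun t => ?_))
  simp only [Pi.mul_apply]
  rw [apply_conj hL (hX t) hY]

theorem onMatrices_transpose_mul (ρ : Representation ℂ G V) {A : Matrix (Fin n) (Fin n) ℝ}
    (hA : A ∈ matSet G) : onMatrices ρ A.transpose * onMatrices ρ A = 1 := by
  rw [← onMatrices_mul ρ (transpose_mem_matSet hA) hA, transpose_mul_self_of_mem hA,
    onMatrices_one]

theorem IsUnitaryRep.inner_onMatrices (hρ : ∀ (g : G) (v w : V), ⟪ρ g v, ρ g w⟫_ℂ = ⟪v, w⟫_ℂ)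
    {A : Matrix (Fin n) (Fin n) ℝ} (hA : A ∈ matSet G) (v w : V) :
    ⟪onMatrices ρ A v, onMatrices ρ A w⟫_ℂ = ⟪v, w⟫_ℂ := by
  obtain ⟨a, ha, rfl⟩ := hA
  have h1 := onMatrices_coe ρ ⟨a, ha⟩
  simp only at h1
  rw [h1]
  exact hρ _ _ _

/-- This is the derivative at `0` of the unitarity relation along `exp(tX)`. -/
theorem inner_apply_eq_neg (hρ : ∀ (g : G) (v w : V), ⟪ρ g v, ρ g w⟫_ℂ = ⟪v, w⟫_ℂ)
    (hL : HasFDerivWithinAt (onMatrices ρ) L (matSet G) 1)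
    {X : Matrix (Fin n) (Fin n) ℝ} (hX : X ∈ lieAlg G) (v w : V) :
    ⟪L X v, w⟫_ℂ = -⟪v, L X w⟫_ℂ := by
  have h2 := hasDerivAt_onMatrices hL hX (by simp) (hasDerivAt_exp_smul X)
  have key : ∀ u : V, HasDerivAt (fun t : ℝ => onMatrices ρ (NormedSpace.exp (t • X)) u)
      (L X u) 0 := fun u =>
    (((ContinuousLinearMap.apply ℂ V u).restrictScalars ℝ).hasFDerivAt).comp_hasDerivAt 0 h2
  have h3 := (key v).inner ℂ (key w)
  simp only [zero_smul, NormedSpace.exp_zero, onMatrices_one, one_apply_eq_self] at h3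
  have h4 : HasDerivAt (fun _ : ℝ => ⟪v, w⟫_ℂ) (⟪v, L X w⟫_ℂ + ⟪L X v, w⟫_ℂ) 0 :=
    h3.congr_of_eventuallyEq (Eventually.of_forall fun t =>
      (IsUnitaryRep.inner_onMatrices hρ (hX t) v w).symm)
  exact eq_neg_of_add_eq_zero_right (h4.unique (hasDerivAt_const _ _))

end Differential

/-! ### The scalar product of `Λ²` and invariance of ideals -/

section Ideal

variable {n : ℕ} {G : Subgroup (Matrix.specialOrthogonalGroup (Fin n) ℝ)}
variable {h : Submodule ℝ (Matrix (Fin n) (Fin n) ℝ)}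
variable {d : ℕ} {X : Fin d → Matrix (Fin n) (Fin n) ℝ}

theorem soInner_eq_sum (X Y : Matrix (Fin n) (Fin n) ℝ) :
    soInner X Y = 1 / 2 * ∑ i, ∑ j, X i j * Y i j := by
  simp only [soInner, Matrix.trace, Matrix.diag, Matrix.mul_apply, Matrix.transpose_apply]
  rw [Finset.sum_comm]

theorem soInner_comm (X Y : Matrix (Fin n) (Fin n) ℝ) : soInner X Y = soInner Y X := by
  simp [soInner_eq_sum, mul_comm]

/-- The scalar product of `Λ²` as a bilinear map. -/
def soForm (n : ℕ) : Matrix (Fin n) (Fin n) ℝ →ₗ[ℝ] Matrix (Fin n) (Fin n) ℝ →ₗ[ℝ] ℝ :=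
  LinearMap.mk₂ ℝ soInner (fun A B C => by simp [soInner, Matrix.add_mul]; ring)
    (fun c A B => by simp [soInner]; ring)
    (fun A B C => by simp [soInner, Matrix.mul_add]; ring)
    (fun c A B => by simp [soInner]; ring)

theorem soForm_apply (A B : Matrix (Fin n) (Fin n) ℝ) : soForm n A B = soInner A B := rfl

theorem soInner_sum_smul_right {κ : Type*} (s : Finset κ) (A : Matrix (Fin n) (Fin n) ℝ)
    (c : κ → ℝ) (Y : κ → Matrix (Fin n) (Fin n) ℝ) :
    soInner A (∑ β ∈ s, c β • Y β) = ∑ β ∈ s, c β * soInner A (Y β) := by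
  simp [← soForm_apply]

theorem eq_zero_of_soInner_self {A : Matrix (Fin n) (Fin n) ℝ} (hA : soInner A A = 0) : A = 0 := by
  rw [soInner_eq_sum] at hA
  have h1 : ∑ i, ∑ j, A i j * A i j = 0 := by linarith
  ext i j
  have h2 := (Finset.sum_eq_zero_iff_of_nonneg
    (fun i _ => Finset.sum_nonneg fun j _ => mul_self_nonneg (A i j))).1 h1 i (Finset.mem_univ _)
  have h3 := (Finset.sum_eq_zero_iff_of_nonneg
    (fun j _ => mul_self_nonneg (A i j))).1 h2 j (Finset.mem_univ _)
  simpa using h3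

theorem IsOrthonormalBasis.mem (hX : IsOrthonormalBasis h X) (α : Fin d) : X α ∈ h := by
  rw [← hX.span_eq]
  exact Submodule.subset_span ⟨α, rfl⟩

theorem IsOrthonormalBasis.sum_smul_mem (hX : IsOrthonormalBasis h X) (c : Fin d → ℝ) :
    ∑ α, c α • X α ∈ h :=
  h.sum_mem fun α _ => h.smul_mem _ (hX.mem α)

theorem IsOrthonormalBasis.eq_sum (hX : IsOrthonormalBasis h X) {Z : Matrix (Fin n) (Fin n) ℝ}
    (hZ : Z ∈ h) : Z = ∑ α, soInner (X α) Z • X α := by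
  rw [← hX.span_eq, Submodule.mem_span_range_iff_exists_fun] at hZ
  obtain ⟨c, rfl⟩ := hZ
  refine Finset.sum_congr rfl fun α _ => ?_
  rw [soInner_sum_smul_right]
  simp [hX.inner_eq]

theorem IsOrthonormalBasis.inner_sub_sum (hX : IsOrthonormalBasis h X)
    (A : Matrix (Fin n) (Fin n) ℝ) {Z : Matrix (Fin n) (Fin n) ℝ} (hZ : Z ∈ h) :
    soInner Z (A - ∑ α, soInner (X α) A • X α) = 0 := by
  have h1 : ∀ β, soInner (X β) (A - ∑ α, soInner (X α) A • X α) = 0 := fun β => by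
    rw [← soForm_apply, map_sub, soForm_apply, soForm_apply, soInner_sum_smul_right]
    simp [hX.inner_eq]
  rw [hX.eq_sum hZ, soInner_comm, soInner_sum_smul_right]
  exact Finset.sum_eq_zero fun β _ => by rw [soInner_comm _ (X β), h1, mul_zero]

theorem IsOrthonormalBasis.soInner_eq (hX : IsOrthonormalBasis h X)
    (A : Matrix (Fin n) (Fin n) ℝ) {Z : Matrix (Fin n) (Fin n) ℝ} (hZ : Z ∈ h) :
    soInner Z A = ∑ α, soInner (X α) Z * soInner (X α) A := by
  conv_lhs => rw [hX.eq_sum hZ, soInner_comm, soInner_sum_smul_right]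
  simp [soInner_comm A]

/-- The choice in `proj` is harmless: two candidates differ by an element of `h` that is orthogonal
to `h`, and the form is definite on all matrices. -/
theorem IsOrthonormalBasis.proj_eq (hX : IsOrthonormalBasis h X) (A : Matrix (Fin n) (Fin n) ℝ) :
    proj h A = ∑ α, soInner (X α) A • X α := by
  have hex : ∃ Y, Y ∈ h ∧ ∀ Z ∈ h, soInner Z (A - Y) = 0 :=
    ⟨_, hX.sum_smul_mem _, fun Z hZ => hX.inner_sub_sum A hZ⟩
  have hspec := Classical.epsilon_spec hex
  have h1 : proj h A ∈ h := hspec.1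
  have h2 : ∀ Z ∈ h, soInner Z (A - proj h A) = 0 := hspec.2
  have h3 : proj h A - ∑ α, soInner (X α) A • X α ∈ h := h.sub_mem h1 (hX.sum_smul_mem _)
  refine sub_eq_zero.1 (eq_zero_of_soInner_self ?_)
  have h6 : proj h A - ∑ α, soInner (X α) A • X α =
    (A - ∑ α, soInner (X α) A • X α) - (A - proj h A) := by abel
  calc _ = soInner (proj h A - ∑ α, soInner (X α) A • X α)
        ((A - ∑ α, soInner (X α) A • X α) - (A - proj h A)) := by rw [← h6]
    _ = 0 := by
      rw [← soForm_apply, map_sub, soForm_apply, soForm_apply, hX.inner_sub_sum A h3, h2 _ h3,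
        sub_zero]

theorem soInner_conj (A Y Z : Matrix (Fin n) (Fin n) ℝ) :
    soInner (A * Y * A.transpose) Z = soInner Y (A.transpose * Z * A) := by
  simp only [soInner, Matrix.transpose_mul, Matrix.transpose_transpose]
  rw [Matrix.mul_assoc, Matrix.mul_assoc, Matrix.mul_assoc, Matrix.trace_mul_comm]
  simp only [Matrix.mul_assoc]

/-- Bracketing with a skew matrix is a skew operator. The expression splits into traces of `N`
against the symmetric matrices `R Rᵀ` and `Rᵀ R`, each of which vanishes. -/
theorem soInner_bracket_self {N R : Matrix (Fin n) (Fin n) ℝ} (hN : N.transpose = -N) :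
    soInner (N * R - R * N) R = 0 := by
  have key : ∀ S : Matrix (Fin n) (Fin n) ℝ, S.transpose = S → (N * S).trace = 0 := fun S hS => by
    have h1 : (N * S).trace = ((N * S).transpose).trace := (Matrix.trace_transpose _).symm
    rw [Matrix.transpose_mul, hS, hN, Matrix.mul_neg, Matrix.trace_neg,
      Matrix.trace_mul_comm S] at h1
    linarith
  have h1 := key (R * R.transpose) (by simp)
  have h2 := key (R.transpose * R) (by simp)
  simp only [soInner, Matrix.transpose_sub, Matrix.transpose_mul, hN, Matrix.sub_mul,
    Matrix.trace_sub, Matrix.mul_neg, Matrix.neg_mul, Matrix.trace_neg]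
  rw [Matrix.trace_mul_comm (R.transpose * N) R, ← Matrix.mul_assoc,
    Matrix.trace_mul_comm (R * R.transpose) N, h1, Matrix.mul_assoc N, h2]
  simp

-- The definition of connectedness uses the entrywise sup norm, while matrix products are
-- differentiated under an operator norm; only the derivatives are passed on.
attribute [local instance] Matrix.normedAddCommGroup Matrix.normedSpace in
theorem IsPathConnectedGroup.exists_path (hc : IsPathConnectedGroup G)
    {A : Matrix (Fin n) (Fin n) ℝ} (hA : A ∈ matSet G) :
    ∃ γ : ℝ → Matrix (Fin n) (Fin n) ℝ, (∀ t, ∃ γ', HasDerivAt γ γ' t) ∧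
      (∀ t, γ t ∈ matSet G) ∧ γ 0 = 1 ∧ γ 1 = A := by
  obtain ⟨γ, hγ, hmem, h0, h1⟩ := hc A hA
  exact ⟨γ, fun t => ⟨deriv γ t, ((hγ.differentiable (by simp)) t).hasDerivAt⟩, hmem, h0, h1⟩

-- Join `A` to `1` by a path `γ` and let `Z = γ Y γᵀ`, so that `Z' = [N, Z]` with `N = γ' γᵀ` in the
-- Lie algebra. The component `R` of `Z` orthogonal to `h` satisfies `(|R|²)' = 2⟨[N, R], R⟩ = 0`,
-- because `[N, Z - R]` stays in `h`. As `R` vanishes at time `0`, it vanishes at time `1`. No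
-- uniqueness theorem for differential equations is needed.
attribute [local instance] Matrix.linftyOpNormedRing Matrix.linftyOpNormedAlgebra in
theorem conj_mem_ideal (hG : IsClosed (matSet G)) (hc : IsPathConnectedGroup G)
    (hh : IsIdeal G h) (hX : IsOrthonormalBasis h X) {A Y : Matrix (Fin n) (Fin n) ℝ}
    (hA : A ∈ matSet G) (hY : Y ∈ h) : A * Y * A.transpose ∈ h := by
  obtain ⟨γ, hder, hmem, h0, h1⟩ := hc.exists_path hA
  let Z : ℝ → Matrix (Fin n) (Fin n) ℝ := fun t => γ t * Y * (γ t).transpose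
  -- `Q` is the orthogonal projection onto the complement of `h`.
  let Q : Matrix (Fin n) (Fin n) ℝ →ₗ[ℝ] Matrix (Fin n) (Fin n) ℝ :=
    LinearMap.id - ∑ α, (soForm n (X α)).smulRight (X α)
  have hQ : ∀ A, Q A = A - ∑ α, soInner (X α) A • X α := fun A => by
    simp [Q, LinearMap.sum_apply, soForm_apply]
  have hQh : ∀ A ∈ h, Q A = 0 := fun A hA => by rw [hQ, ← hX.eq_sum hA, sub_self]
  have hZ : ∀ t, ∃ N ∈ lieAlg G, HasDerivAt Z (N * Z t - Z t * N) t := by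
    intro t
    obtain ⟨γ', hγ'⟩ := hder t
    -- `γ' γᵀ` is the velocity at `s = 0` of `γ(t + s) γ(t)ᵀ`, a curve in `G` that starts at `1`.
    have hN : γ' * (γ t).transpose ∈ lieAlg G := by
      refine mem_lieAlg_of_hasDerivAt hG (γ := fun s => γ (t + s) * (γ t).transpose)
        (fun s => mul_mem_matSet (hmem _) (transpose_mem_matSet (hmem _)))
        (by simp [self_mul_transpose_of_mem (hmem t)]) ?_
      have h3 : HasDerivAt (fun s => γ (t + s)) γ' 0 := by
        have := HasDerivAt.comp_const_add t 0 (f := γ) (f' := γ') (by rw [add_zero]; exact hγ')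
        exact this
      exact h3.mul_const _
    refine ⟨_, hN, ?_⟩
    have h4 := (hγ'.mul_const Y).mul (hasDerivAt_transpose hγ')
    have hskew := transpose_eq_neg_of_mem_lieAlg hN
    rw [Matrix.transpose_mul, Matrix.transpose_transpose] at hskew
    have e1 : γ' * (γ t).transpose * Z t = γ' * Y * (γ t).transpose := by
      simp only [Z]
      rw [Matrix.mul_assoc, Matrix.mul_assoc (γ t), ← Matrix.mul_assoc _ (γ t),
        transpose_mul_self_of_mem (hmem t), Matrix.one_mul, Matrix.mul_assoc]
    have e2 : Z t * (γ' * (γ t).transpose) = -(γ t * Y * γ'.transpose) := by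
      rw [eq_neg_iff_add_eq_zero, ← neg_eq_iff_add_eq_zero, ← Matrix.mul_neg, ← hskew]
      simp only [Z]
      rw [Matrix.mul_assoc, ← Matrix.mul_assoc _ (γ t),
        transpose_mul_self_of_mem (hmem t), Matrix.one_mul]
    rw [e1, e2, sub_neg_eq_add]
    exact h4
  have hp : ∀ t, HasDerivAt (fun t => soInner (Q (Z t)) (Q (Z t))) 0 t := by
    intro t
    obtain ⟨N, hN, hd⟩ := hZ t
    have hd2 : HasDerivAt (fun t => Q (Z t)) (Q (N * Z t - Z t * N)) t :=
      (LinearMap.toContinuousLinearMap Q).hasFDerivAt.comp_hasDerivAt t hd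
    have hij : ∀ i j, HasDerivAt (fun t => Q (Z t) i j) (Q (N * Z t - Z t * N) i j) t :=
      fun i j => (hasDerivAt_pi.1 ((hasDerivAt_pi.1 hd2) i)) j
    have hs : HasDerivAt (fun t => 1 / 2 * ∑ i, ∑ j, Q (Z t) i j * Q (Z t) i j)
        (1 / 2 * ∑ i, ∑ j, (Q (N * Z t - Z t * N) i j * Q (Z t) i j +
          Q (Z t) i j * Q (N * Z t - Z t * N) i j)) t :=
      (HasDerivAt.fun_sum fun i _ => HasDerivAt.fun_sum fun j _ =>
        (hij i j).mul (hij i j)).const_mul _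
    have e : 1 / 2 * ∑ i, ∑ j, (Q (N * Z t - Z t * N) i j * Q (Z t) i j +
        Q (Z t) i j * Q (N * Z t - Z t * N) i j) =
        2 * soInner (Q (N * Z t - Z t * N)) (Q (Z t)) := by
      rw [soInner_eq_sum]
      simp only [Finset.mul_sum]
      refine Finset.sum_congr rfl fun i _ => Finset.sum_congr rfl fun j _ => by ring
    have e2 : soInner (Q (N * Z t - Z t * N)) (Q (Z t)) = 0 := by
      set R := Q (Z t) with hR
      have hZR : Z t - R ∈ h := by
        rw [hR, hQ, sub_sub_cancel]; exact hX.sum_smul_mem _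
      have hperp : ∀ B ∈ h, soInner B R = 0 := fun B hB => by
        rw [hR, hQ]; exact hX.inner_sub_sum _ hB
      have e3 : N * Z t - Z t * N = (N * R - R * N) + (N * (Z t - R) - (Z t - R) * N) := by
        rw [Matrix.mul_sub, Matrix.sub_mul]; abel
      rw [e3, map_add, hQh _ (hh.bracket_mem N hN _ hZR), add_zero, hQ, ← soForm_apply, map_sub,
        LinearMap.sub_apply, soForm_apply, soForm_apply,
        soInner_bracket_self (transpose_eq_neg_of_mem_lieAlg hN), hperp _ (hX.sum_smul_mem _),
        sub_zero]
    rw [e, e2, mul_zero] at hs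
    exact hs.congr_of_eventuallyEq (Eventually.of_forall fun t => soInner_eq_sum _ _)
  have hconst := is_const_of_deriv_eq_zero (fun t => (hp t).differentiableAt)
    (fun t => (hp t).deriv) 1 0
  have hZ0 : Q (Z 0) = 0 := hQh _ (by simpa [Z, h0] using hY)
  have h00 : soInner (0 : Matrix (Fin n) (Fin n) ℝ) 0 = 0 := by simp [soInner]
  simp only [hZ0, h00] at hconst
  have h7 := eq_zero_of_soInner_self hconst
  rw [hQ, sub_eq_zero] at h7
  have h8 : Z 1 ∈ h := by rw [h7]; exact hX.sum_smul_mem _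
  simpa [Z, h1] using h8

/-- The Casimir tensor `∑ X_α ⊗ X_α` of an ideal is invariant under the group. -/
theorem sum_conj_eq (hG : IsClosed (matSet G)) (hc : IsPathConnectedGroup G)
    (hh : IsIdeal G h) (hX : IsOrthonormalBasis h X) {A : Matrix (Fin n) (Fin n) ℝ}
    (hA : A ∈ matSet G) {E : Type*} [AddCommGroup E] [Module ℝ E]
    (F : Matrix (Fin n) (Fin n) ℝ →ₗ[ℝ] Matrix (Fin n) (Fin n) ℝ →ₗ[ℝ] E) :
    ∑ α, F (A * X α * A.transpose) (A * X α * A.transpose) = ∑ α, F (X α) (X α) := by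
  have h1 : ∀ α, A * X α * A.transpose =
      ∑ β, soInner (X β) (A * X α * A.transpose) • X β := fun α =>
    hX.eq_sum (conj_mem_ideal hG hc hh hX hA (hX.mem α))
  have h2 : ∀ α, F (A * X α * A.transpose) (A * X α * A.transpose) = ∑ β, ∑ γ,
      (soInner (X α) (A.transpose * X β * A) * soInner (X α) (A.transpose * X γ * A)) •
        F (X β) (X γ) := fun α => by
    conv_lhs => rw [h1 α]
    simp only [map_sum, map_smul, LinearMap.sum_apply, LinearMap.smul_apply, Finset.smul_sum,
      smul_smul]
    rw [Finset.sum_comm]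
    refine Finset.sum_congr rfl fun β _ => Finset.sum_congr rfl fun γ _ => ?_
    rw [soInner_comm (X β), soInner_conj, soInner_comm (X γ), soInner_conj, mul_comm]
  rw [Finset.sum_congr rfl fun α _ => h2 α, Finset.sum_comm]
  refine Finset.sum_congr rfl fun β _ => ?_
  rw [Finset.sum_comm]
  -- Parseval in `h` applies to the conjugates `Aᵀ X_β A`, which lie in `h`; conjugation is an
  -- isometry, so their Gram matrix is again the identity.
  have h3 : ∀ γ, ∑ α, (soInner (X α) (A.transpose * X β * A) *
      soInner (X α) (A.transpose * X γ * A)) • F (X β) (X γ) =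
      (if β = γ then (1 : ℝ) else 0) • F (X β) (X γ) := fun γ => by
    rw [← Finset.sum_smul, ← hX.inner_eq β γ]
    congr 1
    have hm : A.transpose * X β * A ∈ h := by
      have := conj_mem_ideal hG hc hh hX (transpose_mem_matSet hA) (hX.mem β)
      rwa [Matrix.transpose_transpose] at this
    have e : A * (A.transpose * X γ * A) * A.transpose = X γ := by
      rw [Matrix.mul_assoc A.transpose, ← Matrix.mul_assoc A, self_mul_transpose_of_mem hA,
        Matrix.one_mul, Matrix.mul_assoc, self_mul_transpose_of_mem hA, Matrix.mul_one]
    rw [← hX.soInner_eq _ hm, soInner_comm, ← soInner_conj A, e, soInner_comm]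
  simp [h3]

end Ideal

/-! ### Coordinates on `T ⊗ V` -/

section Tensor

variable {n : ℕ} {G : Subgroup (Matrix.specialOrthogonalGroup (Fin n) ℝ)}
variable {V : Type*} [NormedAddCommGroup V] [InnerProductSpace ℂ V]

/-- The component of an element of `T ⊗ V` at the basis vector `t_μ`. -/
def contr (μ : Fin n) : (TSpace n ⊗[ℂ] V) →ₗ[ℂ] V :=
  TensorProduct.lid ℂ V ∘ₗ
    LinearMap.rTensor V (EuclideanSpace.proj μ : TSpace n →L[ℂ] ℂ).toLinearMap

@[simp]
theorem contr_tmul (μ : Fin n) (t : TSpace n) (v : V) : contr μ (t ⊗ₜ[ℂ] v) = t μ • v := by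
  simp [contr]

theorem contr_tVec_tmul (μ ν : Fin n) (v : V) :
    contr μ (tVec ν ⊗ₜ[ℂ] v) = if μ = ν then v else 0 := by
  simp [tVec, ite_smul]

theorem sum_tVec_contr (w : TSpace n ⊗[ℂ] V) : ∑ μ, tVec μ ⊗ₜ[ℂ] contr μ w = w := by
  induction w with
  | zero => simp
  | add a b ha hb => simp only [map_add, TensorProduct.tmul_add, Finset.sum_add_distrib, ha, hb]
  | tmul t v =>
    simp only [contr_tmul, TensorProduct.tmul_smul, TensorProduct.smul_tmul']
    rw [← TensorProduct.sum_tmul]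
    congr 1
    ext κ
    simp [tVec, Finset.sum_apply, Pi.single_apply]

theorem contr_sum_tVec (μ : Fin n) (v : Fin n → V) :
    contr μ (∑ ν, tVec ν ⊗ₜ[ℂ] v ν) = v μ := by
  simp only [map_sum, contr_tVec_tmul]
  simp

theorem ext_contr {w w' : TSpace n ⊗[ℂ] V} (h : ∀ μ, contr μ w = contr μ w') : w = w' := by
  rw [← sum_tVec_contr w, ← sum_tVec_contr w']
  simp [h]

theorem contr_map (M : Matrix (Fin n) (Fin n) ℂ) (f : V →ₗ[ℂ] V) (μ : Fin n)
    (w : TSpace n ⊗[ℂ] V) :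
    contr μ (TensorProduct.map (Matrix.toEuclideanLin M) f w) =
      ∑ ν, M μ ν • f (contr ν w) := by
  induction w with
  | zero => simp
  | add a b ha hb => simp only [map_add, ha, hb, smul_add, Finset.sum_add_distrib]
  | tmul t v =>
    simp [Matrix.toEuclideanLin, Matrix.toLpLin_apply, Matrix.mulVec, dotProduct, Finset.sum_smul,
      smul_smul]

theorem inner_eq_sum_contr (w w' : TSpace n ⊗[ℂ] V) :
    ⟪w, w'⟫_ℂ = ∑ μ, ⟪contr μ w, contr μ w'⟫_ℂ := by
  conv_lhs => rw [← sum_tVec_contr w, ← sum_tVec_contr w']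
  simp [sum_inner, inner_sum, TensorProduct.inner_tmul, tVec, EuclideanSpace.inner_single_left]

theorem contr_tprod (ρ : Representation ℂ G V) (g : G) (μ : Fin n) (w : TSpace n ⊗[ℂ] V) :
    contr μ ((complexRep G).tprod ρ g w) =
      ∑ ν, (((g : Matrix.specialOrthogonalGroup (Fin n) ℝ) : Matrix (Fin n) (Fin n) ℝ) μ ν) •
        ρ g (contr ν w) := by
  rw [Representation.tprod_apply]
  refine (contr_map _ (ρ g) μ w).trans ?_
  simp

/-- The infinitesimal action of a matrix `X` on `T ⊗ V`, if `X` acts on `V` by `f`. -/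
def tensorAct (X : Matrix (Fin n) (Fin n) ℝ) (f : V →L[ℂ] V) :
    (TSpace n ⊗[ℂ] V) →ₗ[ℂ] (TSpace n ⊗[ℂ] V) :=
  TensorProduct.map (Matrix.toEuclideanLin (X.map Complex.ofRealHom)) LinearMap.id +
    TensorProduct.map LinearMap.id f.toLinearMap

theorem contr_map_id (f : V →ₗ[ℂ] V) (μ : Fin n) (w : TSpace n ⊗[ℂ] V) :
    contr μ (TensorProduct.map LinearMap.id f w) = f (contr μ w) := by
  have : (LinearMap.id : TSpace n →ₗ[ℂ] TSpace n) = Matrix.toEuclideanLin 1 := by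
    ext; simp
  rw [this, contr_map]
  simp [Matrix.one_apply]

theorem contr_tensorAct (X : Matrix (Fin n) (Fin n) ℝ) (f : V →L[ℂ] V) (μ : Fin n)
    (w : TSpace n ⊗[ℂ] V) :
    contr μ (tensorAct X f w) = ∑ ν, X μ ν • contr ν w + f (contr μ w) := by
  simp [tensorAct, contr_map, contr_map_id]

theorem contr_conformalWeightOp [FiniteDimensional ℂ V] {h : Submodule ℝ (Matrix (Fin n) (Fin n) ℝ)}
    (ρ : Representation ℂ G V) (μ : Fin n) (w : TSpace n ⊗[ℂ] V) :
    contr μ (conformalWeightOp h ρ w) =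
      ∑ ν, differential ρ (proj h (wedge μ ν)) (contr ν w) := by
  simp only [conformalWeightOp, LinearMap.sum_apply, map_sum, contr_map, Matrix.single_apply]
  refine Finset.sum_congr rfl fun ν _ => ?_
  rw [Finset.sum_eq_single μ]
  · rw [Finset.sum_eq_single ν]
    · simp
    · intro κ _ hκ; simp [Ne.symm hκ]
    · simp
  · intro κ _ hκ
    simp [hκ]
  · simp

/-! ### The conformal weight operator -/

variable [FiniteDimensional ℂ V] {ρ : Representation ℂ G V}
variable {h : Submodule ℝ (Matrix (Fin n) (Fin n) ℝ)} {d : ℕ}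
  {X : Fin d → Matrix (Fin n) (Fin n) ℝ}
  {L : Matrix (Fin n) (Fin n) ℝ →L[ℝ] (V →L[ℂ] V)}

/-- The transposed indices on the right produce the minus sign in `contr_conformalWeightOp_eq`. -/
theorem soInner_wedge {X : Matrix (Fin n) (Fin n) ℝ} (hX : X.transpose = -X) (μ ν : Fin n) :
    soInner X (wedge μ ν) = X ν μ := by
  have h1 : X μ ν = -X ν μ := by
    have := congrFun (congrFun hX ν) μ
    simpa using this
  have h2 : ∀ κ ν' : Fin n, ∑ i, ∑ j, X i j * Matrix.single κ ν' (1 : ℝ) i j = X κ ν' := by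
    intro κ ν'
    rw [Finset.sum_eq_single κ, Finset.sum_eq_single ν']
    · simp
    · intro j _ hj; simp [Ne.symm hj]
    · simp
    · intro i _ hi; simp [Ne.symm hi]
    · simp
  simp only [soInner_eq_sum, wedge, Matrix.sub_apply, mul_sub, Finset.sum_sub_distrib, h2, h1]
  ring

theorem IsIdeal.transpose_eq (hh : IsIdeal G h) (hX : IsOrthonormalBasis h X) (α : Fin d) :
    (X α).transpose = -X α :=
  transpose_eq_neg_of_mem_lieAlg (hh.subset _ (hX.mem α))

theorem differential_proj_wedge (hh : IsIdeal G h)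
    (hX : IsOrthonormalBasis h X) (hL : HasFDerivWithinAt (onMatrices ρ) L (matSet G) 1)
    (μ ν : Fin n) :
    differential ρ (proj h (wedge μ ν)) = ∑ α, soInner (X α) (wedge μ ν) • L (X α) := by
  rw [differential_eq hL, hX.proj_eq]
  · simp
  · exact hh.subset _ (by rw [hX.proj_eq]; exact hX.sum_smul_mem _)

/-- Expanding the projection in the basis gives `B = -∑_α X_α ⊗ X_α`. Hermitian symmetry,
equivariance and the relation to Casimir operators are all derived from this form. -/
theorem contr_conformalWeightOp_eq (hh : IsIdeal G h)
    (hX : IsOrthonormalBasis h X) (hL : HasFDerivWithinAt (onMatrices ρ) L (matSet G) 1)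
    (μ : Fin n) (w : TSpace n ⊗[ℂ] V) :
    contr μ (conformalWeightOp h ρ w) =
      -∑ α, ∑ ν, X α μ ν • L (X α) (contr ν w) := by
  rw [contr_conformalWeightOp, Finset.sum_comm, ← Finset.sum_neg_distrib]
  refine Finset.sum_congr rfl fun ν _ => ?_
  rw [differential_proj_wedge hh hX hL, sum_apply, ← Finset.sum_neg_distrib]
  refine Finset.sum_congr rfl fun α _ => ?_
  have h1 : X α ν μ = -X α μ ν := by
    have := congrFun (congrFun (hh.transpose_eq hX α) μ) ν
    simpa using this
  rw [smul_apply, soInner_wedge (hh.transpose_eq hX α), h1, neg_smul]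

/-- The conformal weight operator is Hermitian. -/
theorem inner_conformalWeightOp (hh : IsIdeal G h)
    (hX : IsOrthonormalBasis h X) (hρ : ∀ (g : G) (v w : V), ⟪ρ g v, ρ g w⟫_ℂ = ⟪v, w⟫_ℂ)
    (hL : HasFDerivWithinAt (onMatrices ρ) L (matSet G) 1) (w w' : TSpace n ⊗[ℂ] V) :
    ⟪conformalWeightOp h ρ w, w'⟫_ℂ = ⟪w, conformalWeightOp h ρ w'⟫_ℂ := by
  simp only [inner_eq_sum_contr, contr_conformalWeightOp_eq hh hX hL, inner_neg_left,
    inner_neg_right, sum_inner, inner_sum]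
  simp only [Finset.sum_neg_distrib]
  congr 1
  rw [Finset.sum_comm, Finset.sum_comm (s := (Finset.univ : Finset (Fin n)))]
  refine Finset.sum_congr rfl fun α _ => ?_
  rw [Finset.sum_comm]
  refine Finset.sum_congr rfl fun μ _ => Finset.sum_congr rfl fun ν _ => ?_
  have h1 : X α ν μ = -X α μ ν := by
    have := congrFun (congrFun (hh.transpose_eq hX α) μ) ν
    simpa using this
  rw [h1, neg_smul, inner_neg_left, ← Complex.coe_smul, ← Complex.coe_smul, inner_smul_left,
    inner_smul_right, inner_apply_eq_neg hρ hL (hh.subset _ (hX.mem α))]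
  simp

/-- The conformal weight operator is `G`-equivariant. -/
theorem conformalWeightOp_tprod (hG : IsClosed (matSet G)) (hc : IsPathConnectedGroup G)
    (hh : IsIdeal G h)
    (hX : IsOrthonormalBasis h X) (hL : HasFDerivWithinAt (onMatrices ρ) L (matSet G) 1) (g : G)
    (w : TSpace n ⊗[ℂ] V) :
    conformalWeightOp h ρ ((complexRep G).tprod ρ g w) =
      (complexRep G).tprod ρ g (conformalWeightOp h ρ w) := by
  refine ext_contr fun μ => ?_
  rw [contr_tprod, contr_conformalWeightOp_eq hh hX hL]
  set A : Matrix (Fin n) (Fin n) ℝ := ((g : Matrix.specialOrthogonalGroup (Fin n) ℝ) :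
    Matrix (Fin n) (Fin n) ℝ) with hA
  have hAm : A ∈ matSet G := coe_mem_matSet g
  have hρA : ∀ v, ρ g v = onMatrices ρ A v := fun v => by
    rw [hA, onMatrices_coe]; rfl
  -- The bilinear form to which the invariance of `∑ X_α ⊗ X_α` is applied. After `X_α` is replaced
  -- by its conjugate, the matrix `A` and the operator `ρ(A)` cancel against those acting on `w`.
  let F : (Fin n → V) → Matrix (Fin n) (Fin n) ℝ →ₗ[ℝ] Matrix (Fin n) (Fin n) ℝ →ₗ[ℝ] V :=
    fun u => LinearMap.mk₂ ℝ (fun Y Z => ∑ ν, Y μ ν • L Z (u ν))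
      (fun Y Y' Z => by simp [add_smul, Finset.sum_add_distrib])
      (fun c Y Z => by simp [Finset.smul_sum, smul_smul])
      (fun Y Z Z' => by simp [Finset.sum_add_distrib])
      (fun c Y Z => by simp [Finset.smul_sum, smul_smul, mul_comm])
  have key := sum_conj_eq hG hc hh hX hAm (F fun ν => contr ν ((complexRep G).tprod ρ g w))
  simp only [F, LinearMap.mk₂_apply] at key
  rw [← key]
  simp only [contr_conformalWeightOp_eq hh hX hL, map_neg, smul_neg, Finset.sum_neg_distrib]
  congr 1
  simp only [map_sum, Finset.smul_sum]
  rw [Finset.sum_comm (s := (Finset.univ : Finset (Fin n))) (t := (Finset.univ : Finset (Fin d)))]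
  refine Finset.sum_congr rfl fun α _ => ?_
  have hρinv : ∀ v, onMatrices ρ A.transpose (onMatrices ρ A v) = v := fun v => by
    rw [← mul_apply_eq_comp, onMatrices_transpose_mul ρ hAm, one_apply_eq_self]
  have hent : ∀ κ, ∑ ν, (A * X α * A.transpose) μ ν * A ν κ = ∑ ν, A μ ν * X α ν κ := by
    intro κ
    rw [← Matrix.mul_apply, ← Matrix.mul_apply, Matrix.mul_assoc, transpose_mul_self_of_mem hAm,
      Matrix.mul_one]
  simp only [apply_conj hL hAm (hh.subset _ (hX.mem α)), contr_tprod, map_sum, ← hA, hρA,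
    mul_apply_eq_comp, ContinuousLinearMap.map_smul_of_tower, hρinv, Finset.smul_sum,
    smul_smul]
  rw [Finset.sum_comm]
  conv_rhs => rw [Finset.sum_comm]
  refine Finset.sum_congr rfl fun κ _ => ?_
  rw [← Finset.sum_smul, hent κ, Finset.sum_smul]

/-- Over `ℝ` a commuting map need not be a scalar. A symmetric matrix, however, has a real
eigenvalue, and its eigenspace is a nonzero invariant subspace, hence the whole space. -/
theorem exists_eq_smul_of_irreducible_real
    (hirr : (realRep G).IsIrreducible) (S : Matrix (Fin n) (Fin n) ℝ) (hS : S.transpose = S)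
    (hcomm : ∀ A ∈ matSet G, A * S = S * A) : ∃ c : ℝ, S = c • 1 := by
  have := hirr
  have hne : (⊥ : Subrepresentation (realRep G)) ≠ ⊤ := bot_ne_top
  -- Irreducibility excludes `n = 0`, where there is no eigenvector to choose.
  have hn : Nonempty (Fin n) := by
    by_contra hcon
    rw [not_nonempty_iff] at hcon
    refine hne (Subrepresentation.toSubmodule_injective ?_)
    exact Subsingleton.elim _ _
  have hH : S.IsHermitian := by
    rw [Matrix.IsHermitian, Matrix.conjTranspose_eq_transpose_of_trivial, hS]
  obtain ⟨i⟩ := hn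
  set c := hH.eigenvalues i
  have hv := hH.mulVec_eigenvectorBasis i
  set v : Fin n → ℝ := ⇑(hH.eigenvectorBasis i)
  have hv0 : v ≠ 0 := fun h0 => by
    have h1 := hH.eigenvectorBasis.orthonormal.ne_zero i
    exact h1 (PiLp.ext fun j => congrFun h0 j)
  let E : Subrepresentation (realRep G) :=
    { toSubmodule := LinearMap.ker (Matrix.toLin' S - c • LinearMap.id)
      apply_mem_toSubmodule := by
        intro g w hw
        rw [LinearMap.mem_ker] at hw ⊢
        have e1 : Matrix.toLin' S w = c • w := by
          simpa [sub_eq_zero] using hw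
        have e2 := congrArg (fun M => Matrix.toLin' M w) (hcomm _ (coe_mem_matSet g))
        simp only [Matrix.toLin'_mul, LinearMap.comp_apply, e1, map_smul] at e2
        simp only [LinearMap.sub_apply, LinearMap.smul_apply, LinearMap.id_apply, sub_eq_zero]
        exact e2.symm }
  have hE : E = ⊤ := by
    refine (eq_bot_or_eq_top E).resolve_left fun hE => hv0 ?_
    have h1 : v ∈ E.toSubmodule := by
      simp only [E, LinearMap.mem_ker, LinearMap.sub_apply, LinearMap.smul_apply,
        LinearMap.id_apply, Matrix.toLin'_apply, sub_eq_zero]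
      exact hv
    rw [hE] at h1
    exact h1
  refine ⟨c, ?_⟩
  have h2 : ∀ w, S.mulVec w = c • w := fun w => by
    have h1 : w ∈ E.toSubmodule := by rw [hE]; trivial
    simpa only [E, LinearMap.mem_ker, LinearMap.sub_apply, LinearMap.smul_apply,
        LinearMap.id_apply, Matrix.toLin'_apply, sub_eq_zero] using h1
  ext i j
  have := congrFun (h2 (Pi.single j 1)) i
  simpa [Matrix.one_apply, Pi.single_apply] using this

/-- Schur's lemma over `ℂ`. -/
theorem exists_eq_smul_of_irreducible {U : Type*} [AddCommGroup U] [Module ℂ U]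
    [FiniteDimensional ℂ U] {σ : Representation ℂ G U} (hσ : σ.IsIrreducible) (f : U →ₗ[ℂ] U)
    (hf : ∀ g u, f (σ g u) = σ g (f u)) : ∃ c : ℂ, ∀ u, f u = c • u := by
  have := hσ
  have hb := Representation.IsIrreducible.algebraMap_intertwiningMap_bijective_of_isAlgClosed
    (ρ := σ)
  obtain ⟨c, hc⟩ := hb.2 (f.intertwiningMap_of_isIntertwiningMap σ σ hf)
  refine ⟨c, fun u => ?_⟩
  have := congrArg (fun F => F u) hc
  exact this.symm

/-- The Casimir operator of an ideal acts on an irreducible representation as a scalar. -/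
theorem exists_casimir_eq_smul (hG : IsClosed (matSet G)) (hc : IsPathConnectedGroup G)
    (hh : IsIdeal G h) (hX : IsOrthonormalBasis h X)
    (hL : HasFDerivWithinAt (onMatrices ρ) L (matSet G) 1) (hirr : ρ.IsIrreducible) :
    ∃ c : ℂ, ∀ v, ∑ α, L (X α) (L (X α) v) = c • v := by
  suffices hcomm : ∀ g v, (∑ α, (L (X α) * L (X α)).toLinearMap) (ρ g v) =
      ρ g ((∑ α, (L (X α) * L (X α)).toLinearMap) v) by
    obtain ⟨c, hc'⟩ := exists_eq_smul_of_irreducible hirr _ hcomm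
    refine ⟨c, fun v => ?_⟩
    rw [← hc', LinearMap.sum_apply]
    rfl
  intro g v
  set A : Matrix (Fin n) (Fin n) ℝ := ((g : Matrix.specialOrthogonalGroup (Fin n) ℝ) :
    Matrix (Fin n) (Fin n) ℝ) with hA
  have hAm : A ∈ matSet G := coe_mem_matSet g
  have hρA : ∀ v, ρ g v = onMatrices ρ A v := fun v => by
    rw [hA, onMatrices_coe]; rfl
  let F : Matrix (Fin n) (Fin n) ℝ →ₗ[ℝ] Matrix (Fin n) (Fin n) ℝ →ₗ[ℝ] (V →L[ℂ] V) :=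
    LinearMap.mk₂ ℝ (fun Y Z => L Y * L Z)
      (fun Y Y' Z => by simp [add_mul]) (fun c Y Z => by ext; simp)
      (fun Y Z Z' => by simp [mul_add]) (fun c Y Z => by ext; simp)
  -- Invariance replaces each `X_α` by its conjugate, after which `apply_conj` moves `ρ(g)` past the
  -- sum of squares.
  have key := congrArg (fun f : V →L[ℂ] V => f (ρ g v)) (sum_conj_eq hG hc hh hX hAm F)
  simp only [F, LinearMap.mk₂_apply, sum_apply] at key
  have hρinv : ∀ v, onMatrices ρ A.transpose (onMatrices ρ A v) = v := fun v => by
    rw [← mul_apply_eq_comp, onMatrices_transpose_mul ρ hAm, one_apply_eq_self]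
  simp only [LinearMap.sum_apply, ContinuousLinearMap.coe_coe, ← key, map_sum]
  refine Finset.sum_congr rfl fun α _ => ?_
  simp only [apply_conj hL hAm (hh.subset _ (hX.mem α)), hρA, mul_apply_eq_comp, hρinv]

end Tensor

/-! ### Conformal weights -/

section Weights

variable {n : ℕ} {G : Subgroup (Matrix.specialOrthogonalGroup (Fin n) ℝ)}
variable {V : Type*} [NormedAddCommGroup V] [InnerProductSpace ℂ V]
variable {ρ : Representation ℂ G V}
variable {h : Submodule ℝ (Matrix (Fin n) (Fin n) ℝ)} {d : ℕ}
  {X : Fin d → Matrix (Fin n) (Fin n) ℝ}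
  {L : Matrix (Fin n) (Fin n) ℝ →L[ℝ] (V →L[ℂ] V)}

/-- The Kronecker delta keeps the shape that the product rule gives for `A_μν ρ(A)` at `A = 1`, so
the result can be matched with the derivative of `tprod_eq_sum`. -/
theorem tensorAct_eq_sum (Y : Matrix (Fin n) (Fin n) ℝ) (f : V →L[ℂ] V) (w : TSpace n ⊗[ℂ] V) :
    tensorAct Y f w = ∑ μ, ∑ ν, tVec μ ⊗ₜ[ℂ]
      (Y μ ν • contr ν w + (1 : Matrix (Fin n) (Fin n) ℝ) μ ν • f (contr ν w)) := by
  rw [← sum_tVec_contr (tensorAct Y f w)]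
  simp only [contr_tensorAct, TensorProduct.tmul_add, TensorProduct.tmul_sum,
    Finset.sum_add_distrib]
  congr 1
  refine Finset.sum_congr rfl fun μ _ => ?_
  rw [Finset.sum_eq_single μ]
  · simp
  · intro ν _ hν; simp [Ne.symm hν]
  · simp

theorem inner_tprod (hρ : ∀ (g : G) (v w : V), ⟪ρ g v, ρ g w⟫_ℂ = ⟪v, w⟫_ℂ) (g : G)
    (w w' : TSpace n ⊗[ℂ] V) :
    ⟪(complexRep G).tprod ρ g w, (complexRep G).tprod ρ g w'⟫_ℂ = ⟪w, w'⟫_ℂ := by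
  have h1 := transpose_mul_self_of_mem (coe_mem_matSet g)
  simp only [inner_eq_sum_contr, contr_tprod, sum_inner, inner_sum]
  have h2 : ∀ μ ν κ, ⟪((g : Matrix.specialOrthogonalGroup (Fin n) ℝ) :
        Matrix (Fin n) (Fin n) ℝ) μ ν • ρ g (contr ν w),
      ((g : Matrix.specialOrthogonalGroup (Fin n) ℝ) :
        Matrix (Fin n) (Fin n) ℝ) μ κ • ρ g (contr κ w')⟫_ℂ =
      ((((g : Matrix.specialOrthogonalGroup (Fin n) ℝ) : Matrix (Fin n) (Fin n) ℝ) μ ν *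
        ((g : Matrix.specialOrthogonalGroup (Fin n) ℝ) : Matrix (Fin n) (Fin n) ℝ) μ κ : ℝ) : ℂ) *
      ⟪contr ν w, contr κ w'⟫_ℂ := by
    intro μ ν κ
    rw [← Complex.coe_smul, ← Complex.coe_smul (_ : ℝ) (ρ g (contr κ w')), inner_smul_left,
      inner_smul_right, hρ, Complex.conj_ofReal]
    push_cast; ring
  simp only [h2]
  rw [Finset.sum_comm]
  have h3 : ∀ ν κ, ∑ μ, ((g : Matrix.specialOrthogonalGroup (Fin n) ℝ) :
      Matrix (Fin n) (Fin n) ℝ) μ ν * ((g : Matrix.specialOrthogonalGroup (Fin n) ℝ) :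
      Matrix (Fin n) (Fin n) ℝ) μ κ = (1 : Matrix (Fin n) (Fin n) ℝ) ν κ := fun ν κ => by
    rw [← h1]; rfl
  calc _ = ∑ κ, ∑ ν, (((1 : Matrix (Fin n) (Fin n) ℝ) ν κ : ℝ) : ℂ) *
        ⟪contr ν w, contr κ w'⟫_ℂ := by
        refine Finset.sum_congr rfl fun κ _ => ?_
        rw [Finset.sum_comm]
        refine Finset.sum_congr rfl fun ν _ => ?_
        rw [← h3, ← Finset.sum_mul]
        push_cast; rfl
    _ = _ := by
        refine Finset.sum_congr rfl fun κ _ => ?_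
        rw [Finset.sum_eq_single κ]
        · simp
        · intro ν _ hν; simp [hν]
        · simp

variable [FiniteDimensional ℂ V]

/-- The right side makes sense for every matrix in place of `g`, so it can be differentiated within
`G`. -/
theorem tprod_eq_sum (ρ : Representation ℂ G V) (g : G) (w : TSpace n ⊗[ℂ] V) :
    (complexRep G).tprod ρ g w = ∑ μ, ∑ ν, tVec μ ⊗ₜ[ℂ]
      ((((g : Matrix.specialOrthogonalGroup (Fin n) ℝ) : Matrix (Fin n) (Fin n) ℝ) μ ν) •
        onMatrices ρ ((g : Matrix.specialOrthogonalGroup (Fin n) ℝ) :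
          Matrix (Fin n) (Fin n) ℝ) (contr ν w)) := by
  rw [← sum_tVec_contr ((complexRep G).tprod ρ g w)]
  simp only [contr_tprod, onMatrices_coe, TensorProduct.tmul_sum]
  rfl

attribute [local instance] Matrix.normedAddCommGroup Matrix.normedSpace in
/-- The derivative of the tensor product representation. -/
theorem hasFDerivWithinAt_tensor (hL : HasFDerivWithinAt (onMatrices ρ) L (matSet G) 1)
    (w : TSpace n ⊗[ℂ] V) :
    ∃ D : Matrix (Fin n) (Fin n) ℝ →L[ℝ] (TSpace n ⊗[ℂ] V),
      (∀ Y, D Y = tensorAct Y (L Y) w) ∧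
      HasFDerivWithinAt (fun A : Matrix (Fin n) (Fin n) ℝ => ∑ μ, ∑ ν, tVec μ ⊗ₜ[ℂ]
        (A μ ν • onMatrices ρ A (contr ν w))) D (matSet G) 1 := by
  let T : Fin n → V →L[ℝ] (TSpace n ⊗[ℂ] V) := fun μ =>
    (TensorProduct.mkL ℂ (TSpace n) V (tVec μ)).restrictScalars ℝ
  let e : Fin n → Fin n → Matrix (Fin n) (Fin n) ℝ →L[ℝ] ℝ := fun μ ν =>
    LinearMap.toContinuousLinearMap
      (LinearMap.proj ν ∘ₗ LinearMap.proj (φ := fun _ : Fin n => Fin n → ℝ) μ)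
  let ev : V → (V →L[ℂ] V) →L[ℝ] V := fun v =>
    (ContinuousLinearMap.apply ℂ V v).restrictScalars ℝ
  let D : Fin n → Fin n → Matrix (Fin n) (Fin n) ℝ →L[ℝ] (TSpace n ⊗[ℂ] V) := fun μ ν => T μ ∘L
    ((1 : Matrix (Fin n) (Fin n) ℝ) μ ν • (ev (contr ν w) ∘L L) +
      (e μ ν).smulRight (onMatrices ρ 1 (contr ν w)))
  have h1 : ∀ μ ν, HasFDerivWithinAt (fun A : Matrix (Fin n) (Fin n) ℝ => T μ
      (A μ ν • onMatrices ρ A (contr ν w))) (D μ ν) (matSet G) 1 := fun μ ν =>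
    (T μ).hasFDerivAt.comp_hasFDerivWithinAt 1
      (((e μ ν).hasFDerivWithinAt).smul ((ev (contr ν w)).hasFDerivAt.comp_hasFDerivWithinAt 1 hL))
  refine ⟨∑ μ, ∑ ν, D μ ν, fun Y => ?_, HasFDerivWithinAt.fun_sum fun μ _ =>
    HasFDerivWithinAt.fun_sum fun ν _ => h1 μ ν⟩
  rw [tensorAct_eq_sum]
  simp only [sum_apply]
  refine Finset.sum_congr rfl fun μ _ => Finset.sum_congr rfl fun ν _ => ?_
  rw [add_comm]
  simp only [onMatrices_one, D]
  simp [T, ev, TensorProduct.tmul_add]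
  rfl

/-- The orbit of `w` under `exp(tY)` stays in the subspace, hence so does its velocity. -/
theorem tensorAct_mem (hL : HasFDerivWithinAt (onMatrices ρ) L (matSet G) 1)
    (S : Submodule ℂ (TSpace n ⊗[ℂ] V))
    (hS : ∀ g, ∀ w ∈ S, (complexRep G).tprod ρ g w ∈ S) {Y : Matrix (Fin n) (Fin n) ℝ}
    (hY : Y ∈ lieAlg G) {w : TSpace n ⊗[ℂ] V} (hw : w ∈ S) :
    tensorAct Y (L Y) w ∈ S := by
  obtain ⟨D, hD, hd⟩ := hasFDerivWithinAt_tensor hL w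
  rw [← hD]
  have h1 := hasDerivAt_comp_of_mem hd hY (by simp) (hasDerivAt_exp_smul Y)
  refine mem_of_hasDerivAt_of_forall_mem (S.restrictScalars ℝ) h1 fun t => ?_
  obtain ⟨g, hg, hgt⟩ := hY t
  have h2 := hS ⟨g, hg⟩ _ hw
  rw [tprod_eq_sum] at h2
  simp only [hgt] at h2
  exact h2

attribute [local instance] Matrix.normedAddCommGroup Matrix.normedSpace in
/-- The differential of a subrepresentation of `T ⊗ V`. -/
theorem exists_hasFDerivWithinAt_of_embedding
    (hL : HasFDerivWithinAt (onMatrices ρ) L (matSet G) 1)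
    {V' : Type*} [NormedAddCommGroup V'] [InnerProductSpace ℂ V'] [FiniteDimensional ℂ V']
    {ρ' : Representation ℂ G V'} (j : V' →ₗ[ℂ] (TSpace n ⊗[ℂ] V))
    (p : (TSpace n ⊗[ℂ] V) →ₗ[ℂ] V') (hpj : ∀ w, p (j w) = w)
    (hj : ∀ g w, j (ρ' g w) = (complexRep G).tprod ρ g (j w)) :
    ∃ L' : Matrix (Fin n) (Fin n) ℝ →L[ℝ] (V' →L[ℂ] V'),
      HasFDerivWithinAt (onMatrices ρ') L' (matSet G) 1 ∧
      ∀ Y ∈ lieAlg G, ∀ w, j (L' Y w) = tensorAct Y (L Y) (j w) := by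
  -- `Λ_μν(f) = p ∘ (E_μν ⊗ f) ∘ j`, so that `ρ'(A) = ∑ A_μν Λ_μν(ρ(A))` on `G`. Differentiability
  -- of `ρ'` is thus inherited from `ρ`.
  let Λ : Fin n → Fin n → (V →L[ℂ] V) →L[ℂ] (V' →L[ℂ] V') := fun μ ν =>
    LinearMap.toContinuousLinearMap
      { toFun := fun f => LinearMap.toContinuousLinearMap
          (p ∘ₗ
            TensorProduct.map (Matrix.toEuclideanLin (Matrix.single μ ν (1 : ℂ))) f.toLinearMap ∘ₗ
            j)
        map_add' := fun f g => by ext w; simp [TensorProduct.map_add_right]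
        map_smul' := fun c f => by ext w; simp [TensorProduct.map_smul_right] }
  let e : Fin n → Fin n → Matrix (Fin n) (Fin n) ℝ →L[ℝ] ℝ := fun μ ν =>
    LinearMap.toContinuousLinearMap
      (LinearMap.proj ν ∘ₗ LinearMap.proj (φ := fun _ : Fin n => Fin n → ℝ) μ)
  let D : Fin n → Fin n → Matrix (Fin n) (Fin n) ℝ →L[ℝ] (V' →L[ℂ] V') :=
    fun μ ν => (1 : Matrix (Fin n) (Fin n) ℝ) μ ν • (((Λ μ ν).restrictScalars ℝ) ∘L L) +
      (e μ ν).smulRight (Λ μ ν (onMatrices ρ 1))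
  have h1 : ∀ μ ν, HasFDerivWithinAt (fun A : Matrix (Fin n) (Fin n) ℝ =>
      A μ ν • Λ μ ν (onMatrices ρ A)) (D μ ν) (matSet G) 1 := fun μ ν =>
    (e μ ν).hasFDerivWithinAt.smul
      (((Λ μ ν).restrictScalars ℝ).hasFDerivAt.comp_hasFDerivWithinAt 1 hL)
  have hcontr : ∀ (M : Matrix (Fin n) (Fin n) ℝ) (f : Fin n → Fin n → V →L[ℂ] V)
      (w : V'), ((∑ μ, ∑ ν, M μ ν • Λ μ ν (f μ ν)) w) =
      p
        (∑ μ, ∑ ν, tVec μ ⊗ₜ[ℂ] (M μ ν • f μ ν (contr ν (j w)))) := by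
    intro M f w
    simp only [sum_apply, smul_apply, map_sum]
    refine Finset.sum_congr rfl fun μ _ => Finset.sum_congr rfl fun ν _ => ?_
    rw [TensorProduct.tmul_smul, LinearMap.map_smul_of_tower]
    congr 1
    simp only [Λ, LinearMap.coe_toContinuousLinearMap', LinearMap.coe_mk, AddHom.coe_mk,
      LinearMap.comp_apply]
    congr 1
    refine ext_contr fun κ => ?_
    rw [contr_map, contr_tVec_tmul]
    by_cases hκ : κ = μ
    · subst hκ
      rw [Finset.sum_eq_single ν]
      · simp
      · intro ν' _ hν'; simp [Ne.symm hν']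
      · simp
    · simp [hκ, Ne.symm hκ]
  have heq : ∀ A ∈ matSet G, onMatrices ρ' A =
      ∑ μ, ∑ ν, A μ ν • Λ μ ν (onMatrices ρ A) := by
    rintro _ ⟨g, hg, rfl⟩
    have h2 := onMatrices_coe ρ' ⟨g, hg⟩
    simp only at h2
    rw [h2]
    ext1 w
    rw [hcontr]
    have h3 := tprod_eq_sum ρ ⟨g, hg⟩ (j w)
    simp only at h3
    rw [← h3, ← hj, hpj]
    rfl
  refine ⟨∑ μ, ∑ ν, D μ ν, (HasFDerivWithinAt.fun_sum fun μ _ => HasFDerivWithinAt.fun_sum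
    fun ν _ => h1 μ ν).congr heq (heq 1 one_mem_matSet), fun Y hY w => ?_⟩
  -- The derivative of the formula for `ρ'` is known only after applying `p`. The infinitesimal
  -- action preserves the range of `j`, where `j ∘ p` is the identity, so `p` can be removed.
  obtain ⟨w', hw'⟩ := tensorAct_mem hL (LinearMap.range j)
    (by rintro g _ ⟨w, rfl⟩; exact ⟨_, hj g w⟩) hY (LinearMap.mem_range_self j w)
  have h5 : (∑ μ, ∑ ν, D μ ν) Y w = p
      (tensorAct Y (L Y) (j w)) := by
    have h6 : (∑ μ, ∑ ν, D μ ν) Y = ∑ μ, ∑ ν, (1 : Matrix (Fin n) (Fin n) ℝ) μ ν • Λ μ ν (L Y) +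
        ∑ μ, ∑ ν, Y μ ν • Λ μ ν (onMatrices ρ 1) := by
      simp [D, e, Finset.sum_add_distrib]
      rfl
    rw [h6, add_apply, hcontr, hcontr _ fun _ _ => onMatrices ρ 1, ← map_add,
      tensorAct_eq_sum, ← Finset.sum_add_distrib]
    congr 1
    refine Finset.sum_congr rfl fun μ _ => ?_
    rw [← Finset.sum_add_distrib]
    refine Finset.sum_congr rfl fun ν _ => ?_
    rw [onMatrices_one, ← TensorProduct.tmul_add, add_comm]
    rfl
  rw [h5, ← hw', hpj]

/-- If the holonomy representation is irreducible, the conformal weight operator preserves every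
subrepresentation of `T ⊗ V`. -/
theorem conformalWeightOp_mem_of_irreducible (hG : IsClosed (matSet G))
    (hc : IsPathConnectedGroup G) (hh : IsIdeal G h) (hX : IsOrthonormalBasis h X)
    (hL : HasFDerivWithinAt (onMatrices ρ) L (matSet G) 1) (hirr : ρ.IsIrreducible)
    (hreal : (realRep G).IsIrreducible) (W : Subrepresentation ((complexRep G).tprod ρ))
    {w : TSpace n ⊗[ℂ] V} (hw : w ∈ W.toSubmodule) :
    conformalWeightOp h ρ w ∈ W.toSubmodule := by
  obtain ⟨c', hc'⟩ := exists_casimir_eq_smul hG hc hh hX hL hirr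
  -- `∑ X_α²` is symmetric and commutes with `G`, by invariance of the Casimir tensor.
  obtain ⟨c, hcT⟩ := exists_eq_smul_of_irreducible_real hreal (∑ α, X α * X α)
    (by simp [Matrix.transpose_sum, hh.transpose_eq hX]) (by
      intro A hA
      have key := sum_conj_eq hG hc hh hX hA (LinearMap.mul ℝ (Matrix (Fin n) (Fin n) ℝ))
      simp only [LinearMap.mul_apply'] at key
      have h2 : ∀ α, A * X α * A.transpose * (A * X α * A.transpose) =
          A * (X α * X α) * A.transpose := fun α => by
        rw [Matrix.mul_assoc (A * X α), ← Matrix.mul_assoc A.transpose,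
          ← Matrix.mul_assoc A.transpose, transpose_mul_self_of_mem hA, Matrix.one_mul]
        simp only [Matrix.mul_assoc]
      simp only [h2, ← Finset.sum_mul, ← Finset.mul_sum] at key
      conv_rhs => rw [← key]
      rw [Matrix.mul_assoc _ A.transpose, transpose_mul_self_of_mem hA, Matrix.mul_one])
  have hmem : ∑ α, tensorAct (X α) (L (X α)) (tensorAct (X α) (L (X α)) w) ∈ W.toSubmodule :=
    Submodule.sum_mem _ fun α _ =>
      have hα := hh.subset _ (hX.mem α)
      have hS := fun g w (hw : w ∈ W.toSubmodule) => W.apply_mem_toSubmodule g hw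
      tensorAct_mem hL _ hS hα (tensorAct_mem hL _ hS hα hw)
  -- Expanding `∑ (X_α ⊗ 1 + 1 ⊗ X_α)²` yields the two scalar Casimir terms plus `2 ∑ X_α ⊗ X_α =
  -- -2B`.
  have hB : conformalWeightOp h ρ w = (1 / 2 : ℂ) • (((c : ℂ) + c') • w -
      ∑ α, tensorAct (X α) (L (X α)) (tensorAct (X α) (L (X α)) w)) := by
    refine ext_contr fun μ => ?_
    have h1 : contr μ (∑ α, tensorAct (X α) (L (X α)) (tensorAct (X α) (L (X α)) w)) =
        (c : ℂ) • contr μ w + c' • contr μ w - (2 : ℂ) • contr μ (conformalWeightOp h ρ w) := by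
      have h2 : ∀ α, contr μ (tensorAct (X α) (L (X α)) (tensorAct (X α) (L (X α)) w)) =
          ∑ κ, (X α * X α) μ κ • contr κ w + L (X α) (L (X α) (contr μ w)) +
            (2 : ℂ) • ∑ ν, X α μ ν • L (X α) (contr ν w) := fun α => by
        simp only [contr_tensorAct, smul_add, Finset.sum_add_distrib, map_add, map_sum,
          Matrix.mul_apply, Finset.sum_smul,
          ContinuousLinearMap.map_smul_of_tower, two_smul]
        simp only [Finset.smul_sum, smul_smul]
        rw [Finset.sum_comm]
        abel
      rw [map_sum, Finset.sum_congr rfl fun α _ => h2 α, Finset.sum_add_distrib,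
        Finset.sum_add_distrib, hc', contr_conformalWeightOp_eq hh hX hL, ← Finset.smul_sum,
        smul_neg, sub_neg_eq_add]
      congr 2
      rw [Finset.sum_comm]
      simp only [← Finset.sum_smul]
      have h3 : ∀ κ, ∑ α, (X α * X α) μ κ = c * (1 : Matrix (Fin n) (Fin n) ℝ) μ κ := fun κ => by
        have := congrFun (congrFun hcT μ) κ
        simpa [Matrix.sum_apply] using this
      rw [Finset.sum_eq_single μ]
      · rw [h3]; simp
      · intro κ _ hκ
        rw [h3]; simp [Ne.symm hκ]
      · simp
    rw [map_smul, map_sub, map_smul, h1]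
    module
  rw [hB]
  exact Submodule.smul_mem _ _ (Submodule.sub_mem _ (Submodule.smul_mem _ _ hw) hmem)

/-- The orthogonal projection onto a subrepresentation is equivariant. -/
theorem orthogonalProjectionOnto_tprod
    (hρ : ∀ (g : G) (v w : V), ⟪ρ g v, ρ g w⟫_ℂ = ⟪v, w⟫_ℂ)
    (W : Subrepresentation ((complexRep G).tprod ρ)) (g : G) (w : TSpace n ⊗[ℂ] V) :
    W.toSubmodule.orthogonalProjectionOnto ((complexRep G).tprod ρ g w) =
      W.toRepresentation g (W.toSubmodule.orthogonalProjectionOnto w) := by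
  refine Subtype.ext ?_
  refine Submodule.eq_starProjection_of_mem_of_inner_eq_zero (SetLike.coe_mem _) fun z hz => ?_
  have h1 : z = (complexRep G).tprod ρ g ((complexRep G).tprod ρ g⁻¹ z) := by
    rw [← Module.End.mul_apply, ← map_mul, mul_inv_cancel, map_one, Module.End.one_apply]
  have h2 : ((W.toRepresentation g (W.toSubmodule.orthogonalProjectionOnto w) : W.toSubmodule) :
      TSpace n ⊗[ℂ] V) = (complexRep G).tprod ρ g (W.toSubmodule.orthogonalProjectionOnto w) := rfl
  rw [h2, h1, ← map_sub, inner_tprod hρ]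
  exact Submodule.starProjection_inner_eq_zero w _ (W.apply_mem_toSubmodule _ hz)

/-- If the decomposition is multiplicity free, the conformal weight operator preserves its
summands. -/
theorem conformalWeightOp_mem_of_multiplicity_free (hG : IsClosed (matSet G))
    (hc : IsPathConnectedGroup G) (hh : IsIdeal G h) (hX : IsOrthonormalBasis h X)
    (hL : HasFDerivWithinAt (onMatrices ρ) L (matSet G) 1)
    (hρ : ∀ (g : G) (v w : V), ⟪ρ g v, ρ g w⟫_ℂ = ⟪v, w⟫_ℂ)
    {ι : Type*} {W : ι → Subrepresentation ((complexRep G).tprod ρ)}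
    (hW : IsIrreducibleDecomposition W)
    (hmf : ∀ i j, i ≠ j →
      IsEmpty (Representation.Equiv (W i).toRepresentation (W j).toRepresentation)) (i : ι)
    {w : TSpace n ⊗[ℂ] V} (hw : w ∈ (W i).toSubmodule) :
    conformalWeightOp h ρ w ∈ (W i).toSubmodule := by
  have hzero : ∀ j, j ≠ i → (W j).toSubmodule.orthogonalProjectionOnto
      (conformalWeightOp h ρ w) = 0 := by
    intro j hj
    have := hW.irreducible i
    have := hW.irreducible j
    have := hmf i j hj.symm
    let f : (W i).toSubmodule →ₗ[ℂ] (W j).toSubmodule :=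
      (W j).toSubmodule.orthogonalProjectionOnto.toLinearMap ∘ₗ conformalWeightOp h ρ ∘ₗ
        (W i).toSubmodule.subtype
    let F : Representation.IntertwiningMap (W i).toRepresentation (W j).toRepresentation :=
      f.intertwiningMap_of_isIntertwiningMap (W i).toRepresentation (W j).toRepresentation
        fun g v => by
          refine Eq.trans ?_ (orthogonalProjectionOnto_tprod hρ (W j) g _)
          exact congrArg (W j).toSubmodule.orthogonalProjectionOnto
            (conformalWeightOp_tprod hG hc hh hX hL g (v : TSpace n ⊗[ℂ] V))
    -- Schur's lemma: intertwining maps between non-isomorphic irreducible representations vanish.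
    have hF : F = 0 := Subsingleton.elim _ _
    exact congrArg (fun F : Representation.IntertwiningMap (W i).toRepresentation
      (W j).toRepresentation => F ⟨w, hw⟩) hF
  -- What the projection onto the `i`-th summand misses is orthogonal to every summand, and the
  -- summands span.
  have hperp : conformalWeightOp h ρ w - (W i).toSubmodule.starProjection
      (conformalWeightOp h ρ w) ∈ (⨆ j, (W j).toSubmodule)ᗮ := by
    rw [← Submodule.iInf_orthogonal, Submodule.mem_iInf]
    intro j
    by_cases hj : j = i
    · subst hj
      exact Submodule.sub_starProjection_mem_orthogonal _
    · refine Submodule.sub_mem _ (Submodule.orthogonalProjectionOnto_eq_zero_iff.1 (hzero j hj)) ?_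
      exact (hW.orthogonal j i hj).symm (Submodule.starProjection_apply_mem _ _)
  rw [hW.iSup_eq_top, Submodule.top_orthogonal_eq_bot, Submodule.mem_bot, sub_eq_zero] at hperp
  rw [hperp]
  exact Submodule.starProjection_apply_mem _ _

/-- Schur's lemma gives a complex scalar on each summand. Hermitian symmetry, tested on a nonzero
vector, makes it equal to its conjugate, and the same vector gives uniqueness. -/
theorem existsUnique_conformalWeights (hG : IsClosed (matSet G))
    (hc : IsPathConnectedGroup G) (hh : IsIdeal G h) (hX : IsOrthonormalBasis h X)
    (hρ : IsUnitaryRep ρ) {ι : Type*} {W : ι → Subrepresentation ((complexRep G).tprod ρ)}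
    (hW : IsIrreducibleDecomposition W)
    (hmem : ∀ i, ∀ w ∈ (W i).toSubmodule, conformalWeightOp h ρ w ∈ (W i).toSubmodule) :
    ∃! b : ι → ℝ, IsConformalWeights h W b := by
  obtain ⟨L, hL⟩ := hρ.exists_hasFDerivWithinAt
  have hne : ∀ i, ∃ w ∈ (W i).toSubmodule, w ≠ 0 := by
    intro i
    have := hW.irreducible i
    by_contra hcon
    push Not at hcon
    have h1 : (⊥ : Subrepresentation (W i).toRepresentation) ≠ ⊤ := bot_ne_top
    refine h1 (Subrepresentation.toSubmodule_injective (Submodule.ext fun w => ?_))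
    have h2 : w = 0 := Subtype.ext (hcon w w.2)
    rw [h2]
    exact iff_of_true (Submodule.zero_mem _) (Submodule.zero_mem _)
  have hex : ∀ i, ∃ b : ℝ, ∀ w ∈ (W i).toSubmodule, conformalWeightOp h ρ w = (b : ℂ) • w := by
    intro i
    obtain ⟨c, hc'⟩ := exists_eq_smul_of_irreducible (hW.irreducible i)
      ((conformalWeightOp h ρ).restrict (hmem i)) (fun g u => Subtype.ext
        (conformalWeightOp_tprod hG hc hh hX hL g u))
    have hc2 : ∀ w ∈ (W i).toSubmodule, conformalWeightOp h ρ w = c • w := fun w hw =>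
      congrArg Subtype.val (hc' ⟨w, hw⟩)
    obtain ⟨w, hw, hw0⟩ := hne i
    have h3 := inner_conformalWeightOp hh hX hρ.inner_map hL w w
    rw [hc2 w hw] at h3
    have h4 := mul_right_cancel₀ (inner_self_ne_zero.2 hw0)
      ((inner_smul_left w w c).symm.trans (h3.trans (inner_smul_right w w c)))
    obtain ⟨r, hr⟩ := Complex.conj_eq_iff_real.1 h4
    exact ⟨r, fun w hw => by rw [hc2 w hw, hr]⟩
  choose b hb using hex
  refine ⟨b, hb, fun b' hb' => funext fun i => ?_⟩
  obtain ⟨w, hw, hw0⟩ := hne i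
  have h1 : (b' i : ℂ) • w = (b i : ℂ) • w := by rw [← hb' i w hw, ← hb i w hw]
  exact_mod_cast smul_left_injective ℂ hw0 h1

end Weights

/-! ### Vector fields in charts -/

section Charts

variable {n : ℕ} {M : Type*} [TopologicalSpace M] [ChartedSpace (EuclideanSpace ℝ (Fin n)) M]

/-- A vector field is smooth on a set. -/
abbrev SmoothOn [IsManifold (𝓡 n) ∞ M] (X : ∀ y : M, TangentSpace (𝓡 n) y) (U : Set M) : Prop :=
  ContMDiffOn (𝓡 n) ((𝓡 n).prod 𝓘(ℝ, EuclideanSpace ℝ (Fin n))) ∞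
    (fun y => (⟨y, X y⟩ :
      TotalSpace (EuclideanSpace ℝ (Fin n)) (TangentSpace (𝓡 n) : M → Type _))) U

/-- The coordinate expression of a vector field in the preferred chart at `x`. -/
def coordField (x : M) (X : ∀ y : M, TangentSpace (𝓡 n) y) :
    EuclideanSpace ℝ (Fin n) → EuclideanSpace ℝ (Fin n) :=
  VectorField.mpullback 𝓘(ℝ, EuclideanSpace ℝ (Fin n)) (𝓡 n) (extChartAt (𝓡 n) x).symm X

theorem mvfderiv_congr {F : Type*} [NormedAddCommGroup F] [NormedSpace ℝ F] {f g : M → F} {x : M}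
    (h : f =ᶠ[𝓝 x] g) (a : TangentSpace (𝓡 n) x) :
    mvfderiv (𝓡 n) f x a = mvfderiv (𝓡 n) g x a := by
  have h1 := h.mfderiv_eq (I := 𝓡 n) (I' := 𝓘(ℝ, F))
  have : f x = g x := h.self_of_nhds
  simp only [mvfderiv]
  exact congrArg (fun l : EuclideanSpace ℝ (Fin n) →L[ℝ] F => l a) h1

theorem two_le_infty : (2 : WithTop ℕ∞) ≤ ∞ := by
  have : ((2 : ℕ∞) : WithTop ℕ∞) ≤ ((⊤ : ℕ∞) : WithTop ℕ∞) := WithTop.coe_le_coe.2 le_top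
  exact this

variable [IsManifold (𝓡 n) ∞ M]

theorem contMDiffAt_extChartAt_symm_of_mem {x : M} {z : EuclideanSpace ℝ (Fin n)}
    (hz : z ∈ (extChartAt (𝓡 n) x).target) :
    ContMDiffAt 𝓘(ℝ, EuclideanSpace ℝ (Fin n)) (𝓡 n) ∞ (extChartAt (𝓡 n) x).symm z :=
  (contMDiffOn_extChartAt_symm x).contMDiffAt ((isOpen_extChartAt_target x).mem_nhds hz)

theorem mdifferentiableAt_extChartAt_symm_of_mem {x : M} {z : EuclideanSpace ℝ (Fin n)}
    (hz : z ∈ (extChartAt (𝓡 n) x).target) :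
    MDifferentiableAt 𝓘(ℝ, EuclideanSpace ℝ (Fin n)) (𝓡 n) (extChartAt (𝓡 n) x).symm z :=
  (contMDiffAt_extChartAt_symm_of_mem hz).mdifferentiableAt (by simp)

theorem isInvertible_mfderiv_extChartAt_symm {x : M} {z : EuclideanSpace ℝ (Fin n)}
    (hz : z ∈ (extChartAt (𝓡 n) x).target) :
    (mfderiv 𝓘(ℝ, EuclideanSpace ℝ (Fin n)) (𝓡 n)
      (extChartAt (𝓡 n) x).symm z).IsInvertible := by
  have := isInvertible_mfderivWithin_extChartAt_symm (I := 𝓡 n) hz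
  simpa using this

/-- The pullback is defined through an inverse of the derivative of the chart, which is a true
inverse only on the chart target. -/
theorem mfderiv_coordField {x : M} {z : EuclideanSpace ℝ (Fin n)}
    (hz : z ∈ (extChartAt (𝓡 n) x).target) (X : ∀ y : M, TangentSpace (𝓡 n) y) :
    mfderiv 𝓘(ℝ, EuclideanSpace ℝ (Fin n)) (𝓡 n) (extChartAt (𝓡 n) x).symm z
      (coordField x X z) = X ((extChartAt (𝓡 n) x).symm z) := by
  obtain ⟨e, he⟩ := isInvertible_mfderiv_extChartAt_symm hz
  simp only [coordField, VectorField.mpullback_apply, ← he, ContinuousLinearMap.inverse_equiv]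
  exact e.apply_symm_apply _

/-- The chain rule; it reduces derivatives along vector fields to calculus in `ℝ^n`. -/
theorem fderiv_coordField {F : Type*} [NormedAddCommGroup F] [NormedSpace ℝ F] {f : M → F}
    {x : M} {z : EuclideanSpace ℝ (Fin n)} (hz : z ∈ (extChartAt (𝓡 n) x).target)
    (hf : MDifferentiableAt (𝓡 n) 𝓘(ℝ, F) f ((extChartAt (𝓡 n) x).symm z))
    (X : ∀ y : M, TangentSpace (𝓡 n) y) :
    fderiv ℝ (f ∘ (extChartAt (𝓡 n) x).symm) z (coordField x X z) =
      mvfderiv (𝓡 n) f ((extChartAt (𝓡 n) x).symm z) (X ((extChartAt (𝓡 n) x).symm z)) := by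
  rw [← mfderiv_coordField hz X, ← mfderiv_eq_fderiv]
  exact mfderiv_comp_apply z hf (mdifferentiableAt_extChartAt_symm_of_mem hz) _

theorem contDiffAt_coordField {U : Set M} (hU : IsOpen U) {X : ∀ y : M, TangentSpace (𝓡 n) y}
    (hX : SmoothOn X U) {x : M} {z : EuclideanSpace ℝ (Fin n)}
    (hz : z ∈ (extChartAt (𝓡 n) x).target) (hzU : (extChartAt (𝓡 n) x).symm z ∈ U) :
    ContDiffAt ℝ ∞ (coordField x X) z := by
  have h1 := ContMDiffAt.mpullback_vectorField_preimage (n := ∞) (m := ∞)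
    (hX.contMDiffAt (hU.mem_nhds hzU))
    (contMDiffAt_extChartAt_symm_of_mem hz) (isInvertible_mfderiv_extChartAt_symm hz) le_rfl
  exact ((contMDiff_snd_tangentBundle_modelSpace (EuclideanSpace ℝ (Fin n))
    𝓘(ℝ, EuclideanSpace ℝ (Fin n))).contMDiffAt.comp z h1).contDiffAt

theorem coordField_mlieBracket {X Y : ∀ y : M, TangentSpace (𝓡 n) y}
    {x : M} {z : EuclideanSpace ℝ (Fin n)}
    (hX : MDifferentiableAt (𝓡 n) ((𝓡 n).prod 𝓘(ℝ, EuclideanSpace ℝ (Fin n)))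
      (fun y => (⟨y, X y⟩ : TotalSpace (EuclideanSpace ℝ (Fin n))
        (TangentSpace (𝓡 n) : M → Type _))) ((extChartAt (𝓡 n) x).symm z))
    (hY : MDifferentiableAt (𝓡 n) ((𝓡 n).prod 𝓘(ℝ, EuclideanSpace ℝ (Fin n)))
      (fun y => (⟨y, Y y⟩ : TotalSpace (EuclideanSpace ℝ (Fin n))
        (TangentSpace (𝓡 n) : M → Type _))) ((extChartAt (𝓡 n) x).symm z))
    (hz : z ∈ (extChartAt (𝓡 n) x).target) :
    coordField x (VectorField.mlieBracket (𝓡 n) X Y) z =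
      VectorField.lieBracket ℝ (coordField x X) (coordField x Y) z := by
  have : IsManifold (𝓡 n) (minSmoothness ℝ 2) M := by
    rw [minSmoothness_of_isRCLikeNormedField]; infer_instance
  refine (VectorField.mpullback_mlieBracket hX hY (contMDiffAt_extChartAt_symm_of_mem hz)
    (by rw [minSmoothness_of_isRCLikeNormedField]; exact two_le_infty)).trans ?_
  rw [← VectorField.mlieBracketWithin_univ, VectorField.mlieBracketWithin_eq_lieBracketWithin,
    ← VectorField.lieBracketWithin_univ]
  rfl

theorem SmoothOn.mdifferentiableAt {U : Set M} (hU : IsOpen U)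
    {X : ∀ y : M, TangentSpace (𝓡 n) y} (hX : SmoothOn X U) {x : M} (hx : x ∈ U) :
    MDifferentiableAt (𝓡 n) ((𝓡 n).prod 𝓘(ℝ, EuclideanSpace ℝ (Fin n)))
      (fun y => (⟨y, X y⟩ : TotalSpace (EuclideanSpace ℝ (Fin n))
        (TangentSpace (𝓡 n) : M → Type _))) x :=
  (hX.contMDiffAt (hU.mem_nhds hx)).mdifferentiableAt (by simp)

theorem contDiffAt_comp_extChartAt_symm {F : Type*} [NormedAddCommGroup F] [NormedSpace ℝ F]
    {f : M → F} {U : Set M} (hU : IsOpen U) (hf : ContMDiffOn (𝓡 n) 𝓘(ℝ, F) ∞ f U)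
    {x : M} {z : EuclideanSpace ℝ (Fin n)}
    (hz : z ∈ (extChartAt (𝓡 n) x).target) (hzU : (extChartAt (𝓡 n) x).symm z ∈ U) :
    ContDiffAt ℝ ∞ (f ∘ (extChartAt (𝓡 n) x).symm) z :=
  ((hf.contMDiffAt (hU.mem_nhds hzU)).comp z (contMDiffAt_extChartAt_symm_of_mem hz)).contDiffAt

/-- The derivative of a smooth function along a smooth vector field is smooth. -/
theorem contMDiffOn_mvfderiv {F : Type*} [NormedAddCommGroup F] [NormedSpace ℝ F]
    {f : M → F} {U : Set M} (hU : IsOpen U) (hf : ContMDiffOn (𝓡 n) 𝓘(ℝ, F) ∞ f U)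
    {X : ∀ y : M, TangentSpace (𝓡 n) y} (hX : SmoothOn X U) :
    ContMDiffOn (𝓡 n) 𝓘(ℝ, F) ∞ (fun y => mvfderiv (𝓡 n) f y (X y)) U := by
  intro x hx
  refine ContMDiffAt.contMDiffWithinAt ?_
  have hz := mem_extChartAt_target (I := 𝓡 n) x
  have hzU : (extChartAt (𝓡 n) x).symm (extChartAt (𝓡 n) x x) ∈ U := by
    rwa [extChartAt_to_inv]
  have h1 : ContDiffAt ℝ ∞ (fun z => fderiv ℝ (f ∘ (extChartAt (𝓡 n) x).symm) z
      (coordField x X z)) (extChartAt (𝓡 n) x x) :=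
    ((contDiffAt_comp_extChartAt_symm hU hf hz hzU).fderiv_right le_rfl).clm_apply
      (contDiffAt_coordField hU hX hz hzU)
  refine (h1.contMDiffAt.comp x (contMDiffAt_extChartAt (I := 𝓡 n) (n := ∞))).congr_of_eventuallyEq
    ?_
  filter_upwards [hU.mem_nhds hx, extChartAt_source_mem_nhds (I := 𝓡 n) x] with y hy hys
  have h2 := (extChartAt (𝓡 n) x).left_inv hys
  have h3 := fderiv_coordField (f := f) ((extChartAt (𝓡 n) x).map_source hys)
    (by rw [h2]; exact (hf.contMDiffAt (hU.mem_nhds hy)).mdifferentiableAt (by simp)) X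
  rw [h2] at h3
  exact h3.symm

/-- The commutator of the derivatives along two vector fields is the derivative along their Lie
bracket. -/
theorem mvfderiv_mlieBracket {F : Type*} [NormedAddCommGroup F] [NormedSpace ℝ F]
    {f : M → F} {U : Set M} (hU : IsOpen U) (hf : ContMDiffOn (𝓡 n) 𝓘(ℝ, F) ∞ f U)
    {X Y : ∀ y : M, TangentSpace (𝓡 n) y} (hX : SmoothOn X U) (hY : SmoothOn Y U) {x : M}
    (hx : x ∈ U) :
    mvfderiv (𝓡 n) f x (VectorField.mlieBracket (𝓡 n) X Y x) =
      mvfderiv (𝓡 n) (fun y => mvfderiv (𝓡 n) f y (Y y)) x (X x) -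
        mvfderiv (𝓡 n) (fun y => mvfderiv (𝓡 n) f y (X y)) x (Y x) := by
  have hz := mem_extChartAt_target (I := 𝓡 n) x
  have hx' := extChartAt_to_inv (I := 𝓡 n) x
  set z := extChartAt (𝓡 n) x x with hzdef
  have hzU : (extChartAt (𝓡 n) x).symm z ∈ U := by rwa [hx']
  have hfd : ∀ y ∈ U, MDifferentiableAt (𝓡 n) 𝓘(ℝ, F) f y := fun y hy =>
    (hf.contMDiffAt (hU.mem_nhds hy)).mdifferentiableAt (by simp)
  have hXd := hX.mdifferentiableAt hU hx
  have hYd := hY.mdifferentiableAt hU hx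
  -- The iterated derivative is a second derivative plus a first derivative along `dB(A)`. The
  -- second derivatives are symmetric and cancel, and the remaining terms form the coordinate Lie
  -- bracket.
  have key : ∀ {A B : ∀ y : M, TangentSpace (𝓡 n) y}, SmoothOn A U → SmoothOn B U →
      mvfderiv (𝓡 n) (fun y => mvfderiv (𝓡 n) f y (B y)) x (A x) =
        fderiv ℝ (fderiv ℝ (f ∘ (extChartAt (𝓡 n) x).symm)) z (coordField x A z)
          (coordField x B z) + fderiv ℝ (f ∘ (extChartAt (𝓡 n) x).symm) z
            (fderiv ℝ (coordField x B) z (coordField x A z)) := by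
    intro A B hA hB
    have h1 := fderiv_coordField (f := fun y => mvfderiv (𝓡 n) f y (B y)) hz
      (by rw [hx']; exact ((contMDiffOn_mvfderiv hU hf hB).contMDiffAt
        (hU.mem_nhds hx)).mdifferentiableAt (by simp)) A
    rw [hx'] at h1
    rw [← h1]
    have h2 : (fun y => mvfderiv (𝓡 n) f y (B y)) ∘ (extChartAt (𝓡 n) x).symm =ᶠ[𝓝 z]
        fun w => fderiv ℝ (f ∘ (extChartAt (𝓡 n) x).symm) w (coordField x B w) := by
      filter_upwards [(isOpen_extChartAt_target x).mem_nhds hz,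
        (continuousAt_extChartAt_symm'' hz).preimage_mem_nhds (hU.mem_nhds hzU)] with w hw hwU
      exact (fderiv_coordField hw (hfd _ hwU) B).symm
    rw [h2.fderiv_eq, fderiv_clm_apply]
    · simp [add_comm]
    · exact ((contDiffAt_comp_extChartAt_symm hU hf hz hzU).fderiv_right
        (m := ∞) le_rfl).differentiableAt (by simp)
    · exact (contDiffAt_coordField hU hB hz hzU).differentiableAt (by simp)
  rw [key hX hY, key hY hX]
  have h3 := fderiv_coordField (f := f) hz (by rw [hx']; exact hfd x hx)
    (VectorField.mlieBracket (𝓡 n) X Y)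
  rw [coordField_mlieBracket (by rwa [hx']) (by rwa [hx']) hz] at h3
  rw [hx'] at h3
  rw [← h3, VectorField.lieBracket, map_sub]
  have h4 : IsSymmSndFDerivAt ℝ (f ∘ (extChartAt (𝓡 n) x).symm) z :=
    (contDiffAt_comp_extChartAt_symm hU hf hz hzU).isSymmSndFDerivAt
      (by rw [minSmoothness_of_isRCLikeNormedField]; exact two_le_infty)
  rw [h4 (coordField x X z) (coordField x Y z)]
  abel

end Charts

/-! ### Frames and the connection form -/

section Connection

variable {n : ℕ} {M : Type*} [TopologicalSpace M] [ChartedSpace (EuclideanSpace ℝ (Fin n)) M]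

section Orthonormal

variable [RiemannianBundle (fun x : M => TangentSpace (𝓡 n) x)]

theorem sum_inner_smul {x : M} {u : Fin n → TangentSpace (𝓡 n) x} (hu : Orthonormal ℝ u)
    (v : TangentSpace (𝓡 n) x) : ∑ i, ⟪u i, v⟫_ℝ • u i = v := by
  have hfd : FiniteDimensional ℝ (TangentSpace (𝓡 n) x) :=
    inferInstanceAs (FiniteDimensional ℝ (EuclideanSpace ℝ (Fin n)))
  have hdim : Module.finrank ℝ (TangentSpace (𝓡 n) x) = n :=
    (finrank_euclideanSpace_fin (𝕜 := ℝ) (n := n))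
  have hspan : (⊤ : Submodule ℝ (TangentSpace (𝓡 n) x)) ≤ Submodule.span ℝ (Set.range u) := by
    rw [hu.linearIndependent.span_eq_top_of_card_eq_finrank' (by simp [hdim])]
  have := (OrthonormalBasis.mk hu hspan).sum_repr' v
  simpa using this

theorem inner_frame {x : M} {u : Fin n → TangentSpace (𝓡 n) x} (hu : Orthonormal ℝ u)
    (i j : Fin n) : ⟪u i, u j⟫_ℝ = (1 : Matrix (Fin n) (Fin n) ℝ) i j := by
  rw [orthonormal_iff_ite.1 hu, Matrix.one_apply]

theorem inner_frameMul {x : M} {u : Fin n → TangentSpace (𝓡 n) x} (hu : Orthonormal ℝ u)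
    (g : Matrix (Fin n) (Fin n) ℝ) (i j : Fin n) : ⟪u i, frameMul u g j⟫_ℝ = g i j := by
  simp [frameMul, inner_sum, inner_smul_right, inner_frame hu, Matrix.one_apply]

end Orthonormal

variable [IsManifold (𝓡 n) ∞ M]

/-- A curve through `x` with velocity `a`. -/
def curve (x : M) (a : TangentSpace (𝓡 n) x) (t : ℝ) : M :=
  (extChartAt (𝓡 n) x).symm (extChartAt (𝓡 n) x x +
    t • coordField x (FiberBundle.extend (EuclideanSpace ℝ (Fin n)) a) (extChartAt (𝓡 n) x x))

@[simp]
theorem curve_zero (x : M) (a : TangentSpace (𝓡 n) x) : curve x a 0 = x := by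
  simp [curve]

theorem hasDerivAt_line (z b : EuclideanSpace ℝ (Fin n)) :
    HasDerivAt (fun t : ℝ => z + t • b) b 0 := by
  simpa using ((hasDerivAt_id (0 : ℝ)).smul_const b).const_add z

theorem continuousAt_curve (x : M) (a : TangentSpace (𝓡 n) x) : ContinuousAt (curve x a) 0 := by
  refine ContinuousAt.comp (g := (extChartAt (𝓡 n) x).symm) ?_
    (hasDerivAt_line (extChartAt (𝓡 n) x x) _).continuousAt
  rw [zero_smul, add_zero]
  exact continuousAt_extChartAt_symm'' (mem_extChartAt_target (I := 𝓡 n) x)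

/-- Directional derivatives on `M` become one-variable derivatives, so product rules and curves in
the matrix group can be handled with `HasDerivAt`. -/
theorem hasDerivAt_comp_curve {F : Type*} [NormedAddCommGroup F] [NormedSpace ℝ F] {f : M → F}
    {x : M} (hf : MDifferentiableAt (𝓡 n) 𝓘(ℝ, F) f x) (a : TangentSpace (𝓡 n) x) :
    HasDerivAt (fun t => f (curve x a t)) (mvfderiv (𝓡 n) f x a) 0 := by
  have hz := mem_extChartAt_target (I := 𝓡 n) x
  have hx' := extChartAt_to_inv (I := 𝓡 n) x
  have h1 := fderiv_coordField (f := f) hz (by rwa [hx'])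
    (FiberBundle.extend (EuclideanSpace ℝ (Fin n)) a)
  rw [hx'] at h1
  rw [FiberBundle.extend_apply_self] at h1
  rw [← h1]
  have h3 : DifferentiableAt ℝ (f ∘ (extChartAt (𝓡 n) x).symm) (extChartAt (𝓡 n) x x) :=
    (MDifferentiableAt.comp _ (by rwa [hx'])
      (mdifferentiableAt_extChartAt_symm_of_mem hz)).differentiableAt
  exact HasFDerivAt.comp_hasDerivAt_of_eq 0 h3.hasFDerivAt (hasDerivAt_line _ _) (by simp)

/-- A vector field is differentiable at a point. -/
abbrev FieldDiffAt (X : ∀ y : M, TangentSpace (𝓡 n) y) (x : M) : Prop :=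
  MDifferentiableAt (𝓡 n) ((𝓡 n).prod 𝓘(ℝ, EuclideanSpace ℝ (Fin n)))
    (fun y => (⟨y, X y⟩ : TotalSpace (EuclideanSpace ℝ (Fin n))
      (TangentSpace (𝓡 n) : M → Type _))) x

variable {cov : CovariantDerivative (𝓡 n) (EuclideanSpace ℝ (Fin n))
  (TangentSpace (𝓡 n) : M → Type _)}

theorem cov_congr {Z Z' : ∀ y : M, TangentSpace (𝓡 n) y} {x : M} (hZ : FieldDiffAt Z x)
    (h : ∀ᶠ y in 𝓝 x, Z y = Z' y) : cov Z x = cov Z' x := by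
  refine cov.isCovariantDerivativeOnUniv.congr_of_eventuallyEq hZ ?_ univ_mem h
  refine hZ.congr_of_eventuallyEq ?_
  filter_upwards [h] with y hy
  rw [hy]

theorem FieldDiffAt.sum_smul {ι : Type*} {t : Finset ι} {f : ι → M → ℝ}
    {Z : ι → ∀ y : M, TangentSpace (𝓡 n) y} {x : M}
    (hf : ∀ i, MDifferentiableAt (𝓡 n) 𝓘(ℝ, ℝ) (f i) x) (hZ : ∀ i, FieldDiffAt (Z i) x) :
    FieldDiffAt (fun y => ∑ i ∈ t, f i y • Z i y) x :=
  MDifferentiableAt.sum_section fun i _ => (hf i).smul_section (hZ i)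

theorem cov_sum_smul {ι : Type*} (t : Finset ι) {f : ι → M → ℝ}
    {Z : ι → ∀ y : M, TangentSpace (𝓡 n) y} {x : M}
    (hf : ∀ i, MDifferentiableAt (𝓡 n) 𝓘(ℝ, ℝ) (f i) x) (hZ : ∀ i, FieldDiffAt (Z i) x)
    (a : TangentSpace (𝓡 n) x) :
    cov (fun y => ∑ i ∈ t, f i y • Z i y) x a =
      ∑ i ∈ t, (f i x • cov (Z i) x a + mvfderiv (𝓡 n) (f i) x a • Z i x) := by
  classical
  induction t using Finset.induction_on with
  | empty =>
    have : (fun y : M => ∑ i ∈ (∅ : Finset ι), f i y • Z i y) = 0 := by ext; simp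
    rw [this, cov.zero]; simp
  | insert i t hi ih =>
    have h1 : (fun y : M => ∑ j ∈ insert i t, f j y • Z j y) =
        (f i • Z i) + fun y => ∑ j ∈ t, f j y • Z j y := by
      ext1 y; simp [Finset.sum_insert hi]
    rw [h1, cov.isCovariantDerivativeOnUniv.add ((hf i).smul_section (hZ i))
      (FieldDiffAt.sum_smul hf hZ), cov.isCovariantDerivativeOnUniv.leibniz (hZ i) (hf i),
      Finset.sum_insert hi, ← ih]
    rfl

variable [RiemannianBundle (fun x : M => TangentSpace (𝓡 n) x)]

variable {G : Subgroup (Matrix.specialOrthogonalGroup (Fin n) ℝ)} {P : ParallelReduction cov G}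
  {U : Set M} {s : ∀ y : M, Fin n → TangentSpace (𝓡 n) y}

theorem IsLocalSection.fieldDiffAt (hs : IsLocalSection P.fiber U s) {x : M} (hx : x ∈ U)
    (j : Fin n) : FieldDiffAt (fun y => s y j) x :=
  SmoothOn.mdifferentiableAt hs.isOpen (hs.contMDiffOn j) hx

theorem cov_frame (hs : IsLocalSection P.fiber U s) {x : M} (hx : x ∈ U) (j : Fin n)
    (a : TangentSpace (𝓡 n) x) :
    cov (fun y => s y j) x a = ∑ i, connectionForm cov s x a i j • s x i :=
  (sum_inner_smul (P.orthonormal x _ (hs.mem x hx)) _).symm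

theorem connectionForm_sum_smul (s : ∀ y : M, Fin n → TangentSpace (𝓡 n) y) (x : M)
    {ι : Type*} (t : Finset ι) (c : ι → ℝ) (a : ι → TangentSpace (𝓡 n) x) :
    connectionForm cov s x (∑ k ∈ t, c k • a k) = ∑ k ∈ t, c k • connectionForm cov s x (a k) := by
  ext i j
  simp [connectionForm, inner_sum, inner_smul_right, Matrix.sum_apply]

/-- The transition matrix between two frames. -/
def transition {x : M} (u v : Fin n → TangentSpace (𝓡 n) x) : Matrix (Fin n) (Fin n) ℝ :=
  Matrix.of fun i j => ⟪u i, v j⟫_ℝ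

theorem frameMul_transition {x : M} {u v : Fin n → TangentSpace (𝓡 n) x}
    (hu : u ∈ P.fiber x) : frameMul u (transition u v) = v := by
  ext1 j
  exact sum_inner_smul (P.orthonormal x u hu) (v j)

theorem transition_frameMul {x : M} {u : Fin n → TangentSpace (𝓡 n) x}
    (hu : u ∈ P.fiber x) (g : Matrix (Fin n) (Fin n) ℝ) : transition u (frameMul u g) = g := by
  ext i j
  exact inner_frameMul (P.orthonormal x u hu) g i j

theorem transition_mem {x : M} {u v : Fin n → TangentSpace (𝓡 n) x}
    (hu : u ∈ P.fiber x) (hv : v ∈ P.fiber x) : transition u v ∈ matSet G := by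
  obtain ⟨g, hg, rfl⟩ := P.transitive x u hu v hv
  rwa [transition_frameMul hu]

variable [IsContMDiffRiemannianBundle (𝓡 n) ∞ (EuclideanSpace ℝ (Fin n))
  (fun x : M => TangentSpace (𝓡 n) x)]

/-- Smoothness of the connection is used for globally smooth fields. The field `Z` is therefore
multiplied by a bump function equal to `1` near the point, and locality of the connection transfers
the result back. -/
theorem smoothOn_cov [T2Space M] (hcov : IsLeviCivita cov) {U : Set M} (hU : IsOpen U)
    {Z X : ∀ y : M, TangentSpace (𝓡 n) y} (hZ : SmoothOn Z U) (hX : SmoothOn X U) :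
    SmoothOn (fun y => cov Z y (X y)) U := by
  intro x hx
  refine ContMDiffAt.contMDiffWithinAt ?_
  obtain ⟨χ, -, hχ⟩ := (SmoothBumpFunction.nhds_basis_tsupport (I := 𝓡 n) x).mem_iff.1
    (hU.mem_nhds hx)
  have h1 : ContMDiff (𝓡 n) ((𝓡 n).prod 𝓘(ℝ, EuclideanSpace ℝ (Fin n))) ∞
      (fun y => (⟨y, ((χ : M → ℝ) • Z) y⟩ : TotalSpace (EuclideanSpace ℝ (Fin n))
        (TangentSpace (𝓡 n) : M → Type _))) :=
    ContMDiffOn.smul_section_of_tsupport χ.contMDiff.contMDiffOn hU hχ hZ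
  have h2 := (hcov.smooth.contMDiff.contMDiff (σ := (χ : M → ℝ) • Z) h1.contMDiffOn).contMDiffAt
    (x := x) univ_mem
  refine (h2.clm_bundle_apply (hX.contMDiffAt (hU.mem_nhds hx))).congr_of_eventuallyEq ?_
  filter_upwards [hU.mem_nhds hx, χ.eventuallyEq_one.eventuallyEq_nhds] with y hy hχy
  have h3 : cov Z y = cov ((χ : M → ℝ) • Z) y := by
    refine cov_congr (hZ.mdifferentiableAt hU hy) ?_
    filter_upwards [hχy] with w hw
    simp [hw]
  rw [h3]

theorem contMDiffOn_inner {U : Set M} {X Y : ∀ y : M, TangentSpace (𝓡 n) y}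
    (hX : SmoothOn X U) (hY : SmoothOn Y U) :
    ContMDiffOn (𝓡 n) 𝓘(ℝ, ℝ) ∞ (fun y => ⟪X y, Y y⟫_ℝ) U :=
  ContMDiffOn.inner_bundle hX hY

theorem IsLeviCivita.mvfderiv_inner (hcov : IsLeviCivita cov)
    {Y Z : ∀ y : M, TangentSpace (𝓡 n) y} {x : M} (hY : FieldDiffAt Y x) (hZ : FieldDiffAt Z x)
    (a : TangentSpace (𝓡 n) x) :
    mvfderiv (𝓡 n) (fun y => ⟪Y y, Z y⟫_ℝ) x a = ⟪cov Y x a, Z x⟫_ℝ + ⟪Y x, cov Z x a⟫_ℝ := by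
  have := hcov.metric.mvfderiv_inner_eq
    (FiberBundle.extend (EuclideanSpace ℝ (Fin n)) a) hY hZ
  simpa using this

theorem IsLeviCivita.mlieBracket_eq (hcov : IsLeviCivita cov)
    {Y Z : ∀ y : M, TangentSpace (𝓡 n) y} {x : M} (hY : FieldDiffAt Y x) (hZ : FieldDiffAt Z x) :
    VectorField.mlieBracket (𝓡 n) Y Z x = cov Z x (Y x) - cov Y x (Z x) :=
  ((CovariantDerivative.torsion_eq_zero_iff cov).1 hcov.torsion_eq_zero hY hZ).symm

theorem contMDiffOn_connectionForm [T2Space M] (hcov : IsLeviCivita cov)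
    (hs : IsLocalSection P.fiber U s) {X : ∀ y : M, TangentSpace (𝓡 n) y} (hX : SmoothOn X U)
    (i j : Fin n) :
    ContMDiffOn (𝓡 n) 𝓘(ℝ, ℝ) ∞ (fun y => connectionForm cov s y (X y) i j) U :=
  contMDiffOn_inner (hs.contMDiffOn i) (smoothOn_cov hcov hs.isOpen (hs.contMDiffOn j) hX)

theorem contMDiffOn_apply_connectionForm [T2Space M] (hcov : IsLeviCivita cov)
    (hs : IsLocalSection P.fiber U s) {X : ∀ y : M, TangentSpace (𝓡 n) y} (hX : SmoothOn X U)
    {F : Type*} [NormedAddCommGroup F] [NormedSpace ℝ F]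
    (L : Matrix (Fin n) (Fin n) ℝ →ₗ[ℝ] F) :
    ContMDiffOn (𝓡 n) 𝓘(ℝ, F) ∞ (fun y => L (connectionForm cov s y (X y))) U := by
  have h1 : ∀ A : Matrix (Fin n) (Fin n) ℝ, L A = ∑ i, ∑ j, A i j • L (Matrix.single i j 1) := by
    intro A
    conv_lhs => rw [Matrix.matrix_eq_sum_single A]
    simp only [map_sum]
    refine Finset.sum_congr rfl fun i _ => Finset.sum_congr rfl fun j _ => ?_
    rw [← map_smul, Matrix.smul_single, smul_eq_mul, mul_one]
  rw [funext fun y => h1 (connectionForm cov s y (X y))]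
  exact contMDiffOn_finsetSum fun i _ => contMDiffOn_finsetSum fun j _ =>
    (contMDiffOn_connectionForm hcov hs hX i j).smul contMDiffOn_const

end Connection

/-! ### The covariant derivative in a local frame -/

section LocalDeriv

variable {n : ℕ} {M : Type*} [TopologicalSpace M] [ChartedSpace (EuclideanSpace ℝ (Fin n)) M]
  [IsManifold (𝓡 n) ∞ M] [RiemannianBundle (fun x : M => TangentSpace (𝓡 n) x)]
  {cov : CovariantDerivative (𝓡 n) (EuclideanSpace ℝ (Fin n))
    (TangentSpace (𝓡 n) : M → Type _)}
  {G : Subgroup (Matrix.specialOrthogonalGroup (Fin n) ℝ)} {P : ParallelReduction cov G}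
  {U U' : Set M} {s s' : ∀ y : M, Fin n → TangentSpace (𝓡 n) y}
  {V : Type*} [NormedAddCommGroup V] [InnerProductSpace ℂ V]
  {ρ : Representation ℂ G V} {L : Matrix (Fin n) (Fin n) ℝ →L[ℝ] (V →L[ℂ] V)}
  {ψ : FrameFun n M V}

-- The transition matrix of two local frames lies in `G` only while the curve remains in both
-- domains, hence only for small `t`.
attribute [local instance] Matrix.normedAddCommGroup Matrix.normedSpace in
theorem hasDerivAt_onMatrices_of_eventually [FiniteDimensional ℂ V]
    (hL : HasFDerivWithinAt (onMatrices ρ) L (matSet G) 1)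
    {γ : ℝ → Matrix (Fin n) (Fin n) ℝ} {Y : Matrix (Fin n) (Fin n) ℝ}
    (hγ : ∀ᶠ t in 𝓝 0, γ t ∈ matSet G) (h0 : γ 0 = 1) (hd : HasDerivAt γ Y 0) :
    HasDerivAt (fun t => onMatrices ρ (γ t)) (L Y) 0 := by
  rw [← h0] at hL
  have h1 : HasDerivWithinAt (fun t => onMatrices ρ (γ t)) (L Y) {t | γ t ∈ matSet G} 0 :=
    hL.comp_hasDerivWithinAt 0 (s := {t | γ t ∈ matSet G}) (HasDerivAt.hasDerivWithinAt hd)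
      fun t ht => ht
  exact h1.hasDerivAt hγ

theorem IsSection.apply_frameMul [FiniteDimensional ℂ V] (hψ : IsSection P ρ ψ) {x : M}
    {u : Fin n → TangentSpace (𝓡 n) x} (hu : u ∈ P.fiber x) {g : Matrix (Fin n) (Fin n) ℝ}
    (hg : g ∈ matSet G) : ψ x (frameMul u g) = onMatrices ρ g.transpose (ψ x u) := by
  have h1 := transpose_mem_matSet hg
  obtain ⟨g₀, hg₀, rfl⟩ := hg
  rw [hψ.equivariant x u hu ⟨g₀, hg₀⟩]
  have h2 : (g₀ : Matrix (Fin n) (Fin n) ℝ).transpose =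
      (((⟨g₀, hg₀⟩ : G)⁻¹ : G) : Matrix.specialOrthogonalGroup (Fin n) ℝ) := rfl
  rw [h2, onMatrices_coe]
  rfl

/-- The covariant derivative along `a`, computed in the frame field `s`. -/
def localDeriv (cov : CovariantDerivative (𝓡 n) (EuclideanSpace ℝ (Fin n))
    (TangentSpace (𝓡 n) : M → Type _)) (L : Matrix (Fin n) (Fin n) ℝ →L[ℝ] (V →L[ℂ] V))
    (ψ : FrameFun n M V) (s : ∀ y : M, Fin n → TangentSpace (𝓡 n) y) (x : M)
    (a : TangentSpace (𝓡 n) x) : V :=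
  mvfderiv (𝓡 n) (fun y => ψ y (s y)) x a + L (connectionForm cov s x a) (ψ x (s x))

theorem IsSection.mdifferentiableAt (hψ : IsSection P ρ ψ) (hs : IsLocalSection P.fiber U s)
    {x : M} (hx : x ∈ U) : MDifferentiableAt (𝓡 n) 𝓘(ℝ, V) (fun y => ψ y (s y)) x :=
  ((hψ.smooth U s hs).contMDiffAt (hs.isOpen.mem_nhds hx)).mdifferentiableAt (by simp)

variable [IsContMDiffRiemannianBundle (𝓡 n) ∞ (EuclideanSpace ℝ (Fin n))
  (fun x : M => TangentSpace (𝓡 n) x)]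

theorem mdifferentiableAt_transition (hs : IsLocalSection P.fiber U s)
    (hs' : IsLocalSection P.fiber U' s') {x : M} (hx : x ∈ U) (hx' : x ∈ U') (i j : Fin n) :
    MDifferentiableAt (𝓡 n) 𝓘(ℝ, ℝ) (fun y => transition (s y) (s' y) i j) x :=
  MDifferentiableAt.inner_bundle (hs.fieldDiffAt hx i) (hs'.fieldDiffAt hx' j)

/-- The gauge transformation of the connection form. -/
theorem connectionForm_change (hs : IsLocalSection P.fiber U s)
    (hs' : IsLocalSection P.fiber U' s') {x : M} (hx : x ∈ U) (hx' : x ∈ U')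
    (a : TangentSpace (𝓡 n) x) :
    connectionForm cov s' x a =
      (transition (s x) (s' x)).transpose * connectionForm cov s x a * transition (s x) (s' x) +
      (transition (s x) (s' x)).transpose * Matrix.of fun i j =>
        mvfderiv (𝓡 n) (fun y => transition (s y) (s' y) i j) x a := by
  have hg := mdifferentiableAt_transition hs hs' hx hx'
  -- The Leibniz rule for `s'_j = ∑_k g_kj s_k`.
  have h1 : ∀ j, cov (fun y => s' y j) x a = ∑ k, (transition (s x) (s' x) k j •
      cov (fun y => s y k) x a +
      mvfderiv (𝓡 n) (fun y => transition (s y) (s' y) k j) x a • s x k) := by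
    intro j
    rw [← cov_sum_smul Finset.univ (fun k => hg k j) fun k => hs.fieldDiffAt hx k]
    refine congrArg (fun l : TangentSpace (𝓡 n) x →L[ℝ] TangentSpace (𝓡 n) x => l a) ?_
    refine cov_congr (hs'.fieldDiffAt hx' j) ?_
    filter_upwards [hs.isOpen.mem_nhds hx] with y hy
    exact (congrFun (frameMul_transition (P := P) (v := s' y) (hs.mem y hy)) j).symm
  have h2 : ∀ i, s' x i = ∑ l, transition (s x) (s' x) l i • s x l := fun i =>
    (congrFun (frameMul_transition (P := P) (v := s' x) (hs.mem x hx)) i).symm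
  ext i j
  have h3 : connectionForm cov s' x a i j = ⟪s' x i, cov (fun y => s' y j) x a⟫_ℝ := rfl
  have h4 : ∀ l k, ⟪s x l, cov (fun y => s y k) x a⟫_ℝ = connectionForm cov s x a l k :=
    fun _ _ => rfl
  rw [h3, h1, h2]
  simp only [sum_inner, inner_sum, inner_smul_left, inner_add_right, inner_smul_right, h4,
    inner_frame (P.orthonormal x _ (hs.mem x hx)), Matrix.add_apply, Matrix.mul_apply,
    Matrix.transpose_apply, Matrix.of_apply, Finset.sum_add_distrib, Finset.sum_mul,
    Finset.mul_sum, Matrix.one_apply, conj_trivial]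
  congr 1
  · refine Finset.sum_congr rfl fun l _ => Finset.sum_congr rfl fun k _ => ?_
    ring
  · refine Finset.sum_congr rfl fun l _ => ?_
    simp [mul_comm]

variable [FiniteDimensional ℂ V]

attribute [local instance] Matrix.normedAddCommGroup Matrix.normedSpace in
/-- The covariant derivative in two frame fields. -/
theorem localDeriv_change (hL : HasFDerivWithinAt (onMatrices ρ) L (matSet G) 1)
    (hψ : IsSection P ρ ψ) (hs : IsLocalSection P.fiber U s)
    (hs' : IsLocalSection P.fiber U' s') {x : M} (hx : x ∈ U) (hx' : x ∈ U')
    (a : TangentSpace (𝓡 n) x) :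
    localDeriv cov L ψ s' x a =
      onMatrices ρ (transition (s x) (s' x)).transpose (localDeriv cov L ψ s x a) := by
  set g := transition (s x) (s' x) with hgdef
  have hg : g ∈ matSet G := transition_mem (hs.mem x hx) (hs'.mem x hx')
  set D : Matrix (Fin n) (Fin n) ℝ := Matrix.of fun i j =>
    mvfderiv (𝓡 n) (fun y => transition (s y) (s' y) i j) x a with hD
  have hmem : ∀ᶠ t in 𝓝 (0 : ℝ), curve x a t ∈ U ∩ U' := by
    refine (continuousAt_curve x a).preimage_mem_nhds ?_
    rw [curve_zero]
    exact (hs.isOpen.inter hs'.isOpen).mem_nhds ⟨hx, hx'⟩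
  -- Multiplying by `gᵀ`, the inverse of the transition matrix at `x`, makes the curve start at `1`,
  -- the only point where `L` differentiates `ρ`.
  have hk : HasDerivAt (fun t => g.transpose * transition (s (curve x a t)) (s' (curve x a t)))
      (g.transpose * D) 0 := by
    have h1 : HasDerivAt (fun t => transition (s (curve x a t)) (s' (curve x a t))) D 0 := by
      refine hasDerivAt_pi.2 fun i => hasDerivAt_pi.2 fun j => ?_
      exact hasDerivAt_comp_curve (mdifferentiableAt_transition hs hs' hx hx' i j) a
    refine hasDerivAt_pi.2 fun i => hasDerivAt_pi.2 fun j => ?_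
    simp only [Matrix.mul_apply]
    exact HasDerivAt.fun_sum fun k _ =>
      (hasDerivAt_pi.1 (hasDerivAt_pi.1 h1 k) j).const_mul (g.transpose i k)
  have h2 := hasDerivAt_onMatrices_of_eventually hL
    (hmem.mono fun t ht => mul_mem_matSet (transpose_mem_matSet hg)
      (transition_mem (hs.mem _ ht.1) (hs'.mem _ ht.2)))
    (by rw [curve_zero]; exact transpose_mul_self_of_mem hg) hk
  have h3 := hasDerivAt_comp_curve (hψ.mdifferentiableAt hs' hx') a
  have h4 := hasDerivAt_comp_curve (hψ.mdifferentiableAt hs hx) a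
  let ap : (V →L[ℂ] V) →L[ℝ] V →L[ℝ] V :=
    (ContinuousLinearMap.restrictScalarsL ℂ V V ℝ ℝ)
  have h5 := ap.hasFDerivAt.comp_hasDerivAt (0 : ℝ) h2
  have h6 := h5.clm_apply h3
  have h7 : HasDerivAt (fun t => onMatrices ρ g.transpose
      (ψ (curve x a t) (s (curve x a t))))
      (onMatrices ρ g.transpose (mvfderiv (𝓡 n) (fun y => ψ y (s y)) x a)) 0 :=
    ((onMatrices ρ g.transpose).restrictScalars ℝ).hasFDerivAt.comp_hasDerivAt (0 : ℝ) h4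
  -- Equivariance writes one function of `t` in both frames: `ρ(gᵀ) ψ(s) = ρ(gᵀ g(t)) ψ(s')`.
  -- Differentiating it at `0` gives the gauge term `L(gᵀ dg)`.
  have h8 : (fun t => onMatrices ρ g.transpose (ψ (curve x a t) (s (curve x a t)))) =ᶠ[𝓝 0]
      fun t => (ap (onMatrices ρ (g.transpose *
        transition (s (curve x a t)) (s' (curve x a t)))))
          (ψ (curve x a t) (s' (curve x a t))) := by
    filter_upwards [hmem] with t ht
    have h9 := transition_mem (P := P) (hs.mem _ ht.1) (hs'.mem _ ht.2)
    have h10 := hψ.apply_frameMul (hs.mem _ ht.1) h9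
    rw [frameMul_transition (P := P) (hs.mem _ ht.1)] at h10
    change _ = onMatrices ρ _ _
    rw [h10, onMatrices_mul ρ (transpose_mem_matSet hg) h9, ← mul_apply_eq_comp, mul_assoc,
      ← onMatrices_mul ρ h9 (transpose_mem_matSet h9), self_mul_transpose_of_mem h9, onMatrices_one,
      mul_one]
  have h11 := h7.unique (h6.congr_of_eventuallyEq h8)
  have h12 : g.transpose * transition (s x) (s' x) = 1 := transpose_mul_self_of_mem hg
  simp only [Function.comp_def] at h11
  rw [curve_zero, h12, onMatrices_one] at h11
  have h13 : onMatrices ρ g.transpose (mvfderiv (𝓡 n) (fun y => ψ y (s y)) x a) =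
      L (g.transpose * D) (ψ x (s' x)) + mvfderiv (𝓡 n) (fun y => ψ y (s' y)) x a := h11
  have h14 := apply_conj hL (transpose_mem_matSet hg) (P.connectionForm_mem U s hs x hx a)
  rw [Matrix.transpose_transpose] at h14
  have h15 := hψ.apply_frameMul (hs.mem _ hx) hg
  rw [frameMul_transition (P := P) (hs.mem _ hx)] at h15
  rw [localDeriv, localDeriv, connectionForm_change hs hs' hx hx', ← hgdef, ← hD, map_add, h14,
    map_add, h13, add_apply, mul_apply_eq_comp, mul_apply_eq_comp, h15, ← mul_apply_eq_comp
      (onMatrices ρ g), ← onMatrices_mul ρ hg (transpose_mem_matSet hg),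
    self_mul_transpose_of_mem hg, onMatrices_one, one_apply_eq_self]
  abel

end LocalDeriv

/-! ### The covariant derivative of a section -/

section CovDeriv

theorem frameMul_one {n : ℕ} {M : Type*} [TopologicalSpace M]
    [ChartedSpace (EuclideanSpace ℝ (Fin n)) M] {x : M} (u : Fin n → TangentSpace (𝓡 n) x) :
    frameMul u 1 = u := by
  ext1 j
  simp [frameMul, Matrix.one_apply]

variable {n : ℕ} {M : Type*} [TopologicalSpace M] [ChartedSpace (EuclideanSpace ℝ (Fin n)) M]
  [IsManifold (𝓡 n) ∞ M] [RiemannianBundle (fun x : M => TangentSpace (𝓡 n) x)]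
  {cov : CovariantDerivative (𝓡 n) (EuclideanSpace ℝ (Fin n))
    (TangentSpace (𝓡 n) : M → Type _)}
  {G : Subgroup (Matrix.specialOrthogonalGroup (Fin n) ℝ)} {P : ParallelReduction cov G}
  {U : Set M} {s : ∀ y : M, Fin n → TangentSpace (𝓡 n) y}

theorem IsLocalSection.frameMul_const (hs : IsLocalSection P.fiber U s)
    {g : Matrix (Fin n) (Fin n) ℝ} (hg : g ∈ matSet G) :
    IsLocalSection P.fiber U (fun y => frameMul (s y) g) where
  isOpen := hs.isOpen
  mem y hy := P.frameMul_mem y _ (hs.mem y hy) g hg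
  contMDiffOn j := ContMDiffOn.sum_section fun i _ =>
    ContMDiffOn.smul_section (f := fun _ => g i j) contMDiffOn_const (hs.contMDiffOn i)

/-- There is a local section through each frame. -/
theorem exists_section_through (P : ParallelReduction cov G) {x : M}
    {u : Fin n → TangentSpace (𝓡 n) x} (hu : u ∈ P.fiber x) :
    ∃ U s, IsLocalSection P.fiber U s ∧ x ∈ U ∧ s x = u := by
  obtain ⟨U, s, hs, hx⟩ := P.exists_section x
  obtain ⟨g, hg, rfl⟩ := P.transitive x _ (hs.mem x hx) u hu
  exact ⟨U, _, hs.frameMul_const hg, hx, rfl⟩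

variable {V : Type*} [NormedAddCommGroup V] [InnerProductSpace ℂ V]
  {ρ : Representation ℂ G V} {L : Matrix (Fin n) (Fin n) ℝ →L[ℝ] (V →L[ℂ] V)}
  {ψ : FrameFun n M V}

theorem localDeriv_sum_smul (ψ : FrameFun n M V) (x : M) {ι : Type*} (t : Finset ι)
    (c : ι → ℝ) (a : ι → TangentSpace (𝓡 n) x) :
    localDeriv cov L ψ s x (∑ k ∈ t, c k • a k) = ∑ k ∈ t, c k • localDeriv cov L ψ s x (a k) := by
  simp only [localDeriv, connectionForm_sum_smul, map_sum, map_smul, smul_add,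
    Finset.sum_add_distrib, sum_apply, smul_apply]

variable [FiniteDimensional ℂ V]

theorem contr_nabla (ψ : FrameFun n M V) (x : M) (u : Fin n → TangentSpace (𝓡 n) x) (μ : Fin n) :
    contr μ (nabla P ρ ψ x u) = covDeriv P ρ ψ x u μ := by
  rw [nabla, contr_sum_tVec μ fun ν => covDeriv P ρ ψ x u ν]

variable [IsContMDiffRiemannianBundle (𝓡 n) ∞ (EuclideanSpace ℝ (Fin n))
  (fun x : M => TangentSpace (𝓡 n) x)]

/-- The local section chosen in `covDeriv` agrees with `s` at `x`, so the transition matrix there is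
`1` and `localDeriv_change` identifies the two derivatives. -/
theorem covDeriv_eq (hL : HasFDerivWithinAt (onMatrices ρ) L (matSet G) 1)
    (hψ : IsSection P ρ ψ) (hs : IsLocalSection P.fiber U s) {x : M} (hx : x ∈ U) (μ : Fin n) :
    covDeriv P ρ ψ x (s x) μ = localDeriv cov L ψ s x (s x μ) := by
  have hex : ∃ s' : ∀ y : M, Fin n → TangentSpace (𝓡 n) y,
      ∃ U, IsLocalSection P.fiber U s' ∧ x ∈ U ∧ s' x = s x := ⟨s, U, hs, hx, rfl⟩
  rw [covDeriv, dif_pos hex]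
  obtain ⟨U', hs', hx', he⟩ := hex.choose_spec
  have h1 := localDeriv_change hL hψ hs hs' hx hx' (s x μ)
  have h2 : transition (s x) (s x) = (1 : Matrix (Fin n) (Fin n) ℝ) := by
    have := transition_frameMul (P := P) (hs.mem x hx) 1
    rwa [frameMul_one] at this
  rw [he, h2, Matrix.transpose_one, onMatrices_one, one_apply_eq_self] at h1
  rw [← h1, localDeriv, he, differential_eq hL (P.connectionForm_mem U' _ hs' x hx' _)]

/-- Compute in `s` and in `s · g` with constant `g`: the value changes by `ρ(gᵀ)`, the direction by
linearity. -/
theorem covDeriv_frameMul (hL : HasFDerivWithinAt (onMatrices ρ) L (matSet G) 1)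
    (hψ : IsSection P ρ ψ) {x : M} {u : Fin n → TangentSpace (𝓡 n) x} (hu : u ∈ P.fiber x)
    {g : Matrix (Fin n) (Fin n) ℝ} (hg : g ∈ matSet G) (μ : Fin n) :
    covDeriv P ρ ψ x (frameMul u g) μ =
      ∑ ν, g ν μ • onMatrices ρ g.transpose (covDeriv P ρ ψ x u ν) := by
  obtain ⟨U, s, hs, hx, rfl⟩ := exists_section_through P hu
  have h1 := covDeriv_eq hL hψ (hs.frameMul_const hg) hx μ
  rw [h1, localDeriv_change hL hψ hs (hs.frameMul_const hg) hx hx,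
    transition_frameMul (hs.mem x hx)]
  simp only [covDeriv_eq hL hψ hs hx]
  rw [frameMul, localDeriv_sum_smul, map_sum]
  refine Finset.sum_congr rfl fun ν _ => ?_
  exact map_smul ((onMatrices ρ g.transpose).restrictScalars ℝ) _ _

/-- The covariant derivative of a smooth section is smooth. -/
theorem contMDiffOn_covDeriv [T2Space M] (hcov : IsLeviCivita cov)
    (hL : HasFDerivWithinAt (onMatrices ρ) L (matSet G) 1)
    (hψ : IsSection P ρ ψ) (hs : IsLocalSection P.fiber U s) (μ : Fin n) :
    ContMDiffOn (𝓡 n) 𝓘(ℝ, V) ∞ (fun y => covDeriv P ρ ψ y (s y) μ) U := by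
  have h1 : ContMDiffOn (𝓡 n) 𝓘(ℝ, V) ∞ (fun y => localDeriv cov L ψ s y (s y μ)) U := by
    refine (contMDiffOn_mvfderiv hs.isOpen (hψ.smooth U s hs) (hs.contMDiffOn μ)).add ?_
    have h2 := contMDiffOn_apply_connectionForm hcov hs (hs.contMDiffOn μ)
      ((ContinuousLinearMap.restrictScalarsL ℂ V V ℝ ℝ).toLinearMap ∘ₗ L.toLinearMap)
    exact h2.clm_apply (hψ.smooth U s hs)
  exact h1.congr fun y hy => covDeriv_eq hL hψ hs hy μ

theorem nabla_frameMul (hL : HasFDerivWithinAt (onMatrices ρ) L (matSet G) 1)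
    (hψ : IsSection P ρ ψ) {x : M} {u : Fin n → TangentSpace (𝓡 n) x} (hu : u ∈ P.fiber x)
    (g : G) : nabla P ρ ψ x (frameMul u ((g : Matrix.specialOrthogonalGroup (Fin n) ℝ) :
      Matrix (Fin n) (Fin n) ℝ)) = (complexRep G).tprod ρ g⁻¹ (nabla P ρ ψ x u) := by
  refine ext_contr fun μ => ?_
  rw [contr_nabla, covDeriv_frameMul hL hψ hu (coe_mem_matSet g), contr_tprod]
  refine Finset.sum_congr rfl fun ν _ => ?_
  have h2 : ((g : Matrix.specialOrthogonalGroup (Fin n) ℝ) :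
      Matrix (Fin n) (Fin n) ℝ).transpose =
      (((g⁻¹ : G) : Matrix.specialOrthogonalGroup (Fin n) ℝ) : Matrix (Fin n) (Fin n) ℝ) := rfl
  rw [contr_nabla, h2, onMatrices_coe, ← h2]
  rfl

theorem contMDiffOn_nabla [T2Space M] (hcov : IsLeviCivita cov)
    (hL : HasFDerivWithinAt (onMatrices ρ) L (matSet G) 1)
    (hψ : IsSection P ρ ψ) (hs : IsLocalSection P.fiber U s) :
    ContMDiffOn (𝓡 n) 𝓘(ℝ, TSpace n ⊗[ℂ] V) ∞ (fun y => nabla P ρ ψ y (s y)) U := by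
  refine contMDiffOn_finsetSum fun μ _ => ?_
  exact (((TensorProduct.mkL ℂ (TSpace n) V (tVec μ)).restrictScalars ℝ).contMDiff).comp_contMDiffOn
    (contMDiffOn_covDeriv hcov hL hψ hs μ)

/-- The Stein-Weiss operators map smooth sections to smooth sections. -/
theorem isSection_steinWeiss [T2Space M] (hcov : IsLeviCivita cov)
    (hL : HasFDerivWithinAt (onMatrices ρ) L (matSet G) 1)
    (hρ : ∀ (g : G) (v w : V), ⟪ρ g v, ρ g w⟫_ℂ = ⟪v, w⟫_ℂ)
    (W : Subrepresentation ((complexRep G).tprod ρ)) (hψ : IsSection P ρ ψ) :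
    IsSection P W.toRepresentation (steinWeiss P ρ W ψ) where
  equivariant x u hu g := by
    rw [steinWeiss, nabla_frameMul hL hψ hu, orthogonalProjectionOnto_tprod hρ]
    rfl
  smooth U s hs :=
    ((W.toSubmodule.orthogonalProjectionOnto.restrictScalars ℝ).contMDiff).comp_contMDiffOn
      (contMDiffOn_nabla hcov hL hψ hs)

end CovDeriv

/-! ### The curvature in a local frame -/

section Curvature

variable {n : ℕ} {M : Type*} [TopologicalSpace M] [ChartedSpace (EuclideanSpace ℝ (Fin n)) M]
  [IsManifold (𝓡 n) ∞ M]

/-- The curvature `∇_X ∇_Y Z - ∇_Y ∇_X Z - ∇_[X, Y] Z` of vector fields. -/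
def fieldCurvature (cov : CovariantDerivative (𝓡 n) (EuclideanSpace ℝ (Fin n))
    (TangentSpace (𝓡 n) : M → Type _)) (X Y Z : ∀ y : M, TangentSpace (𝓡 n) y) (x : M) :
    TangentSpace (𝓡 n) x :=
  cov (fun y => cov Z y (Y y)) x (X x) - cov (fun y => cov Z y (X y)) x (Y x)
    - cov Z x (VectorField.mlieBracket (𝓡 n) X Y x)

theorem exists_smoothOn_extend {x : M} (a : TangentSpace (𝓡 n) x) :
    ∃ U : Set M, IsOpen U ∧ x ∈ U ∧
      SmoothOn (FiberBundle.extend (EuclideanSpace ℝ (Fin n)) a) U := by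
  obtain ⟨U, hU, hs⟩ := FiberBundle.exists_contMDiffOn_extend (𝓡 n) (EuclideanSpace ℝ (Fin n)) (k := ∞) a
  obtain ⟨U', hU', ho, hx⟩ := mem_nhds_iff.1 hU
  exact ⟨U', ho, hx, hs.mono hU'⟩

variable {cov : CovariantDerivative (𝓡 n) (EuclideanSpace ℝ (Fin n))
  (TangentSpace (𝓡 n) : M → Type _)}

theorem fieldCurvature_swap (X Y Z : ∀ y : M, TangentSpace (𝓡 n) y) (x : M) :
    fieldCurvature cov X Y Z x = -fieldCurvature cov Y X Z x := by
  rw [fieldCurvature, fieldCurvature, VectorField.mlieBracket_swap_apply, map_neg]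
  abel

variable [RiemannianBundle (fun x : M => TangentSpace (𝓡 n) x)]
  [IsContMDiffRiemannianBundle (𝓡 n) ∞ (EuclideanSpace ℝ (Fin n))
    (fun x : M => TangentSpace (𝓡 n) x)]
  [T2Space M] {U : Set M}

/-- The pointwise analogue of `smoothOn_cov`, needed because tensoriality is tested on fields that
are merely differentiable at `x`. -/
theorem fieldDiffAt_cov (hcov : IsLeviCivita cov) (hU : IsOpen U)
    {Z X : ∀ y : M, TangentSpace (𝓡 n) y} (hZ : SmoothOn Z U) {x : M} (hx : x ∈ U)
    (hX : FieldDiffAt X x) : FieldDiffAt (fun y => cov Z y (X y)) x := by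
  obtain ⟨χ, -, hχ⟩ := (SmoothBumpFunction.nhds_basis_tsupport (I := 𝓡 n) x).mem_iff.1
    (hU.mem_nhds hx)
  have h1 : ContMDiff (𝓡 n) ((𝓡 n).prod 𝓘(ℝ, EuclideanSpace ℝ (Fin n))) ∞
      (fun y => (⟨y, ((χ : M → ℝ) • Z) y⟩ : TotalSpace (EuclideanSpace ℝ (Fin n))
        (TangentSpace (𝓡 n) : M → Type _))) :=
    ContMDiffOn.smul_section_of_tsupport χ.contMDiff.contMDiffOn hU hχ hZ
  have h2 := (hcov.smooth.contMDiff.contMDiff (σ := (χ : M → ℝ) • Z) h1.contMDiffOn).contMDiffAt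
    (x := x) univ_mem
  refine ((h2.mdifferentiableAt (by simp)).clm_bundle_apply hX).congr_of_eventuallyEq ?_
  filter_upwards [hU.mem_nhds hx, χ.eventuallyEq_one.eventuallyEq_nhds] with y hy hχy
  have h3 : cov Z y = cov ((χ : M → ℝ) • Z) y := by
    refine cov_congr (hZ.mdifferentiableAt hU hy) ?_
    filter_upwards [hχy] with w hw
    simp [hw]
  rw [h3]

/-- The derivative of `f` from the Leibniz rule for `∇_Y (f ∇_X Z)` cancels against the one in `[f
X, Y]`. -/
theorem tensorialAt_fieldCurvature (hcov : IsLeviCivita cov) (hU : IsOpen U)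
    {Y Z : ∀ y : M, TangentSpace (𝓡 n) y} {x : M} (hx : x ∈ U) (hZ : SmoothOn Z U) :
    TensorialAt (𝓡 n) (EuclideanSpace ℝ (Fin n)) (fun X => fieldCurvature cov X Y Z x) x where
  smul {f X} hf hX := by
    have h1 : (fun y => cov Z y ((f • X) y)) = f • fun y => cov Z y (X y) := by
      ext1 y; simp
    simp only [fieldCurvature]
    rw [h1, cov.isCovariantDerivativeOnUniv.leibniz (fieldDiffAt_cov hcov hU hZ hx hX) hf,
      VectorField.mlieBracket_smul_left hf hX]
    simp only [Pi.smul_apply', map_smul, map_add, add_apply, smul_apply,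
      ContinuousLinearMap.smulRight_apply]
    module
  add {X X'} hX hX' := by
    have h1 : (fun y => cov Z y ((X + X') y)) =
        (fun y => cov Z y (X y)) + fun y => cov Z y (X' y) := by
      ext1 y; simp
    simp only [fieldCurvature]
    rw [h1, cov.isCovariantDerivativeOnUniv.add (fieldDiffAt_cov hcov hU hZ hx hX)
      (fieldDiffAt_cov hcov hU hZ hx hX'), VectorField.mlieBracket_add_left hX hX']
    simp only [Pi.add_apply, map_add, add_apply]
    abel

theorem fieldCurvature_congr (hcov : IsLeviCivita cov) (hU : IsOpen U)
    {X X' Y Y' Z : ∀ y : M, TangentSpace (𝓡 n) y} {x : M} (hx : x ∈ U) (hZ : SmoothOn Z U)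
    (hX : FieldDiffAt X x) (hX' : FieldDiffAt X' x) (hY : FieldDiffAt Y x)
    (hY' : FieldDiffAt Y' x) (hXX : X x = X' x) (hYY : Y x = Y' x) :
    fieldCurvature cov X Y Z x = fieldCurvature cov X' Y' Z x := by
  have h1 := (tensorialAt_fieldCurvature hcov hU hx hZ (Y := Y)).pointwise hX hX' hXX
  have h2 := (tensorialAt_fieldCurvature hcov hU hx hZ (Y := X')).pointwise hY hY' hYY
  rw [h1, fieldCurvature_swap, h2, ← fieldCurvature_swap]

/-- The curvature is skew-symmetric, as the connection is metric. -/
theorem inner_fieldCurvature (hcov : IsLeviCivita cov) (hU : IsOpen U)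
    {X Y Z W : ∀ y : M, TangentSpace (𝓡 n) y} {x : M} (hx : x ∈ U) (hX : SmoothOn X U)
    (hY : SmoothOn Y U) (hZ : SmoothOn Z U) (hW : SmoothOn W U) :
    ⟪fieldCurvature cov X Y Z x, W x⟫_ℝ = -⟪Z x, fieldCurvature cov X Y W x⟫_ℝ := by
  have hd : ∀ {A : ∀ y : M, TangentSpace (𝓡 n) y}, SmoothOn A U → ∀ y ∈ U, FieldDiffAt A y :=
    fun hA y hy => hA.mdifferentiableAt hU hy
  -- Metricity is applied twice. The two mixed terms together are symmetric in `A` and `B`, so they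
  -- drop out of the commutator.
  have key : ∀ {A B : ∀ y : M, TangentSpace (𝓡 n) y}, SmoothOn A U → SmoothOn B U →
      mvfderiv (𝓡 n) (fun y => mvfderiv (𝓡 n) (fun y => ⟪Z y, W y⟫_ℝ) y (B y)) x (A x) =
        ⟪cov (fun y => cov Z y (B y)) x (A x), W x⟫_ℝ + ⟪cov Z x (B x), cov W x (A x)⟫_ℝ +
        (⟪cov Z x (A x), cov W x (B x)⟫_ℝ + ⟪Z x, cov (fun y => cov W y (B y)) x (A x)⟫_ℝ) := by
    intro A B hA hB
    have h1 : (fun y => mvfderiv (𝓡 n) (fun y => ⟪Z y, W y⟫_ℝ) y (B y)) =ᶠ[𝓝 x]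
        fun y => ⟪cov Z y (B y), W y⟫_ℝ + ⟪Z y, cov W y (B y)⟫_ℝ := by
      filter_upwards [hU.mem_nhds hx] with y hy
      exact hcov.mvfderiv_inner (hd hZ y hy) (hd hW y hy) (B y)
    rw [mvfderiv_congr h1]
    have hZB := smoothOn_cov hcov hU hZ hB
    have hWB := smoothOn_cov hcov hU hW hB
    have h2 := hcov.mvfderiv_inner (hd hZB x hx) (hd hW x hx) (A x)
    have h3 := hcov.mvfderiv_inner (hd hZ x hx) (hd hWB x hx) (A x)
    rw [mvfderiv_fun_add
      (((contMDiffOn_inner hZB hW).contMDiffAt (hU.mem_nhds hx)).mdifferentiableAt (by simp))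
      (((contMDiffOn_inner hZ hWB).contMDiffAt (hU.mem_nhds hx)).mdifferentiableAt (by simp)),
      add_apply, h2, h3]
  have h1 := mvfderiv_mlieBracket hU (contMDiffOn_inner hZ hW) hX hY hx
  rw [key hX hY, key hY hX, hcov.mvfderiv_inner (hd hZ x hx) (hd hW x hx)] at h1
  simp only [fieldCurvature, inner_sub_left, inner_sub_right]
  linarith

/-- For `X` and `Y` the independence of the extension is tensoriality. For `Z` it follows from
skew-symmetry: `⟨R(X, Y) Z, W⟩ = -⟨Z, R(X, Y) W⟩`, whose right side involves only the value of `Z`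
at `x`. -/
theorem curvature_eq_fieldCurvature (hcov : IsLeviCivita cov) (hU : IsOpen U)
    {X Y Z : ∀ y : M, TangentSpace (𝓡 n) y} {x : M} (hx : x ∈ U) (hX : SmoothOn X U)
    (hY : SmoothOn Y U) (hZ : SmoothOn Z U) :
    curvature cov x (X x) (Y x) (Z x) = fieldCurvature cov X Y Z x := by
  obtain ⟨UX, hUX, hxX, hX'⟩ := exists_smoothOn_extend (X x)
  obtain ⟨UY, hUY, hxY, hY'⟩ := exists_smoothOn_extend (Y x)
  obtain ⟨UZ, hUZ, hxZ, hZ'⟩ := exists_smoothOn_extend (Z x)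
  have h1 : curvature cov x (X x) (Y x) (Z x) = fieldCurvature cov X Y
      (FiberBundle.extend (EuclideanSpace ℝ (Fin n)) (Z x)) x := by
    refine fieldCurvature_congr hcov hUZ hxZ hZ' (hX'.mdifferentiableAt hUX hxX)
      (hX.mdifferentiableAt hU hx) (hY'.mdifferentiableAt hUY hxY) (hY.mdifferentiableAt hU hx)
      (by simp) (by simp)
  rw [h1]
  refine ext_inner_right ℝ fun w => ?_
  obtain ⟨UW, hUW, hxW, hW⟩ := exists_smoothOn_extend w
  have hw : FiberBundle.extend (EuclideanSpace ℝ (Fin n)) w x = w := by simp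
  rw [← hw]
  have ho := (hU.inter hUZ).inter hUW
  have h2 := inner_fieldCurvature hcov ho ⟨⟨hx, hxZ⟩, hxW⟩ (hX.mono fun y hy => hy.1.1)
    (hY.mono fun y hy => hy.1.1) (hZ.mono fun y hy => hy.1.1) (hW.mono fun y hy => hy.2)
  have h3 := inner_fieldCurvature hcov ho ⟨⟨hx, hxZ⟩, hxW⟩ (hX.mono fun y hy => hy.1.1)
    (hY.mono fun y hy => hy.1.1) (hZ'.mono fun y hy => hy.1.2) (hW.mono fun y hy => hy.2)
  rw [h2, h3]
  simp

variable {G : Subgroup (Matrix.specialOrthogonalGroup (Fin n) ℝ)} {P : ParallelReduction cov G}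
  {s : ∀ y : M, Fin n → TangentSpace (𝓡 n) y}

/-- The Leibniz rule applied to `∇_X s_j = ∑_k ω_kj(X) s_k`. -/
theorem inner_cov_cov_frame (hcov : IsLeviCivita cov) (hs : IsLocalSection P.fiber U s) {x : M}
    (hx : x ∈ U) {X : ∀ y : M, TangentSpace (𝓡 n) y} (hX : SmoothOn X U)
    (a : TangentSpace (𝓡 n) x) (i j : Fin n) :
    ⟪s x i, cov (fun y => cov (fun w => s w j) y (X y)) x a⟫_ℝ =
      (connectionForm cov s x a * connectionForm cov s x (X x)) i j +
      mvfderiv (𝓡 n) (fun y => connectionForm cov s y (X y) i j) x a := by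
  have h1 : cov (fun y => cov (fun w => s w j) y (X y)) x a =
      ∑ k, (connectionForm cov s x (X x) k j • cov (fun y => s y k) x a +
        mvfderiv (𝓡 n) (fun y => connectionForm cov s y (X y) k j) x a • s x k) := by
    rw [← cov_sum_smul Finset.univ (fun k => ((contMDiffOn_connectionForm hcov hs hX k
      j).contMDiffAt (hs.isOpen.mem_nhds hx)).mdifferentiableAt (by simp))
      fun k => hs.fieldDiffAt hx k]
    refine congrArg (fun l : TangentSpace (𝓡 n) x →L[ℝ] TangentSpace (𝓡 n) x => l a) ?_
    refine cov_congr ((smoothOn_cov hcov hs.isOpen (hs.contMDiffOn j)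
      hX).mdifferentiableAt hs.isOpen hx) ?_
    filter_upwards [hs.isOpen.mem_nhds hx] with y hy
    exact cov_frame hs hy j (X y)
  have h4 : ∀ l k, ⟪s x l, cov (fun y => s y k) x a⟫_ℝ = connectionForm cov s x a l k :=
    fun _ _ => rfl
  rw [h1]
  simp only [inner_sum, inner_add_right, inner_smul_right, h4, Finset.sum_add_distrib,
    inner_frame (P.orthonormal x _ (hs.mem x hx)), Matrix.mul_apply, Matrix.one_apply]
  congr 1
  · exact Finset.sum_congr rfl fun k _ => mul_comm _ _
  · simp

/-- The structure equation. -/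
theorem frameCurvature_eq (hcov : IsLeviCivita cov) (hs : IsLocalSection P.fiber U s) {x : M}
    (hx : x ∈ U) (μ ν i j : Fin n) :
    frameCurvature cov x (s x) μ ν i j =
      mvfderiv (𝓡 n) (fun y => connectionForm cov s y (s y ν) i j) x (s x μ) -
      mvfderiv (𝓡 n) (fun y => connectionForm cov s y (s y μ) i j) x (s x ν) -
      connectionForm cov s x (VectorField.mlieBracket (𝓡 n) (fun y => s y μ) (fun y => s y ν) x)
        i j +
      (connectionForm cov s x (s x μ) * connectionForm cov s x (s x ν) -
        connectionForm cov s x (s x ν) * connectionForm cov s x (s x μ)) i j := by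
  have h1 : frameCurvature cov x (s x) μ ν i j =
      ⟪s x i, curvature cov x (s x μ) (s x ν) (s x j)⟫_ℝ := rfl
  rw [h1, curvature_eq_fieldCurvature hcov hs.isOpen hx (hs.contMDiffOn μ) (hs.contMDiffOn ν)
    (hs.contMDiffOn j), fieldCurvature, inner_sub_right, inner_sub_right,
    inner_cov_cov_frame hcov hs hx (hs.contMDiffOn ν),
    inner_cov_cov_frame hcov hs hx (hs.contMDiffOn μ)]
  simp only [Matrix.sub_apply]
  have h2 : ∀ a, ⟪s x i, cov (fun y => s y j) x a⟫_ℝ = connectionForm cov s x a i j :=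
    fun _ => rfl
  rw [h2]
  ring

end Curvature

/-! ### The commutator of second covariant derivatives -/

section Commutator

attribute [local instance] Matrix.normedAddCommGroup Matrix.normedSpace in
theorem mem_of_hasDerivAt_of_eventually_mem {n : ℕ} (S : Submodule ℝ (Matrix (Fin n) (Fin n) ℝ))
    {γ : ℝ → Matrix (Fin n) (Fin n) ℝ} {Y : Matrix (Fin n) (Fin n) ℝ}
    (hd : HasDerivAt γ Y 0) (h : ∀ᶠ t in 𝓝 0, γ t ∈ S) : Y ∈ S := by
  classical
  -- Setting the curve to `0` where it leaves `S` does not change its germ at `0`.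
  refine mem_of_hasDerivAt_of_forall_mem S (t := 0) (γ := fun t => if γ t ∈ S then γ t else 0) ?_ ?_
  · refine hd.congr_of_eventuallyEq ?_
    filter_upwards [h] with t ht
    simp [ht]
  · intro t
    split_ifs with ht
    · exact ht
    · exact S.zero_mem

variable {n : ℕ} {M : Type*} [TopologicalSpace M] [ChartedSpace (EuclideanSpace ℝ (Fin n)) M]
  [IsManifold (𝓡 n) ∞ M]

theorem mvfderiv_eq_of_hasDerivAt {F : Type*} [NormedAddCommGroup F] [NormedSpace ℝ F] {f : M → F}
    {x : M} (hf : MDifferentiableAt (𝓡 n) 𝓘(ℝ, F) f x) {a : TangentSpace (𝓡 n) x} {D : F}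
    (h : HasDerivAt (fun t => f (curve x a t)) D 0) : mvfderiv (𝓡 n) f x a = D :=
  (hasDerivAt_comp_curve hf a).unique h

theorem mvfderiv_clm_comp {F F' : Type*} [NormedAddCommGroup F] [NormedSpace ℝ F]
    [NormedAddCommGroup F'] [NormedSpace ℝ F'] (T : F →L[ℝ] F') {f : M → F}
    {x : M} (hf : MDifferentiableAt (𝓡 n) 𝓘(ℝ, F) f x) (a : TangentSpace (𝓡 n) x) :
    mvfderiv (𝓡 n) (fun y => T (f y)) x a = T (mvfderiv (𝓡 n) f x a) :=
  mvfderiv_eq_of_hasDerivAt (T.mdifferentiableAt.comp x hf)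
    (T.hasFDerivAt.comp_hasDerivAt 0 (hasDerivAt_comp_curve hf a))

theorem mvfderiv_finset_sum {F ι : Type*} [NormedAddCommGroup F] [NormedSpace ℝ F] (t : Finset ι)
    {f : ι → M → F} {x : M} (hf : ∀ i, MDifferentiableAt (𝓡 n) 𝓘(ℝ, F) (f i) x)
    (a : TangentSpace (𝓡 n) x) :
    mvfderiv (𝓡 n) (fun y => ∑ i ∈ t, f i y) x a = ∑ i ∈ t, mvfderiv (𝓡 n) (f i) x a := by
  refine mvfderiv_eq_of_hasDerivAt ?_ (HasDerivAt.fun_sum fun i _ => hasDerivAt_comp_curve (hf i) a)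
  classical
  induction t using Finset.induction_on with
  | empty => simpa using mdifferentiableAt_const
  | insert i t hi ih =>
    simp only [Finset.sum_insert hi]
    exact (hf i).add ih

variable [RiemannianBundle (fun x : M => TangentSpace (𝓡 n) x)]
  [IsContMDiffRiemannianBundle (𝓡 n) ∞ (EuclideanSpace ℝ (Fin n))
    (fun x : M => TangentSpace (𝓡 n) x)]
  {U : Set M} {cov : CovariantDerivative (𝓡 n) (EuclideanSpace ℝ (Fin n))
    (TangentSpace (𝓡 n) : M → Type _)}
  {G : Subgroup (Matrix.specialOrthogonalGroup (Fin n) ℝ)} {P : ParallelReduction cov G}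
  {s : ∀ y : M, Fin n → TangentSpace (𝓡 n) y}

/-- Torsion-freeness: `[s_μ, s_ν] = ∇_{s_μ} s_ν - ∇_{s_ν} s_μ`. -/
theorem mlieBracket_frame (hcov : IsLeviCivita cov) (hs : IsLocalSection P.fiber U s)
    {x : M} (hx : x ∈ U) (μ ν : Fin n) :
    VectorField.mlieBracket (𝓡 n) (fun y => s y μ) (fun y => s y ν) x =
      ∑ κ, (connectionForm cov s x (s x μ) κ ν - connectionForm cov s x (s x ν) κ μ) • s x κ := by
  rw [hcov.mlieBracket_eq (hs.fieldDiffAt hx μ) (hs.fieldDiffAt hx ν), cov_frame hs hx,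
    cov_frame hs hx, ← Finset.sum_sub_distrib]
  simp only [sub_smul]

variable [T2Space M]

/-- The derivative along `s_μ` of the matrix function `ω(s_ν)`. -/
def derivConnectionForm (cov : CovariantDerivative (𝓡 n) (EuclideanSpace ℝ (Fin n))
    (TangentSpace (𝓡 n) : M → Type _)) (s : ∀ y : M, Fin n → TangentSpace (𝓡 n) y) (x : M)
    (μ ν : Fin n) : Matrix (Fin n) (Fin n) ℝ :=
  Matrix.of fun i j => mvfderiv (𝓡 n) (fun y => connectionForm cov s y (s y ν) i j) x (s x μ)

attribute [local instance] Matrix.normedAddCommGroup Matrix.normedSpace in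
theorem hasDerivAt_connectionForm (hcov : IsLeviCivita cov) (hs : IsLocalSection P.fiber U s)
    {x : M} (hx : x ∈ U) (μ ν : Fin n) :
    HasDerivAt (fun t => connectionForm cov s (curve x (s x μ) t) (s (curve x (s x μ) t) ν))
      (derivConnectionForm cov s x μ ν) 0 := by
  refine hasDerivAt_pi.2 fun i => hasDerivAt_pi.2 fun j => ?_
  exact hasDerivAt_comp_curve (((contMDiffOn_connectionForm hcov hs (hs.contMDiffOn ν) i
    j).contMDiffAt (hs.isOpen.mem_nhds hx)).mdifferentiableAt (by simp)) _

theorem derivConnectionForm_mem (hG : IsClosed (matSet G)) (hcov : IsLeviCivita cov)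
    (hs : IsLocalSection P.fiber U s) {x : M} (hx : x ∈ U) (μ ν : Fin n) :
    derivConnectionForm cov s x μ ν ∈ lieAlg G := by
  refine mem_of_hasDerivAt_of_eventually_mem (lieSubmodule hG)
    (hasDerivAt_connectionForm hcov hs hx μ ν) ?_
  have h1 : ∀ᶠ t in 𝓝 (0 : ℝ), curve x (s x μ) t ∈ U := by
    refine (continuousAt_curve x _).preimage_mem_nhds ?_
    rw [curve_zero]
    exact hs.isOpen.mem_nhds hx
  filter_upwards [h1] with t ht
  exact P.connectionForm_mem U s hs _ ht _

theorem frameCurvature_eq_matrix (hcov : IsLeviCivita cov) (hs : IsLocalSection P.fiber U s)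
    {x : M} (hx : x ∈ U) (μ ν : Fin n) :
    frameCurvature cov x (s x) μ ν =
      derivConnectionForm cov s x μ ν - derivConnectionForm cov s x ν μ -
      connectionForm cov s x
        (VectorField.mlieBracket (𝓡 n) (fun y => s y μ) (fun y => s y ν) x) +
      (connectionForm cov s x (s x μ) * connectionForm cov s x (s x ν) -
        connectionForm cov s x (s x ν) * connectionForm cov s x (s x μ)) := by
  ext i j
  rw [frameCurvature_eq hcov hs hx]
  rfl

/-- By the structure equation the curvature is a sum of derivatives, values and brackets of a form
with values in the Lie algebra. Only after this can the curvature act on `V`. -/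
theorem frameCurvature_mem (hG : IsClosed (matSet G)) (hcov : IsLeviCivita cov)
    (hs : IsLocalSection P.fiber U s) {x : M} (hx : x ∈ U) (μ ν : Fin n) :
    frameCurvature cov x (s x) μ ν ∈ lieAlg G := by
  rw [frameCurvature_eq_matrix hcov hs hx]
  have h1 := P.connectionForm_mem U s hs x hx
  exact (lieSubmodule hG).add_mem ((lieSubmodule hG).sub_mem ((lieSubmodule hG).sub_mem
    (derivConnectionForm_mem hG hcov hs hx μ ν) (derivConnectionForm_mem hG hcov hs hx ν μ))
    (h1 _)) (bracket_mem_lieAlg hG (h1 _) (h1 _))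

variable {V : Type*} [NormedAddCommGroup V] [InnerProductSpace ℂ V]
  {ρ : Representation ℂ G V} {L : Matrix (Fin n) (Fin n) ℝ →L[ℝ] (V →L[ℂ] V)}
  {ψ : FrameFun n M V}

/-- The component `∇²_{s_μ, s_ν} ψ` of the second covariant derivative. -/
def secondDeriv (cov : CovariantDerivative (𝓡 n) (EuclideanSpace ℝ (Fin n))
    (TangentSpace (𝓡 n) : M → Type _)) (L : Matrix (Fin n) (Fin n) ℝ →L[ℝ] (V →L[ℂ] V))
    (ψ : FrameFun n M V) (s : ∀ y : M, Fin n → TangentSpace (𝓡 n) y) (x : M) (μ ν : Fin n) : V :=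
  mvfderiv (𝓡 n) (fun y => localDeriv cov L ψ s y (s y ν)) x (s x μ) +
    ∑ κ, connectionForm cov s x (s x μ) ν κ • localDeriv cov L ψ s x (s x κ) +
    L (connectionForm cov s x (s x μ)) (localDeriv cov L ψ s x (s x ν))

attribute [local instance] Matrix.normedAddCommGroup Matrix.normedSpace in
theorem mvfderiv_localDeriv (hcov : IsLeviCivita cov) (hψ : IsSection P ρ ψ)
    (hs : IsLocalSection P.fiber U s) {x : M} (hx : x ∈ U) (μ ν : Fin n) :
    mvfderiv (𝓡 n) (fun y => localDeriv cov L ψ s y (s y ν)) x (s x μ) =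
      mvfderiv (𝓡 n) (fun y => mvfderiv (𝓡 n) (fun z => ψ z (s z)) y (s y ν)) x (s x μ) +
      (L (derivConnectionForm cov s x μ ν) (ψ x (s x)) +
        L (connectionForm cov s x (s x ν)) (mvfderiv (𝓡 n) (fun y => ψ y (s y)) x (s x μ))) := by
  let ap : (V →L[ℂ] V) →L[ℝ] V →L[ℝ] V := ContinuousLinearMap.restrictScalarsL ℂ V V ℝ ℝ
  have h0 : ∀ {F : Type _} [NormedAddCommGroup F] [NormedSpace ℝ F] {f : M → F},
      ContMDiffOn (𝓡 n) 𝓘(ℝ, F) ∞ f U → MDifferentiableAt (𝓡 n) 𝓘(ℝ, F) f x := fun hf =>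
    (hf.contMDiffAt (hs.isOpen.mem_nhds hx)).mdifferentiableAt (by simp)
  have h1 := contMDiffOn_mvfderiv hs.isOpen (hψ.smooth U s hs) (hs.contMDiffOn ν)
  have h2 := (contMDiffOn_apply_connectionForm hcov hs (hs.contMDiffOn ν)
    (ap.toLinearMap ∘ₗ L.toLinearMap)).clm_apply (hψ.smooth U s hs)
  have h3 := hasDerivAt_comp_curve (h0 h1) (s x μ)
  have h4 := (ap.hasFDerivAt.comp_hasDerivAt (0 : ℝ)
    (L.hasFDerivAt.comp_hasDerivAt (0 : ℝ) (hasDerivAt_connectionForm hcov hs hx μ ν))).clm_apply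
    (hasDerivAt_comp_curve (hψ.mdifferentiableAt hs hx) (s x μ))
  refine mvfderiv_eq_of_hasDerivAt (h0 (h1.add h2)) ((h3.add h4).congr_deriv ?_)
  simp only [Function.comp_def]
  rw [curve_zero]
  rfl

/-- The Ricci identity: the second covariant derivatives commute up to the curvature. -/
theorem secondDeriv_sub (hcov : IsLeviCivita cov) [FiniteDimensional ℂ V]
    (hL : HasFDerivWithinAt (onMatrices ρ) L (matSet G) 1) (hψ : IsSection P ρ ψ)
    (hs : IsLocalSection P.fiber U s) {x : M} (hx : x ∈ U) (μ ν : Fin n) :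
    secondDeriv cov L ψ s x μ ν - secondDeriv cov L ψ s x ν μ =
      L (frameCurvature cov x (s x) μ ν) (ψ x (s x)) := by
  have hω := P.connectionForm_mem U s hs x hx
  have hskew : ∀ a i j, connectionForm cov s x a i j = -connectionForm cov s x a j i := by
    intro a i j
    have := congrFun (congrFun (transpose_eq_neg_of_mem_lieAlg (hω a)) j) i
    simpa using this
  have h1 := mvfderiv_mlieBracket hs.isOpen (hψ.smooth U s hs) (hs.contMDiffOn μ)
    (hs.contMDiffOn ν) hx
  -- The connection terms on the `T` index of the two second derivatives combine to `-∇_{[s_μ,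
  -- s_ν]}`. The remainder is the usual commutator, evaluated with `mvfderiv_mlieBracket` and the
  -- structure equation.
  have h2 : localDeriv cov L ψ s x
      (VectorField.mlieBracket (𝓡 n) (fun y => s y μ) (fun y => s y ν) x) =
      -∑ κ, connectionForm cov s x (s x μ) ν κ • localDeriv cov L ψ s x (s x κ) +
      ∑ κ, connectionForm cov s x (s x ν) μ κ • localDeriv cov L ψ s x (s x κ) := by
    rw [mlieBracket_frame hcov hs hx, localDeriv_sum_smul, ← Finset.sum_neg_distrib,
      ← Finset.sum_add_distrib]
    refine Finset.sum_congr rfl fun κ _ => ?_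
    rw [hskew _ κ ν, hskew _ κ μ]
    module
  have h3 := apply_bracket hL (hω (s x μ)) (hω (s x ν))
  have h4 : L (frameCurvature cov x (s x) μ ν) = L (derivConnectionForm cov s x μ ν) -
      L (derivConnectionForm cov s x ν μ) - L (connectionForm cov s x
        (VectorField.mlieBracket (𝓡 n) (fun y => s y μ) (fun y => s y ν) x)) +
      (L (connectionForm cov s x (s x μ)) * L (connectionForm cov s x (s x ν)) -
        L (connectionForm cov s x (s x ν)) * L (connectionForm cov s x (s x μ))) := by
    rw [frameCurvature_eq_matrix hcov hs hx, map_add, map_sub, map_sub, h3]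
  rw [secondDeriv, secondDeriv, mvfderiv_localDeriv hcov hψ hs hx,
    mvfderiv_localDeriv hcov hψ hs hx, h4]
  have h5 : localDeriv cov L ψ s x
      (VectorField.mlieBracket (𝓡 n) (fun y => s y μ) (fun y => s y ν) x) =
      mvfderiv (𝓡 n) (fun y => ψ y (s y)) x
        (VectorField.mlieBracket (𝓡 n) (fun y => s y μ) (fun y => s y ν) x) +
      L (connectionForm cov s x
        (VectorField.mlieBracket (𝓡 n) (fun y => s y μ) (fun y => s y ν) x)) (ψ x (s x)) := rfl
  rw [h5, h1] at h2
  have h6 : ∀ κ, localDeriv cov L ψ s x (s x κ) = mvfderiv (𝓡 n) (fun y => ψ y (s y)) x (s x κ) +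
      L (connectionForm cov s x (s x κ)) (ψ x (s x)) := fun κ => rfl
  rw [h6 μ, h6 ν]
  simp only [add_apply, sub_apply, mul_apply_eq_comp, map_add]
  rw [← sub_eq_zero] at h2
  rw [← sub_eq_zero, ← h2]
  abel

end Commutator

/-! ### The pointwise Weitzenböck formula -/

section Pointwise

theorem IsIrreducibleDecomposition.sum_orthogonalProjectionOnto {n : ℕ}
    {G : Subgroup (Matrix.specialOrthogonalGroup (Fin n) ℝ)}
    {V : Type*} [NormedAddCommGroup V] [InnerProductSpace ℂ V] [FiniteDimensional ℂ V]
    {ρ : Representation ℂ G V} {ι : Type*} [Fintype ι]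
    {W : ι → Subrepresentation ((complexRep G).tprod ρ)} (hW : IsIrreducibleDecomposition W)
    (w : TSpace n ⊗[ℂ] V) :
    ∑ i, ((W i).toSubmodule.orthogonalProjectionOnto w : TSpace n ⊗[ℂ] V) = w := by
  have h1 : OrthogonalFamily ℂ (fun i => (W i).toSubmodule)
      fun i => (W i).toSubmodule.subtypeₗᵢ :=
    OrthogonalFamily.of_pairwise fun i j hij => hW.orthogonal i j hij
  exact h1.sum_projection_of_mem_iSup w (hW.iSup_eq_top ▸ Submodule.mem_top)

theorem wedge_swap {n : ℕ} (μ ν : Fin n) : wedge ν μ = -wedge μ ν := by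
  simp [wedge]

theorem soInner_neg_right {n : ℕ} (X Y : Matrix (Fin n) (Fin n) ℝ) :
    soInner X (-Y) = -soInner X Y := by
  simp [soInner]

/-- The conformal weight operator commutes with the infinitesimal action of the Lie algebra. -/
theorem conformalWeightOp_tensorAct {n : ℕ}
    {G : Subgroup (Matrix.specialOrthogonalGroup (Fin n) ℝ)}
    {V : Type*} [NormedAddCommGroup V] [InnerProductSpace ℂ V] [FiniteDimensional ℂ V]
    {ρ : Representation ℂ G V} {h : Submodule ℝ (Matrix (Fin n) (Fin n) ℝ)} {d : ℕ}
    {X : Fin d → Matrix (Fin n) (Fin n) ℝ} {L : Matrix (Fin n) (Fin n) ℝ →L[ℝ] (V →L[ℂ] V)}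
    (hG : IsClosed (matSet G)) (hc : IsPathConnectedGroup G)
    (hh : IsIdeal G h) (hX : IsOrthonormalBasis h X)
    (hL : HasFDerivWithinAt (onMatrices ρ) L (matSet G) 1) {Y : Matrix (Fin n) (Fin n) ℝ}
    (hY : Y ∈ lieAlg G) (w : TSpace n ⊗[ℂ] V) :
    conformalWeightOp h ρ (tensorAct Y (L Y) w) =
      tensorAct Y (L Y) (conformalWeightOp h ρ w) := by
  obtain ⟨D, hD, hd⟩ := hasFDerivWithinAt_tensor hL w
  obtain ⟨D', hD', hd'⟩ := hasFDerivWithinAt_tensor hL (conformalWeightOp h ρ w)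
  have h1 := hasDerivAt_comp_of_mem hd hY (by simp) (hasDerivAt_exp_smul Y)
  have h2 := hasDerivAt_comp_of_mem hd' hY (by simp) (hasDerivAt_exp_smul Y)
  have h3 := ((LinearMap.toContinuousLinearMap
    (conformalWeightOp h ρ)).restrictScalars ℝ).hasFDerivAt.comp_hasDerivAt 0 h1
  rw [← hD, ← hD']
  refine h3.unique (h2.congr_of_eventuallyEq (Eventually.of_forall fun t => ?_))
  obtain ⟨g, hg, he⟩ := hY t
  simp only [Function.comp_def, ← he]
  have h4 := tprod_eq_sum ρ ⟨g, hg⟩ w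
  have h5 := tprod_eq_sum ρ ⟨g, hg⟩ (conformalWeightOp h ρ w)
  have h6 := conformalWeightOp_tprod hG hc hh hX hL ⟨g, hg⟩ w
  rw [h4, h5] at h6
  exact h6

variable {n : ℕ} {M : Type*} [TopologicalSpace M] [ChartedSpace (EuclideanSpace ℝ (Fin n)) M]
  [IsManifold (𝓡 n) ∞ M] [RiemannianBundle (fun x : M => TangentSpace (𝓡 n) x)]
  {cov : CovariantDerivative (𝓡 n) (EuclideanSpace ℝ (Fin n))
    (TangentSpace (𝓡 n) : M → Type _)}
  {G : Subgroup (Matrix.specialOrthogonalGroup (Fin n) ℝ)} {P : ParallelReduction cov G}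
  {V : Type*} [NormedAddCommGroup V] [InnerProductSpace ℂ V]
  {V' : Type*} [NormedAddCommGroup V'] [InnerProductSpace ℂ V'] [FiniteDimensional ℂ V']

/-- The operator `-∑_μ ι(u_μ) ∇_{u_μ}`, from sections of a bundle embedded by `j` in `T ⊗ V` to
sections of the bundle of `V`. It is the formal adjoint of `ψ ↦ j^* ∇ψ`. -/
def codifferential (P : ParallelReduction cov G) (ρ' : Representation ℂ G V')
    (j : V' →ₗ[ℂ] (TSpace n ⊗[ℂ] V)) (φ : FrameFun n M V') : FrameFun n M V :=
  fun x u => -∑ μ, contr μ (j (covDeriv P ρ' φ x u μ))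

variable [IsContMDiffRiemannianBundle (𝓡 n) ∞ (EuclideanSpace ℝ (Fin n))
    (fun x : M => TangentSpace (𝓡 n) x)] [T2Space M]
  {ρ : Representation ℂ G V} {ρ' : Representation ℂ G V'}
  {L : Matrix (Fin n) (Fin n) ℝ →L[ℝ] (V →L[ℂ] V)}
  {L' : Matrix (Fin n) (Fin n) ℝ →L[ℝ] (V' →L[ℂ] V')}
  {ψ : FrameFun n M V} {φ : FrameFun n M V'} {j : V' →ₗ[ℂ] (TSpace n ⊗[ℂ] V)}

theorem isSection_codifferential (hcov : IsLeviCivita cov)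
    (hL' : HasFDerivWithinAt (onMatrices ρ') L' (matSet G) 1)
    (hj : ∀ g w, j (ρ' g w) = (complexRep G).tprod ρ g (j w)) (hφ : IsSection P ρ' φ) :
    IsSection P ρ (codifferential P ρ' j φ) where
  equivariant x u hu g := by
    have h0 := self_mul_transpose_of_mem (coe_mem_matSet g)
    have h2 : ((g : Matrix.specialOrthogonalGroup (Fin n) ℝ) :
        Matrix (Fin n) (Fin n) ℝ).transpose =
        (((g⁻¹ : G) : Matrix.specialOrthogonalGroup (Fin n) ℝ) : Matrix (Fin n) (Fin n) ℝ) := rfl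
    have h3 : ∀ (μ : Fin n) (r : ℝ) (w : V'), contr μ (j (r • w)) = r • contr μ (j w) :=
      fun μ r w => map_smul ((contr μ ∘ₗ j).restrictScalars ℝ) r w
    rw [codifferential, codifferential, map_neg, neg_inj, map_sum]
    simp only [covDeriv_frameMul hL' hφ hu (coe_mem_matSet g), h2, onMatrices_coe, map_sum, h3,
      LinearMap.coe_toContinuousLinearMap', hj, contr_tprod]
    simp only [← h2]
    simp only [Matrix.transpose_apply, Finset.smul_sum, smul_smul]
    rw [Finset.sum_comm]
    refine Finset.sum_congr rfl fun ν _ => ?_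
    rw [Finset.sum_comm]
    simp only [← Finset.sum_smul]
    -- The contraction over `μ` is invariant because `g` is orthogonal.
    have h5 : ∀ κ, ∑ μ, ((g : Matrix.specialOrthogonalGroup (Fin n) ℝ) :
        Matrix (Fin n) (Fin n) ℝ) ν μ * ((g : Matrix.specialOrthogonalGroup (Fin n) ℝ) :
        Matrix (Fin n) (Fin n) ℝ) κ μ = if ν = κ then 1 else 0 := fun κ => by
      simpa [Matrix.mul_apply, Matrix.one_apply] using congrFun (congrFun h0 ν) κ
    simp [h5]
  smooth U s hs := by
    refine (contMDiffOn_finsetSum fun μ _ => ?_).neg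
    exact (((LinearMap.toContinuousLinearMap (contr μ ∘ₗ j)).restrictScalars
      ℝ).contMDiff).comp_contMDiffOn (contMDiffOn_covDeriv hcov hL' hφ hs μ)

variable [FiniteDimensional ℂ V]

/-- The argument of `contr ν` is the covariant derivative of `∇ψ` in the bundle of `T ⊗ V`. The `T`
part of its connection accounts for the middle term of `secondDeriv`. -/
theorem contr_secondDeriv (hcov : IsLeviCivita cov)
    (hL : HasFDerivWithinAt (onMatrices ρ) L (matSet G) 1) (hψ : IsSection P ρ ψ)
    {U : Set M} {s : ∀ y : M, Fin n → TangentSpace (𝓡 n) y}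
    (hs : IsLocalSection P.fiber U s) {x : M} (hx : x ∈ U) (μ ν : Fin n) :
    contr ν (mvfderiv (𝓡 n) (fun y => nabla P ρ ψ y (s y)) x (s x μ) +
      tensorAct (connectionForm cov s x (s x μ)) (L (connectionForm cov s x (s x μ)))
        (nabla P ρ ψ x (s x))) = secondDeriv cov L ψ s x μ ν := by
  have h1 := mvfderiv_clm_comp ((LinearMap.toContinuousLinearMap
      (contr (V := V) ν)).restrictScalars ℝ)
    (((contMDiffOn_nabla hcov hL hψ hs).contMDiffAt
      (hs.isOpen.mem_nhds hx)).mdifferentiableAt (by simp)) (s x μ)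
  rw [map_add, contr_tensorAct, secondDeriv, ← add_assoc]
  simp only [contr_nabla, covDeriv_eq hL hψ hs hx]
  congr 2
  refine h1.symm.trans (mvfderiv_congr ?_ _)
  filter_upwards [hs.isOpen.mem_nhds hx] with y hy
  rw [← covDeriv_eq hL hψ hs hy]
  exact contr_nabla ψ y (s y) ν

/-- The universal Weitzenböck formula for the explicit adjoints of the Stein-Weiss operators. -/
theorem curvatureEndo_eq (hcov : IsLeviCivita cov) (hG : IsClosed (matSet G))
    (hc : IsPathConnectedGroup G)
    (hL : HasFDerivWithinAt (onMatrices ρ) L (matSet G) 1)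
    (hρ : ∀ (g : G) (v w : V), ⟪ρ g v, ρ g w⟫_ℂ = ⟪v, w⟫_ℂ) {ι : Type*} [Fintype ι]
    {W : ι → Subrepresentation ((complexRep G).tprod ρ)} (hW : IsIrreducibleDecomposition W)
    {h : Submodule ℝ (Matrix (Fin n) (Fin n) ℝ)} (hh : IsIdeal G h)
    {d : ℕ} {X : Fin d → Matrix (Fin n) (Fin n) ℝ} (hX : IsOrthonormalBasis h X)
    {b : ι → ℝ} (hb : IsConformalWeights h W b) (hψ : IsSection P ρ ψ) {x : M}
    {u : Fin n → TangentSpace (𝓡 n) x} (hu : u ∈ P.fiber x) :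
    curvatureEndo cov ρ X ψ x u = -∑ i, (b i : ℂ) •
      codifferential P (W i).toRepresentation (W i).toSubmodule.subtype
        (steinWeiss P ρ (W i) ψ) x u := by
  obtain ⟨U, s, hs, hx, rfl⟩ := exists_section_through P hu
  set w := fun y => nabla P ρ ψ y (s y) with hw
  have hwd : MDifferentiableAt (𝓡 n) 𝓘(ℝ, TSpace n ⊗[ℂ] V) w x :=
    ((contMDiffOn_nabla hcov hL hψ hs).contMDiffAt
      (hs.isOpen.mem_nhds hx)).mdifferentiableAt (by simp)
  have hY : ∀ μ, connectionForm cov s x (s x μ) ∈ lieAlg G := fun μ =>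
    P.connectionForm_mem U s hs x hx _
  have hproj : ∀ w', ∑ i, (b i : ℂ) • ((W i).toSubmodule.orthogonalProjectionOnto w' :
      TSpace n ⊗[ℂ] V) = conformalWeightOp h ρ w' := fun w' => by
    conv_rhs => rw [← hW.sum_orthogonalProjectionOnto w', map_sum]
    exact Finset.sum_congr rfl fun i _ => (hb i _ (SetLike.coe_mem _)).symm
  -- The projection onto a summand is parallel: it is a constant linear map in the frame, and the
  -- connection of the summand is the restriction of that of `T ⊗ V`.
  have h1 : ∀ i μ, (W i).toSubmodule.subtype
      (covDeriv P (W i).toRepresentation (steinWeiss P ρ (W i) ψ) x (s x) μ) =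
      (W i).toSubmodule.orthogonalProjectionOnto (mvfderiv (𝓡 n) w x (s x μ)) +
      tensorAct (connectionForm cov s x (s x μ)) (L (connectionForm cov s x (s x μ)))
        ((W i).toSubmodule.orthogonalProjectionOnto (w x)) := by
    intro i μ
    obtain ⟨L', hL', hj⟩ := exists_hasFDerivWithinAt_of_embedding
      (V' := (W i).toSubmodule) (ρ' := (W i).toRepresentation) hL (W i).toSubmodule.subtype
      (W i).toSubmodule.orthogonalProjectionOnto.toLinearMap
      (fun w => Submodule.orthogonalProjectionOnto_mem_subspace_eq_self w) (fun g w => rfl)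
    rw [covDeriv_eq hL' (isSection_steinWeiss hcov hL hρ (W i) hψ) hs hx, localDeriv]
    have h2 := hj _ (hY μ) (steinWeiss P ρ (W i) ψ x (s x))
    have h3 := mvfderiv_clm_comp
      ((W i).toSubmodule.orthogonalProjectionOnto.restrictScalars ℝ) hwd (s x μ)
    rw [map_add]
    exact congrArg₂ _ (congrArg Subtype.val h3) h2
  -- Weighted by the `b i`, the projections add up to `B`, which commutes with the connection
  -- matrices and so applies to the whole derivative of `∇ψ`.
  have h2 : ∀ μ, ∑ i, (b i : ℂ) • (W i).toSubmodule.subtype (covDeriv P (W i).toRepresentation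
      (steinWeiss P ρ (W i) ψ) x (s x) μ) =
      conformalWeightOp h ρ (mvfderiv (𝓡 n) w x (s x μ) +
        tensorAct (connectionForm cov s x (s x μ)) (L (connectionForm cov s x (s x μ))) (w x)) := by
    intro μ
    simp only [h1, smul_add, Finset.sum_add_distrib, map_add, hproj, ← map_smul, ← map_sum]
    rw [conformalWeightOp_tensorAct hG hc hh hX hL (hY μ)]
  have h3 : -∑ i, (b i : ℂ) • codifferential P (W i).toRepresentation (W i).toSubmodule.subtype
      (steinWeiss P ρ (W i) ψ) x (s x) =
      ∑ μ, ∑ ν, ∑ α, soInner (X α) (wedge μ ν) • L (X α) (secondDeriv cov L ψ s x μ ν) := by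
    simp only [codifferential, smul_neg, Finset.sum_neg_distrib, neg_neg, Finset.smul_sum]
    rw [Finset.sum_comm]
    refine Finset.sum_congr rfl fun μ _ => ?_
    simp only [← LinearMap.map_smul (contr μ), ← map_sum (contr μ)]
    rw [h2 μ, contr_conformalWeightOp]
    refine Finset.sum_congr rfl fun ν _ => ?_
    rw [contr_secondDeriv hcov hL hψ hs hx, differential_proj_wedge hh hX hL, sum_apply]
    rfl
  -- Needed to replace the differential of `ρ` by the linear map `L` on `R(X_α)`.
  have hcurv : ∀ α, curvatureOp cov x (s x) (X α) ∈ lieAlg G := fun α =>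
    (lieSubmodule hG).smul_mem _ ((lieSubmodule hG).sum_mem fun μ _ =>
      (lieSubmodule hG).sum_mem fun ν _ => (lieSubmodule hG).smul_mem _
        (frameCurvature_mem hG hcov hs hx μ ν))
  have hsm : ∀ (α) (r : ℝ) (v : V), L (X α) (r • v) = r • L (X α) v := fun α r v =>
    map_smul ((L (X α)).restrictScalars ℝ) r v
  rw [h3, curvatureEndo]
  simp only [differential_eq hL (hh.subset _ (hX.mem _)), differential_eq hL (hcurv _)]
  rw [Finset.sum_congr rfl fun μ _ => Finset.sum_comm, Finset.sum_comm]
  refine Finset.sum_congr rfl fun α _ => ?_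
  simp only [← hsm, ← map_sum]
  congr 1
  simp only [curvatureOp, map_smul, map_sum, sum_apply, smul_apply,
    ← secondDeriv_sub hcov hL hψ hs hx, smul_sub, Finset.sum_sub_distrib]
  -- Skewness of `t_μ ∧ t_ν` doubles the sum over the commutator, which the factor `1 / 2` in
  -- `curvatureOp` compensates.
  have h4 : ∑ μ, ∑ ν, soInner (X α) (wedge μ ν) • secondDeriv cov L ψ s x ν μ =
      -∑ μ, ∑ ν, soInner (X α) (wedge μ ν) • secondDeriv cov L ψ s x μ ν := by
    rw [Finset.sum_comm, ← Finset.sum_neg_distrib]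
    refine Finset.sum_congr rfl fun μ _ => ?_
    rw [← Finset.sum_neg_distrib]
    refine Finset.sum_congr rfl fun ν _ => ?_
    rw [wedge_swap, soInner_neg_right, neg_smul]
  rw [h4]
  module

end Pointwise

/-! ### The density of the Riemannian volume -/

section Density

/-- The volume of the parallelepiped spanned by `e`. -/
def gramVolume {n : ℕ} {F : Type*} [NormedAddCommGroup F] [InnerProductSpace ℝ F]
    (e : Fin n → F) : ℝ :=
  Real.sqrt (Matrix.det (Matrix.of fun i j => ⟪e i, e j⟫_ℝ))

theorem gramVolume_sum_smul {n : ℕ} {F : Type*} [NormedAddCommGroup F] [InnerProductSpace ℝ F]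
    (f : Fin n → F) (A : Matrix (Fin n) (Fin n) ℝ) :
    gramVolume (fun i => ∑ l, A l i • f l) = |A.det| * gramVolume f := by
  have h1 : (Matrix.of fun i j => ⟪∑ l, A l i • f l, ∑ l, A l j • f l⟫_ℝ) =
      A.transpose * (Matrix.of fun i j => ⟪f i, f j⟫_ℝ) * A := by
    ext i j
    simp only [Matrix.of_apply, Matrix.mul_apply, sum_inner, inner_sum, real_inner_smul_left,
      real_inner_smul_right, Matrix.transpose_apply, Finset.sum_mul]
    refine Finset.sum_congr rfl fun k _ => Finset.sum_congr rfl fun l _ => ?_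
    ring
  rw [gramVolume, h1, Matrix.det_mul, Matrix.det_mul, Matrix.det_transpose, mul_right_comm,
    ← sq, Real.sqrt_mul (sq_nonneg _), Real.sqrt_sq_eq_abs, gramVolume]

theorem gramVolume_orthonormal {n : ℕ} {F : Type*} [NormedAddCommGroup F] [InnerProductSpace ℝ F]
    {u : Fin n → F} (hu : Orthonormal ℝ u) : gramVolume u = 1 := by
  have h1 : (Matrix.of fun i j => ⟪u i, u j⟫_ℝ) = 1 := by
    ext i j
    simp [orthonormal_iff_ite.1 hu, Matrix.one_apply]
  rw [gramVolume, h1, Matrix.det_one, Real.sqrt_one]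

theorem sum_apply_smul_map_single {n : ℕ} {F : Type*} [AddCommGroup F] [Module ℝ F]
    [TopologicalSpace F] (T : EuclideanSpace ℝ (Fin n) →L[ℝ] F) (v : EuclideanSpace ℝ (Fin n)) :
    ∑ k, v k • T (EuclideanSpace.single k (1 : ℝ)) = T v := by
  have h1 : ∑ k, v k • EuclideanSpace.single k (1 : ℝ) = v := by
    ext i
    simp [Pi.single_apply]
  conv_rhs => rw [← h1, map_sum]
  simp only [map_smul]

variable {n : ℕ} {M : Type*} [TopologicalSpace M] [ChartedSpace (EuclideanSpace ℝ (Fin n)) M]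

/-- The matrix of the frame field `s` in the preferred chart at `x`. -/
def frameMatrix (x : M) (s : ∀ y : M, Fin n → TangentSpace (𝓡 n) y)
    (z : EuclideanSpace ℝ (Fin n)) : Matrix (Fin n) (Fin n) ℝ :=
  Matrix.of fun k ν => coordField x (fun y => s y ν) z k

/-- The change of coordinates between two preferred charts. -/
abbrev chartTransition (x y : M) : EuclideanSpace ℝ (Fin n) → EuclideanSpace ℝ (Fin n) :=
  extChartAt (𝓡 n) y ∘ (extChartAt (𝓡 n) x).symm

variable [IsManifold (𝓡 n) ∞ M] in
theorem differentiableAt_chartTransition {x y : M} {z : EuclideanSpace ℝ (Fin n)}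
    (hz : z ∈ (extChartAt (𝓡 n) x).target)
    (hy : (extChartAt (𝓡 n) x).symm z ∈ (extChartAt (𝓡 n) y).source) :
    DifferentiableAt ℝ (chartTransition (n := n) x y) z := by
  rw [extChartAt_source] at hy
  exact ((contMDiffAt_extChartAt' (n := ∞) hy).mdifferentiableAt (by simp)).comp z
    (mdifferentiableAt_extChartAt_symm_of_mem hz) |>.differentiableAt

variable [RiemannianBundle (fun x : M => TangentSpace (𝓡 n) x)]

theorem volumeDensity_eq_gramVolume (x : M) (z : EuclideanSpace ℝ (Fin n)) :
    volumeDensity x z = gramVolume fun k => mfderiv 𝓘(ℝ, EuclideanSpace ℝ (Fin n)) (𝓡 n)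
      (extChartAt (𝓡 n) x).symm z (EuclideanSpace.single k (1 : ℝ)) :=
  rfl

theorem volumeDensity_nonneg (x : M) (z : EuclideanSpace ℝ (Fin n)) : 0 ≤ volumeDensity x z :=
  Real.sqrt_nonneg _

variable [IsManifold (𝓡 n) ∞ M]

/-- An orthonormal frame spans unit volume, and its Gram determinant is that of the coordinate frame
times `(det A)²`. This expresses the density through the frame alone. -/
theorem abs_det_frameMatrix_mul_volumeDensity {x : M} {z : EuclideanSpace ℝ (Fin n)}
    (hz : z ∈ (extChartAt (𝓡 n) x).target) {s : ∀ y : M, Fin n → TangentSpace (𝓡 n) y}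
    (hs : Orthonormal ℝ (s ((extChartAt (𝓡 n) x).symm z))) :
    |(frameMatrix x s z).det| * volumeDensity x z = 1 := by
  rw [volumeDensity_eq_gramVolume, ← gramVolume_sum_smul]
  refine Eq.trans ?_ (gramVolume_orthonormal hs)
  congr 1
  funext ν
  rw [← mfderiv_coordField hz fun y => s y ν]
  exact sum_apply_smul_map_single (mfderiv 𝓘(ℝ, EuclideanSpace ℝ (Fin n)) (𝓡 n)
    (extChartAt (𝓡 n) x).symm z) (coordField x (fun y => s y ν) z)

theorem volumeDensity_chartTransition {x y : M} {z : EuclideanSpace ℝ (Fin n)}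
    (hz : z ∈ (extChartAt (𝓡 n) x).target)
    (hy : (extChartAt (𝓡 n) x).symm z ∈ (extChartAt (𝓡 n) y).source) :
    volumeDensity x z =
      |(fderiv ℝ (chartTransition (n := n) x y) z).det| * volumeDensity y (chartTransition (n := n) x y z) := by
  set T := chartTransition (n := n) x y with hT
  have hTz : (extChartAt (𝓡 n) y).symm (T z) = (extChartAt (𝓡 n) x).symm z :=
    (extChartAt (𝓡 n) y).left_inv hy
  have hTt : T z ∈ (extChartAt (𝓡 n) y).target := (extChartAt (𝓡 n) y).map_source hy
  have hdet : (fderiv ℝ T z).det = (Matrix.of fun l k =>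
      fderiv ℝ T z (EuclideanSpace.single k (1 : ℝ)) l).det := by
    have h1 := LinearMap.det_toMatrix (EuclideanSpace.basisFun (Fin n) ℝ).toBasis
      (fderiv ℝ T z : EuclideanSpace ℝ (Fin n) →ₗ[ℝ] EuclideanSpace ℝ (Fin n))
    refine h1.symm.trans (congrArg _ ?_)
    ext l k
    simp [LinearMap.toMatrix_apply]
  have hloc : (extChartAt (𝓡 n) x).symm =ᶠ[𝓝 z] (extChartAt (𝓡 n) y).symm ∘ T := by
    have h2 : ∀ᶠ z' in 𝓝 z, (extChartAt (𝓡 n) x).symm z' ∈ (extChartAt (𝓡 n) y).source :=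
      (mdifferentiableAt_extChartAt_symm_of_mem hz).continuousAt.preimage_mem_nhds
        ((isOpen_extChartAt_source y).mem_nhds hy)
    filter_upwards [h2] with z' hz'
    exact ((extChartAt (𝓡 n) y).left_inv hz').symm
  have hder : ∀ v, mfderiv 𝓘(ℝ, EuclideanSpace ℝ (Fin n)) (𝓡 n) (extChartAt (𝓡 n) x).symm z v =
      (mfderiv 𝓘(ℝ, EuclideanSpace ℝ (Fin n)) (𝓡 n) (extChartAt (𝓡 n) y).symm (T z)
        (fderiv ℝ T z v) : EuclideanSpace ℝ (Fin n)) := by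
    intro v
    have h3 := mfderiv_comp (I' := 𝓘(ℝ, EuclideanSpace ℝ (Fin n))) z
      (mdifferentiableAt_extChartAt_symm_of_mem hTt)
      (differentiableAt_chartTransition hz hy).mdifferentiableAt
    have h4 := hloc.mfderiv_eq (I := 𝓘(ℝ, EuclideanSpace ℝ (Fin n))) (I' := 𝓡 n)
    rw [← mfderiv_eq_fderiv]
    exact (congrArg (fun l : EuclideanSpace ℝ (Fin n) →L[ℝ] EuclideanSpace ℝ (Fin n) => l v)
      (h4.trans h3))
  -- The two base points are equal but not definitionally, and the inner product depends on the base
  -- point.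
  have hcast : ∀ (p q : M) (_ : p = q) (e : Fin n → EuclideanSpace ℝ (Fin n)),
      gramVolume (F := TangentSpace (𝓡 n) p) e = gramVolume (F := TangentSpace (𝓡 n) q) e := by
    rintro p q rfl e
    rfl
  rw [volumeDensity_eq_gramVolume, volumeDensity_eq_gramVolume, hdet, ← gramVolume_sum_smul]
  refine Eq.trans ?_ (hcast _ _ hTz _).symm
  congr 1
  funext k
  refine (hder _).trans ?_
  exact (sum_apply_smul_map_single (mfderiv 𝓘(ℝ, EuclideanSpace ℝ (Fin n)) (𝓡 n)
    (extChartAt (𝓡 n) y).symm (T z)) (fderiv ℝ T z (EuclideanSpace.single k 1))).symm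

end Density

/-! ### The Riemannian volume in a chart -/

section Volume

variable {n : ℕ} {M : Type*} [TopologicalSpace M] [ChartedSpace (EuclideanSpace ℝ (Fin n)) M]
  [MeasurableSpace M] [BorelSpace M]

theorem aemeasurable_extChartAt_symm (x : M) (ν : Measure (EuclideanSpace ℝ (Fin n)))
    (hν : ν ≪ volume.restrict (extChartAt (𝓡 n) x).target) :
    AEMeasurable (extChartAt (𝓡 n) x).symm ν :=
  ((continuousOn_extChartAt_symm x).aemeasurable
    (isOpen_extChartAt_target x).measurableSet).mono_ac hν

theorem measurableSet_target_inter_preimage (x : M) {A : Set M} (hA : MeasurableSet A) :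
    MeasurableSet ((extChartAt (𝓡 n) x).target ∩ (extChartAt (𝓡 n) x).symm ⁻¹' A) := by
  have h1 : Measurable ((extChartAt (𝓡 n) x).target.domRestrict (extChartAt (𝓡 n) x).symm) :=
    (continuousOn_iff_continuous_domRestrict.1 (continuousOn_extChartAt_symm x)).measurable
  have h2 := (MeasurableEmbedding.subtype_coe
    (isOpen_extChartAt_target (I := 𝓡 n) x).measurableSet).measurableSet_image.2 (h1 hA)
  convert h2 using 1
  ext z
  exact ⟨fun h => ⟨⟨z, h.1⟩, h.2, rfl⟩, fun ⟨w, hw, he⟩ => he ▸ ⟨w.2, hw⟩⟩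

theorem measurableSet_source_chart (x : M) : MeasurableSet (extChartAt (𝓡 n) x).source :=
  (isOpen_extChartAt_source x).measurableSet

variable [RiemannianBundle (fun x : M => TangentSpace (𝓡 n) x)]

/-- The Riemannian volume of the domain of the preferred chart at `x`. -/
def chartMeasure (n : ℕ) {M : Type*} [TopologicalSpace M]
    [ChartedSpace (EuclideanSpace ℝ (Fin n)) M]
    [RiemannianBundle (fun x : M => TangentSpace (𝓡 n) x)] [MeasurableSpace M] (x : M) :
    Measure M :=
  ((volume.restrict (extChartAt (𝓡 n) x).target).withDensity
    fun y => ENNReal.ofReal (volumeDensity x y)).map (extChartAt (𝓡 n) x).symm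

theorem chartMeasure_apply (x : M) {A : Set M} (hA : MeasurableSet A) :
    chartMeasure n x A = ∫⁻ z in (extChartAt (𝓡 n) x).target ∩ (extChartAt (𝓡 n) x).symm ⁻¹' A,
      ENNReal.ofReal (volumeDensity x z) := by
  rw [chartMeasure, Measure.map_apply_of_aemeasurable
    (aemeasurable_extChartAt_symm x _ (withDensity_absolutelyContinuous _ _)) hA,
    withDensity_apply', Measure.restrict_restrict' (isOpen_extChartAt_target x).measurableSet,
    Set.inter_comm]

theorem chartMeasure_inter_source (x : M) {A : Set M} (hA : MeasurableSet A) :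
    chartMeasure n x (A ∩ (extChartAt (𝓡 n) x).source) = chartMeasure n x A := by
  rw [chartMeasure_apply x hA, chartMeasure_apply x (hA.inter (measurableSet_source_chart x))]
  congr 2
  ext z
  simp only [Set.mem_inter_iff, Set.mem_preimage]
  exact ⟨fun h => ⟨h.1, h.2.1⟩, fun h => ⟨h.1, h.2, (extChartAt (𝓡 n) x).map_target h.1⟩⟩

variable [IsManifold (𝓡 n) ∞ M]

/-- The change of variables formula; the Jacobian is absorbed by the transformation law of the
density. -/
theorem chartMeasure_eq_of_subset (x y : M) {A : Set M} (hA : MeasurableSet A)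
    (hx : A ⊆ (extChartAt (𝓡 n) x).source) (hy : A ⊆ (extChartAt (𝓡 n) y).source) :
    chartMeasure n x A = chartMeasure n y A := by
  rw [chartMeasure_apply x hA, chartMeasure_apply y hA]
  set S := (extChartAt (𝓡 n) x).target ∩ (extChartAt (𝓡 n) x).symm ⁻¹' A with hS
  have h1 : (extChartAt (𝓡 n) y).target ∩ (extChartAt (𝓡 n) y).symm ⁻¹' A =
      chartTransition x y '' S := by
    ext z
    constructor
    · rintro ⟨hz, hzA⟩
      refine ⟨extChartAt (𝓡 n) x ((extChartAt (𝓡 n) y).symm z),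
        ⟨(extChartAt (𝓡 n) x).map_source (hx hzA), ?_⟩, ?_⟩
      · rw [Set.mem_preimage, (extChartAt (𝓡 n) x).left_inv (hx hzA)]
        exact hzA
      · rw [chartTransition, Function.comp_apply, (extChartAt (𝓡 n) x).left_inv (hx hzA),
          (extChartAt (𝓡 n) y).right_inv hz]
    · rintro ⟨z, ⟨hz, hzA⟩, rfl⟩
      refine ⟨(extChartAt (𝓡 n) y).map_source (hy hzA), ?_⟩
      rw [Set.mem_preimage, chartTransition, Function.comp_apply, (extChartAt (𝓡 n) y).left_inv (hy hzA)]
      exact hzA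
  have hinj : Set.InjOn (chartTransition (n := n) x y) S := by
    rintro z ⟨hz, hzA⟩ z' ⟨hz', hzA'⟩ h
    exact (extChartAt (𝓡 n) x).symm.injOn hz hz'
      ((extChartAt (𝓡 n) y).injOn (hy hzA) (hy hzA') h)
  have hSm : MeasurableSet S := measurableSet_target_inter_preimage x hA
  rw [h1, lintegral_image_eq_lintegral_abs_det_fderiv_mul volume hSm
    (fun z hz => (differentiableAt_chartTransition hz.1 (hy hz.2)).hasFDerivAt.hasFDerivWithinAt)
    hinj]
  refine setLIntegral_congr_fun hSm fun z hz => ?_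
  rw [volumeDensity_chartTransition hz.1 (hy hz.2), ENNReal.ofReal_mul (abs_nonneg _)]

/-- A supremum of measures is not computed set by set. The measure `ν`, glued from chart measures on
a countable disjoint family of pieces, dominates every chart measure and hence the supremum. On the
chart at `x` it is the chart measure itself. -/
theorem riemannianVolume_restrict_source [SecondCountableTopology M] (x : M) :
    (riemannianVolume n M).restrict (extChartAt (𝓡 n) x).source = chartMeasure n x := by
  obtain ⟨t, htc, ht⟩ := TopologicalSpace.isOpen_iUnion_countable
    (fun y : M => (extChartAt (𝓡 n) y).source) fun y => isOpen_extChartAt_source y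
  have htne : (insert x t).Nonempty := ⟨x, Set.mem_insert _ _⟩
  obtain ⟨c, hc⟩ := (htc.insert x).exists_eq_range htne
  -- The point `x` is put first so that the piece `D 0` is its entire chart domain.
  let e : ℕ → M := fun k => Nat.casesOn k x c
  let D : ℕ → Set M := disjointed fun k => (extChartAt (𝓡 n) (e k)).source
  have hDm : ∀ k, MeasurableSet (D k) :=
    MeasurableSet.disjointed fun k => measurableSet_source_chart _
  have hDd : Pairwise (Function.onFun Disjoint D) := disjoint_disjointed _
  have hDs : ∀ k, D k ⊆ (extChartAt (𝓡 n) (e k)).source := fun k => disjointed_subset _ k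
  have hD0 : D 0 = (extChartAt (𝓡 n) x).source := disjointed_zero _
  have hDu : ⋃ k, D k = Set.univ := by
    rw [iUnion_disjointed, Set.eq_univ_iff_forall]
    intro y
    have h1 : y ∈ ⋃ i ∈ t, (extChartAt (𝓡 n) i).source := by
      rw [ht]
      exact Set.mem_iUnion.2 ⟨y, mem_extChartAt_source y⟩
    obtain ⟨i, hi, hy⟩ := Set.mem_iUnion₂.1 h1
    have h2 : i ∈ Set.range c := hc ▸ Set.mem_insert_of_mem _ hi
    obtain ⟨k, rfl⟩ := h2
    exact Set.mem_iUnion.2 ⟨k + 1, hy⟩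
  let ν : Measure M := Measure.sum fun k => (chartMeasure n (e k)).restrict (D k)
  have hle : riemannianVolume n M ≤ ν := by
    refine iSup_le fun y => Measure.le_iff.2 fun A hA => ?_
    have h1 : chartMeasure n y A = ∑' k, chartMeasure n y (A ∩ D k) := by
      rw [← measure_iUnion (fun i j hij => (hDd hij).mono Set.inter_subset_right
        Set.inter_subset_right) fun k => hA.inter (hDm k), ← Set.inter_iUnion, hDu, Set.inter_univ]
    refine h1.le.trans ?_
    rw [Measure.sum_apply _ hA]
    refine ENNReal.tsum_le_tsum fun k => ?_
    rw [Measure.restrict_apply hA, ← chartMeasure_inter_source y (hA.inter (hDm k)),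
      chartMeasure_eq_of_subset y (e k)
        ((hA.inter (hDm k)).inter (measurableSet_source_chart y)) Set.inter_subset_right
        fun z hz => hDs k hz.1.2]
    exact measure_mono Set.inter_subset_left
  have hge : chartMeasure n x ≤ riemannianVolume n M :=
    le_iSup (fun y => chartMeasure n y) x
  refine Measure.ext fun A hA => ?_
  rw [Measure.restrict_apply hA, ← chartMeasure_inter_source x hA]
  refine le_antisymm ((hle _).trans ?_) (hge _)
  rw [Measure.sum_apply _ (hA.inter (measurableSet_source_chart x)), tsum_eq_single 0]
  · rw [Measure.restrict_apply (hA.inter (measurableSet_source_chart x))]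
    exact measure_mono Set.inter_subset_left
  · intro k hk
    rw [Measure.restrict_apply (hA.inter (measurableSet_source_chart x))]
    have h2 : A ∩ (extChartAt (𝓡 n) x).source ∩ D k = ∅ := by
      rw [← hD0, Set.inter_assoc, Set.disjoint_iff_inter_eq_empty.1 (hDd hk.symm),
        Set.inter_empty]
    rw [h2, measure_empty]

end Volume

/-! ### The divergence of a frame field in coordinates -/

section Euclidean

variable {n : ℕ}

attribute [local instance] Matrix.normedAddCommGroup Matrix.normedSpace in
theorem differentiable_det :
    Differentiable ℝ (fun A : Matrix (Fin n) (Fin n) ℝ => A.det) := by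
  simp only [Matrix.det_apply]
  have h1 : ∀ i j, ContDiff ℝ 1 fun A : Matrix (Fin n) (Fin n) ℝ => A i j := fun i j =>
    ((ContinuousLinearMap.proj (R := ℝ) (φ := fun _ : Fin n => ℝ) j).comp
      (ContinuousLinearMap.proj (R := ℝ) (φ := fun _ : Fin n => Fin n → ℝ) i)).contDiff
  refine Differentiable.fun_sum fun σ _ => ?_
  exact ((contDiff_prod fun i _ => h1 _ _).differentiable one_ne_zero).const_smul _

-- Jacobi's formula: factor out `det A` and use `det(1 + tB) = 1 + t tr B + O(t²)`.
attribute [local instance] Matrix.normedAddCommGroup Matrix.normedSpace in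
theorem fderiv_det_apply {A : Matrix (Fin n) (Fin n) ℝ} (hA : A.det ≠ 0)
    (H : Matrix (Fin n) (Fin n) ℝ) :
    fderiv ℝ (fun A : Matrix (Fin n) (Fin n) ℝ => A.det) A H = A.det * (A⁻¹ * H).trace := by
  have h1 : HasDerivAt (fun t : ℝ => A + t • H) H 0 :=
    (((hasDerivAt_id (0 : ℝ)).smul_const H).const_add A).congr_deriv (one_smul _ _)
  have h2 : HasFDerivAt (fun A : Matrix (Fin n) (Fin n) ℝ => A.det)
      (fderiv ℝ (fun A : Matrix (Fin n) (Fin n) ℝ => A.det) A) (A + (0 : ℝ) • H) := by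
    rw [zero_smul, add_zero]
    exact (differentiable_det A).hasFDerivAt
  have h3 := h2.comp_hasDerivAt (0 : ℝ) h1
  have h4 : ∀ t : ℝ, (A + t • H).det = A.det * (1 + t • (A⁻¹ * H)).det := by
    intro t
    rw [← Matrix.det_mul, Matrix.mul_add, Matrix.mul_one, Matrix.mul_smul, ← Matrix.mul_assoc,
      Matrix.mul_nonsing_inv _ (isUnit_iff_ne_zero.2 hA), Matrix.one_mul]
  have h5 : HasDerivAt (fun t : ℝ => A.det * (1 + t • (A⁻¹ * H)).det)
      (A.det * (A⁻¹ * H).trace) 0 := by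
    refine HasDerivAt.const_mul _ ?_
    rw [funext fun t : ℝ => Matrix.det_one_add_smul t (A⁻¹ * H)]
    set p := (Polynomial.divX (Polynomial.divX (1 + (Polynomial.X : Polynomial ℝ) •
      (A⁻¹ * H).map Polynomial.C).det)) with hp
    have h6 := (((hasDerivAt_id (0 : ℝ)).const_mul (A⁻¹ * H).trace).const_add 1).add
      ((p.hasDerivAt 0).mul ((hasDerivAt_id (0 : ℝ)).pow 2))
    refine h6.congr_deriv ?_
    simp
  refine h3.unique (h5.congr_of_eventuallyEq (Eventually.of_forall fun t => ?_))
  exact h4 t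

attribute [local instance] Matrix.normedAddCommGroup Matrix.normedSpace in
theorem hasFDerivAt_abs_det_inv {E' : Type*} [NormedAddCommGroup E'] [NormedSpace ℝ E']
    {A : E' → Matrix (Fin n) (Fin n) ℝ} {z : E'}
    (hA : ∀ i j, DifferentiableAt ℝ (fun y => A y i j) z) (hdet : (A z).det ≠ 0) :
    ∃ D : E' →L[ℝ] ℝ, HasFDerivAt (fun y => |(A y).det|⁻¹) D z ∧ ∀ v, D v =
      -(|(A z).det|⁻¹ * ((A z)⁻¹ * Matrix.of fun i j => fderiv ℝ (fun y => A y i j) z v).trace) := by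
  have h1 : HasFDerivAt A (ContinuousLinearMap.pi fun i => ContinuousLinearMap.pi fun j =>
      fderiv ℝ (fun y => A y i j) z) z :=
    hasFDerivAt_pi.2 fun i => hasFDerivAt_pi.2 fun j => (hA i j).hasFDerivAt
  have h2 := ((differentiable_det (A z)).hasFDerivAt).comp z h1
  have h3 := (hasDerivAt_inv (abs_ne_zero.2 hdet)).comp_hasFDerivAt z
    ((hasDerivAt_abs hdet).comp_hasFDerivAt z h2)
  refine ⟨_, h3, fun v => ?_⟩
  have h4 := fderiv_det_apply hdet (Matrix.of fun i j => fderiv ℝ (fun y => A y i j) z v)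
  simp only [smul_apply, smul_eq_mul]
  refine (congrArg (fun r => -(|(A z).det| ^ 2)⁻¹ * (((SignType.sign (A z).det : SignType) : ℝ) * r))
    h4).trans ?_
  have h5 : ((SignType.sign (A z).det : SignType) : ℝ) * (A z).det = |(A z).det| :=
    sign_mul_self _
  rw [← mul_assoc ((SignType.sign (A z).det : SignType) : ℝ), h5]
  have h6 := abs_ne_zero.2 hdet
  field_simp

/-- Integration by parts against the constant function `1`. -/
theorem integral_fderiv_apply_eq_zero {F : Type*} [NormedAddCommGroup F] [NormedSpace ℝ F]
    {g : EuclideanSpace ℝ (Fin n) → F} (hg : ContDiff ℝ 1 g) (hc : HasCompactSupport g)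
    (v : EuclideanSpace ℝ (Fin n)) :
    Integrable (fun z => fderiv ℝ g z v) ∧ ∫ z, fderiv ℝ g z v = 0 := by
  have h1 : Continuous fun z => fderiv ℝ g z v := (hg.continuous_fderiv (by simp)).clm_apply
    continuous_const
  have h2 : Integrable (fun z => fderiv ℝ g z v) :=
    h1.integrable_of_hasCompactSupport (hc.fderiv_apply ℝ v)
  refine ⟨h2, ?_⟩
  have h3 := integral_smul_fderiv_eq_neg_fderiv_smul_of_integrable (𝕜 := ℝ)
    (μ := (volume : Measure (EuclideanSpace ℝ (Fin n)))) (f := fun _ => (1 : ℝ)) (g := g) (v := v)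
    (by simp) (by simpa using h2)
    (by simpa using hg.continuous.integrable_of_hasCompactSupport hc)
    (fun x _ => differentiableAt_const _) (fun x _ => hg.differentiable (by simp) x)
  simpa using h3

/-- The divergence of a frame field with respect to the density that gives its parallelepipeds
volume one is a trace of its structure functions. -/
theorem sum_fderiv_density {A : Matrix (Fin n) (Fin n) ℝ} (hdet : A.det ≠ 0)
    (D : Fin n → Matrix (Fin n) (Fin n) ℝ) (B : Fin n → Fin n → Fin n → ℝ)
    (hB : ∀ μ ν l, ∑ k, (A k μ * D k l ν - A k ν * D k l μ) = ∑ κ, B μ ν κ * A l κ) (μ : Fin n) :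
    ∑ k, (-(A⁻¹ * D k).trace * A k μ + D k k μ) = -∑ ν, B μ ν ν := by
  have hinv : ∀ ν κ, ∑ l, A⁻¹ ν l * A l κ = if ν = κ then 1 else 0 := fun ν κ => by
    simpa [Matrix.mul_apply, Matrix.one_apply] using
      congrFun (congrFun (Matrix.nonsing_inv_mul A (isUnit_iff_ne_zero.2 hdet)) ν) κ
  have hinv' : ∀ k l, ∑ ν, A k ν * A⁻¹ ν l = if k = l then 1 else 0 := fun k l => by
    simpa [Matrix.mul_apply, Matrix.one_apply] using
      congrFun (congrFun (Matrix.mul_nonsing_inv A (isUnit_iff_ne_zero.2 hdet)) k) l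
  -- The bracket relation is contracted with `A⁻¹`, a trace over `ν`. One half of the left side is
  -- the logarithmic derivative of the density, the other the Euclidean divergence of the `μ`-th
  -- column.
  have h1 : ∑ ν, ∑ l, A⁻¹ ν l * ∑ k, (A k μ * D k l ν - A k ν * D k l μ) = ∑ ν, B μ ν ν := by
    refine Finset.sum_congr rfl fun ν _ => ?_
    simp only [hB, Finset.mul_sum]
    rw [Finset.sum_comm]
    have : ∀ κ, ∑ l, A⁻¹ ν l * (B μ ν κ * A l κ) = B μ ν κ * ∑ l, A⁻¹ ν l * A l κ := fun κ => by
      rw [Finset.mul_sum]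
      exact Finset.sum_congr rfl fun l _ => by ring
    simp [this, hinv]
  have h2 : ∑ ν, ∑ l, A⁻¹ ν l * ∑ k, A k μ * D k l ν = ∑ k, (A⁻¹ * D k).trace * A k μ := by
    simp only [Matrix.trace, Matrix.diag, Matrix.mul_apply, Finset.mul_sum, Finset.sum_mul]
    rw [Finset.sum_congr rfl fun ν _ => Finset.sum_comm, Finset.sum_comm]
    refine Finset.sum_congr rfl fun k _ => Finset.sum_congr rfl fun ν _ =>
      Finset.sum_congr rfl fun l _ => by ring
  have h3 : ∑ ν, ∑ l, A⁻¹ ν l * ∑ k, A k ν * D k l μ = ∑ k, D k k μ := by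
    have h4 : ∀ k l, ∑ ν, A⁻¹ ν l * (A k ν * D k l μ) = if k = l then D k l μ else 0 := by
      intro k l
      have : ∑ ν, A⁻¹ ν l * (A k ν * D k l μ) = (∑ ν, A k ν * A⁻¹ ν l) * D k l μ := by
        rw [Finset.sum_mul]
        exact Finset.sum_congr rfl fun ν _ => by ring
      rw [this, hinv']
      simp
    simp only [Finset.mul_sum]
    rw [Finset.sum_comm, Finset.sum_congr rfl fun l _ => Finset.sum_comm, Finset.sum_comm]
    simp [h4]
  simp only [Finset.sum_sub_distrib, mul_sub, h2, h3] at h1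
  rw [Finset.sum_add_distrib, ← h1]
  simp only [neg_mul, Finset.sum_neg_distrib]
  ring

end Euclidean

/-! ### Orthonormal frames and the volume density in a chart -/

section Frame

variable {n : ℕ} {M : Type*} [TopologicalSpace M] [ChartedSpace (EuclideanSpace ℝ (Fin n)) M]
  [IsManifold (𝓡 n) ∞ M] {P : ∀ x : M, Set (Fin n → TangentSpace (𝓡 n) x)} {U : Set M}
  {s : ∀ y : M, Fin n → TangentSpace (𝓡 n) y}

theorem IsLocalSection.contDiffAt_frameMatrix (hs : IsLocalSection P U s) {x : M}
    {z : EuclideanSpace ℝ (Fin n)} (hz : z ∈ (extChartAt (𝓡 n) x).target)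
    (hzU : (extChartAt (𝓡 n) x).symm z ∈ U) (i j : Fin n) :
    ContDiffAt ℝ ∞ (fun y => frameMatrix x s y i j) z :=
  ((EuclideanSpace.proj i : EuclideanSpace ℝ (Fin n) →L[ℝ] ℝ).contDiff.contDiffAt).comp z
    (contDiffAt_coordField hs.isOpen (hs.contMDiffOn j) hz hzU)

theorem IsLocalSection.contDiffAt_det_frameMatrix (hs : IsLocalSection P U s) {x : M}
    {z : EuclideanSpace ℝ (Fin n)} (hz : z ∈ (extChartAt (𝓡 n) x).target)
    (hzU : (extChartAt (𝓡 n) x).symm z ∈ U) :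
    ContDiffAt ℝ ∞ (fun y => (frameMatrix x s y).det) z := by
  simp only [Matrix.det_apply]
  exact ContDiffAt.sum fun σ _ => (contDiffAt_prod fun i _ =>
    hs.contDiffAt_frameMatrix hz hzU _ _).const_smul _

variable [RiemannianBundle (fun x : M => TangentSpace (𝓡 n) x)]

theorem det_frameMatrix_ne_zero {x : M} {z : EuclideanSpace ℝ (Fin n)}
    (hz : z ∈ (extChartAt (𝓡 n) x).target)
    (hs : Orthonormal ℝ (s ((extChartAt (𝓡 n) x).symm z))) : (frameMatrix x s z).det ≠ 0 := by
  intro h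
  have := abs_det_frameMatrix_mul_volumeDensity hz hs
  rw [h, abs_zero, zero_mul] at this
  exact zero_ne_one this

theorem volumeDensity_eq_inv {x : M} {z : EuclideanSpace ℝ (Fin n)}
    (hz : z ∈ (extChartAt (𝓡 n) x).target)
    (hs : Orthonormal ℝ (s ((extChartAt (𝓡 n) x).symm z))) :
    volumeDensity x z = |(frameMatrix x s z).det|⁻¹ :=
  eq_inv_of_mul_eq_one_right (abs_det_frameMatrix_mul_volumeDensity hz hs)

end Frame

/-! ### Integration in a chart -/

section Integration

variable {n : ℕ} {M : Type*} [TopologicalSpace M] [ChartedSpace (EuclideanSpace ℝ (Fin n)) M]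

theorem coordField_sum_smul {x : M} {z : EuclideanSpace ℝ (Fin n)}
    {X : ∀ y : M, TangentSpace (𝓡 n) y} {ι : Type*} (t : Finset ι) (c : ι → ℝ)
    (Y : ι → ∀ y : M, TangentSpace (𝓡 n) y)
    (h : X ((extChartAt (𝓡 n) x).symm z) = ∑ k ∈ t, c k • Y k ((extChartAt (𝓡 n) x).symm z)) :
    coordField x X z = ∑ k ∈ t, c k • coordField x (Y k) z := by
  simp only [coordField, VectorField.mpullback_apply, h, map_sum, map_smul]
  rfl

variable [IsManifold (𝓡 n) ∞ M]

theorem eventually_mem_target_and_mem {U : Set M} (hU : IsOpen U) {x : M}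
    {z : EuclideanSpace ℝ (Fin n)} (hz : z ∈ (extChartAt (𝓡 n) x).target)
    (hzU : (extChartAt (𝓡 n) x).symm z ∈ U) :
    ∀ᶠ y in 𝓝 z, y ∈ (extChartAt (𝓡 n) x).target ∧ (extChartAt (𝓡 n) x).symm y ∈ U :=
  Filter.Eventually.and ((isOpen_extChartAt_target x).mem_nhds hz)
    ((mdifferentiableAt_extChartAt_symm_of_mem hz).continuousAt.preimage_mem_nhds
      (hU.mem_nhds hzU))

variable [RiemannianBundle (fun x : M => TangentSpace (𝓡 n) x)]
  {cov : CovariantDerivative (𝓡 n) (EuclideanSpace ℝ (Fin n))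
    (TangentSpace (𝓡 n) : M → Type _)}
  {G : Subgroup (Matrix.specialOrthogonalGroup (Fin n) ℝ)}

theorem volumeDensity_pos (P : ParallelReduction cov G) {x : M} {z : EuclideanSpace ℝ (Fin n)}
    (hz : z ∈ (extChartAt (𝓡 n) x).target) : 0 < volumeDensity x z := by
  obtain ⟨U, s, hs, hU⟩ := P.exists_section ((extChartAt (𝓡 n) x).symm z)
  have h1 := P.orthonormal _ _ (hs.mem _ hU)
  rw [volumeDensity_eq_inv hz h1]
  exact inv_pos.2 (abs_pos.2 (det_frameMatrix_ne_zero hz h1))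

theorem continuousOn_volumeDensity (P : ParallelReduction cov G) (x : M) :
    ContinuousOn (volumeDensity x) (extChartAt (𝓡 n) x).target := by
  intro z hz
  obtain ⟨U, s, hs, hU⟩ := P.exists_section ((extChartAt (𝓡 n) x).symm z)
  have h1 : ContinuousAt (fun y => |(frameMatrix x s y).det|⁻¹) z :=
    (hs.contDiffAt_det_frameMatrix hz hU).continuousAt.abs.inv₀
      (abs_ne_zero.2 (det_frameMatrix_ne_zero hz (P.orthonormal _ _ (hs.mem _ hU))))
  refine (h1.congr ?_).continuousWithinAt
  filter_upwards [eventually_mem_target_and_mem hs.isOpen hz hU] with y hy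
  exact (volumeDensity_eq_inv hy.1 (P.orthonormal _ _ (hs.mem _ hy.2))).symm

theorem aemeasurable_ofReal_volumeDensity (P : ParallelReduction cov G) (x : M) :
    AEMeasurable (fun y => ENNReal.ofReal (volumeDensity x y))
      (volume.restrict (extChartAt (𝓡 n) x).target) :=
  ((continuousOn_volumeDensity P x).aemeasurable
    (isOpen_extChartAt_target x).measurableSet).ennreal_ofReal

variable [SecondCountableTopology M] [MeasurableSpace M] [BorelSpace M]

/-- The integral over `M` of a function supported in the domain of a chart. -/
theorem integral_eq_integral_chart (P : ParallelReduction cov G) {F : Type*}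
    [NormedAddCommGroup F] [NormedSpace ℝ F] {f : M → F} (hf : Continuous f) (x : M)
    (hx : ∀ y ∉ (extChartAt (𝓡 n) x).source, f y = 0)
    (hi : IntegrableOn (fun z => volumeDensity x z • f ((extChartAt (𝓡 n) x).symm z))
      (extChartAt (𝓡 n) x).target) :
    Integrable f (riemannianVolume n M) ∧ ∫ y, f y ∂(riemannianVolume n M) =
      ∫ z in (extChartAt (𝓡 n) x).target,
        volumeDensity x z • f ((extChartAt (𝓡 n) x).symm z) := by
  borelize F
  have hm := aemeasurable_extChartAt_symm (n := n) x
    ((volume.restrict (extChartAt (𝓡 n) x).target).withDensity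
      fun y => ENNReal.ofReal (volumeDensity x y)) (withDensity_absolutelyContinuous _ _)
  have hfm : AEStronglyMeasurable f (chartMeasure n x) := hf.aestronglyMeasurable
  have hreal : ∀ z : EuclideanSpace ℝ (Fin n), (ENNReal.ofReal (volumeDensity x z)).toReal = volumeDensity x z := fun z =>
    ENNReal.toReal_ofReal (volumeDensity_nonneg x z)
  constructor
  · rw [← integrableOn_iff_integrable_of_support_subset (s := (extChartAt (𝓡 n) x).source)
      (fun y hy => by_contra fun h => hy (hx y h)), IntegrableOn,
      riemannianVolume_restrict_source]
    refine (integrable_map_measure hfm hm).2 ?_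
    rw [integrable_withDensity_iff_integrable_smul₀' (aemeasurable_ofReal_volumeDensity P x)
      (Eventually.of_forall fun _ => ENNReal.ofReal_lt_top)]
    simp only [hreal]
    exact hi
  · rw [← setIntegral_eq_integral_of_forall_compl_eq_zero hx, riemannianVolume_restrict_source]
    refine (integral_map hm hfm).trans ?_
    rw [integral_withDensity_eq_integral_toReal_smul₀ (aemeasurable_ofReal_volumeDensity P x)
      (Eventually.of_forall fun _ => ENNReal.ofReal_lt_top)]
    simp only [hreal]

/-- The density is positive on chart targets. This is what makes formal adjoints unique. -/
theorem isOpenPosMeasure_riemannianVolume (P : ParallelReduction cov G) :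
    (riemannianVolume n M).IsOpenPosMeasure where
  open_pos O hO hne h0 := by
    obtain ⟨x, hx⟩ := hne
    have h1 : chartMeasure n x O = 0 := by
      rw [← riemannianVolume_restrict_source x]
      exact le_antisymm ((Measure.restrict_apply_le _ _).trans h0.le) zero_le
    rw [chartMeasure_apply x hO.measurableSet] at h1
    set S := (extChartAt (𝓡 n) x).target ∩ (extChartAt (𝓡 n) x).symm ⁻¹' O
    have hS : IsOpen S := (continuousOn_extChartAt_symm x).isOpen_inter_preimage
      (isOpen_extChartAt_target x) hO
    have hSne : S.Nonempty := ⟨extChartAt (𝓡 n) x x, mem_extChartAt_target x, by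
      rw [Set.mem_preimage, extChartAt_to_inv]; exact hx⟩
    have h2 : AEMeasurable (fun y => ENNReal.ofReal (volumeDensity x y)) (volume.restrict S) :=
      (aemeasurable_ofReal_volumeDensity P x).mono_measure
        (Measure.restrict_mono Set.inter_subset_left le_rfl)
    rw [lintegral_eq_zero_iff' h2] at h1
    have h3 := (ae_restrict_iff' hS.measurableSet).1 h1
    have h4 : volume S = 0 := by
      refine measure_mono_null (fun z hz => ?_) h3
      simp only [Set.mem_compl_iff, Set.mem_ofPred_eq]
      intro h
      have := h hz
      rw [Pi.zero_apply, ENNReal.ofReal_eq_zero] at this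
      exact absurd (volumeDensity_pos P hz.1) (not_lt.2 this)
    exact (hS.measure_pos volume hSne).ne' h4

/-- A compact neighbourhood in the chart target carries a bounded density. Continuous functions with
compact support are thus integrable. -/
theorem isLocallyFiniteMeasure_riemannianVolume (P : ParallelReduction cov G) :
    IsLocallyFiniteMeasure (riemannianVolume n M) where
  finiteAtNhds x := by
    obtain ⟨N, hN, hNt, hNc⟩ := local_compact_nhds
      ((isOpen_extChartAt_target (I := 𝓡 n) x).mem_nhds (mem_extChartAt_target x))
    set A := (extChartAt (𝓡 n) x).source ∩ extChartAt (𝓡 n) x ⁻¹' interior N with hA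
    have hAo : IsOpen A := (continuousOn_extChartAt x).isOpen_inter_preimage
      (isOpen_extChartAt_source x) isOpen_interior
    refine ⟨A, hAo.mem_nhds ⟨mem_extChartAt_source x, mem_interior_iff_mem_nhds.2 hN⟩, ?_⟩
    have h1 : riemannianVolume n M A = chartMeasure n x A := by
      rw [← riemannianVolume_restrict_source x, Measure.restrict_apply hAo.measurableSet,
        Set.inter_eq_left.2 Set.inter_subset_left]
    rw [h1, chartMeasure_apply x hAo.measurableSet]
    refine (lintegral_mono_set (t := N) ?_).trans_lt
      (((continuousOn_volumeDensity P x).mono hNt).integrableOn_compact hNc).lintegral_lt_top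
    rintro z ⟨hz, -, hzN⟩
    rw [Set.mem_preimage, (extChartAt (𝓡 n) x).right_inv hz] at hzN
    exact interior_subset hzN

/-- The divergence of the vector field `∑_μ f_μ s_μ`. -/
def frameDivergence (cov : CovariantDerivative (𝓡 n) (EuclideanSpace ℝ (Fin n))
    (TangentSpace (𝓡 n) : M → Type _)) (s : ∀ y : M, Fin n → TangentSpace (𝓡 n) y)
    {F : Type*} [NormedAddCommGroup F] [NormedSpace ℝ F] (f : Fin n → M → F) (y : M) : F :=
  ∑ μ, (mvfderiv (𝓡 n) (f μ) y (s y μ) +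
    (∑ ν, connectionForm cov s y (s y ν) ν μ) • f μ y)

end Integration

/-! ### The divergence theorem in a chart -/

section Divergence

variable {n : ℕ} {M : Type*} [TopologicalSpace M] [ChartedSpace (EuclideanSpace ℝ (Fin n)) M]
  [IsManifold (𝓡 n) ∞ M] [RiemannianBundle (fun x : M => TangentSpace (𝓡 n) x)]
  {cov : CovariantDerivative (𝓡 n) (EuclideanSpace ℝ (Fin n))
    (TangentSpace (𝓡 n) : M → Type _)}
  {G : Subgroup (Matrix.specialOrthogonalGroup (Fin n) ℝ)} {P : ParallelReduction cov G}
  {U : Set M} {s : ∀ y : M, Fin n → TangentSpace (𝓡 n) y}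

theorem fderiv_frameMatrix (hs : IsLocalSection P.fiber U s) {x : M}
    {z : EuclideanSpace ℝ (Fin n)} (hz : z ∈ (extChartAt (𝓡 n) x).target)
    (hzU : (extChartAt (𝓡 n) x).symm z ∈ U) (l ν : Fin n) (v : EuclideanSpace ℝ (Fin n)) :
    fderiv ℝ (fun y => frameMatrix x s y l ν) z v =
      fderiv ℝ (coordField x fun y => s y ν) z v l := by
  have h1 := ((contDiffAt_coordField hs.isOpen (hs.contMDiffOn ν) hz hzU).differentiableAt
    (by simp)).hasFDerivAt
  have h2 := ((EuclideanSpace.proj l : EuclideanSpace ℝ (Fin n) →L[ℝ] ℝ).hasFDerivAt).comp z h1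
  exact congrArg (fun T : EuclideanSpace ℝ (Fin n) →L[ℝ] ℝ => T v) h2.fderiv

theorem frameDivergence_eq_zero {F : Type*} [NormedAddCommGroup F] [NormedSpace ℝ F]
    {f : Fin n → M → F} {y : M} (h : ∀ μ, f μ =ᶠ[𝓝 y] fun _ => 0) :
    frameDivergence cov s f y = 0 := by
  refine Finset.sum_eq_zero fun μ _ => ?_
  rw [mvfderiv_congr (h μ), (h μ).self_of_nhds, smul_zero, add_zero]
  exact mvfderiv_eq_of_hasDerivAt mdifferentiableAt_const (hasDerivAt_const _ _)

variable [IsContMDiffRiemannianBundle (𝓡 n) ∞ (EuclideanSpace ℝ (Fin n))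
  (fun x : M => TangentSpace (𝓡 n) x)]

/-- The divergence of `s_μ` for the density `1 / |det A|`, up to that factor. By torsion-freeness
the structure functions of the frame are differences of entries of `ω`, and skewness of `ω` kills
the diagonal entries in their trace. -/
theorem sum_fderiv_frameMatrix (hcov : IsLeviCivita cov) (hs : IsLocalSection P.fiber U s) {x : M}
    {z : EuclideanSpace ℝ (Fin n)} (hz : z ∈ (extChartAt (𝓡 n) x).target)
    (hzU : (extChartAt (𝓡 n) x).symm z ∈ U) (μ : Fin n) :
    ∑ k, (-((frameMatrix x s z)⁻¹ * Matrix.of fun i j => fderiv ℝ (fun y => frameMatrix x s y i j) z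
      (EuclideanSpace.single k 1)).trace * frameMatrix x s z k μ +
      fderiv ℝ (fun y => frameMatrix x s y k μ) z (EuclideanSpace.single k 1)) =
    ∑ ν, connectionForm cov s ((extChartAt (𝓡 n) x).symm z)
      (s ((extChartAt (𝓡 n) x).symm z) ν) ν μ := by
  set p := (extChartAt (𝓡 n) x).symm z with hp
  have hω := P.connectionForm_mem U s hs p hzU
  have hdiag : ∀ a i, connectionForm cov s p a i i = 0 := by
    intro a i
    have := congrFun (congrFun (transpose_eq_neg_of_mem_lieAlg (hω a)) i) i
    simp only [Matrix.transpose_apply, Matrix.neg_apply] at this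
    linarith
  have hB := sum_fderiv_density (det_frameMatrix_ne_zero hz (P.orthonormal _ _ (hs.mem _ hzU)))
    (fun k => Matrix.of fun i j => fderiv ℝ (fun y => frameMatrix x s y i j) z
      (EuclideanSpace.single k 1))
    (fun μ ν κ => connectionForm cov s p (s p μ) κ ν - connectionForm cov s p (s p ν) κ μ) ?_ μ
  · refine hB.trans ?_
    simp [hdiag]
  · intro μ ν l
    have h1 := coordField_mlieBracket (SmoothOn.mdifferentiableAt hs.isOpen (hs.contMDiffOn μ) hzU)
      (SmoothOn.mdifferentiableAt hs.isOpen (hs.contMDiffOn ν) hzU) hz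
    rw [coordField_sum_smul _ _ (fun κ y => s y κ) (mlieBracket_frame hcov hs hzU μ ν)] at h1
    have h2 := congrArg (fun v : EuclideanSpace ℝ (Fin n) => v l) h1
    have h3 : ∀ μ ν, ∑ k, frameMatrix x s z k μ * fderiv ℝ (fun y => frameMatrix x s y l ν) z
        (EuclideanSpace.single k 1) =
        fderiv ℝ (coordField x fun y => s y ν) z (coordField x (fun y => s y μ) z) l := by
      intro μ ν
      rw [← fderiv_frameMatrix hs hz hzU]
      exact sum_apply_smul_map_single _ _
    simp only [Matrix.of_apply, Finset.sum_sub_distrib]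
    rw [h3, h3]
    simp only [VectorField.lieBracket] at h2
    refine Eq.trans ?_ (h2.symm.trans ?_)
    · rfl
    · simp [frameMatrix]

variable [T2Space M] [SecondCountableTopology M] [MeasurableSpace M] [BorelSpace M]

/-- The divergence theorem for vector fields with compact support in a chart. -/
theorem integral_frameDivergence (hcov : IsLeviCivita cov) (hs : IsLocalSection P.fiber U s) (x : M)
    {K : Set M} (hK : IsCompact K) (hKU : K ⊆ U) (hKx : K ⊆ (extChartAt (𝓡 n) x).source)
    {F : Type*} [NormedAddCommGroup F] [NormedSpace ℝ F] {f : Fin n → M → F}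
    (hf : ∀ μ, ContMDiffOn (𝓡 n) 𝓘(ℝ, F) ∞ (f μ) U) (h0 : ∀ μ, ∀ y ∉ K, f μ y = 0) :
    Integrable (frameDivergence cov s f) (riemannianVolume n M) ∧
      ∫ y, frameDivergence cov s f y ∂(riemannianVolume n M) = 0 := by
  classical
  have hdiv0 : ∀ y ∉ K, frameDivergence cov s f y = 0 := by
    intro y hy
    refine frameDivergence_eq_zero fun μ => ?_
    filter_upwards [hK.isClosed.isOpen_compl.mem_nhds hy] with y' hy'
    exact h0 μ y' hy'
  have hdivc : Continuous (frameDivergence cov s f) := by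
    refine continuous_iff_continuousAt.2 fun y => ?_
    by_cases hy : y ∈ K
    · have hU := hs.isOpen.mem_nhds (hKU hy)
      refine tendsto_finsetSum _ fun μ _ => ?_
      refine ContinuousAt.add ?_ (ContinuousAt.smul ?_ ?_)
      · exact (contMDiffOn_mvfderiv hs.isOpen (hf μ) (hs.contMDiffOn μ)).continuousOn.continuousAt hU
      · refine tendsto_finsetSum _ fun ν _ => ?_
        exact (contMDiffOn_connectionForm hcov hs (hs.contMDiffOn ν) ν
          μ).continuousOn.continuousAt hU
      · exact (hf μ).continuousOn.continuousAt hU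
    · refine (continuousAt_const (y := (0 : F))).congr ?_
      filter_upwards [hK.isClosed.isOpen_compl.mem_nhds hy] with y' hy'
      exact (hdiv0 y' hy').symm
  set φ := extChartAt (𝓡 n) x with hφ
  -- The coordinate components of the vector field times the density, extended by zero: chart data
  -- have no meaning outside the target.
  let g : Fin n → EuclideanSpace ℝ (Fin n) → F := fun k z => if z ∈ φ.target then
    ∑ μ, (|(frameMatrix x s z).det|⁻¹ * frameMatrix x s z k μ) • (f μ ∘ φ.symm) z else 0
  have hK' : IsCompact (φ '' K) := hK.image_of_continuousOn ((continuousOn_extChartAt x).mono hKx)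
  have hKmem : ∀ z ∈ φ '' K, z ∈ φ.target ∧ φ.symm z ∈ K := by
    rintro _ ⟨y, hy, rfl⟩
    exact ⟨φ.map_source (hKx hy), by rw [φ.left_inv (hKx hy)]; exact hy⟩
  have hnot : ∀ z ∉ φ '' K, z ∈ φ.target → φ.symm z ∉ K := fun z hz hzt h =>
    hz ⟨φ.symm z, h, φ.right_inv hzt⟩
  have hg0 : ∀ k, ∀ z ∉ φ '' K, g k z = 0 := by
    intro k z hz
    by_cases hzt : z ∈ φ.target
    · simp only [g, if_pos hzt, Function.comp_apply, h0 _ _ (hnot z hz hzt), smul_zero,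
        Finset.sum_const_zero]
    · simp only [g, if_neg hzt]
  have hgloc : ∀ k, ∀ z ∉ φ '' K, g k =ᶠ[𝓝 z] fun _ => 0 := by
    intro k z hz
    filter_upwards [hK'.isClosed.isOpen_compl.mem_nhds hz] with z' hz'
    exact hg0 k z' hz'
  have hgin : ∀ k, ∀ z ∈ φ '' K, g k =ᶠ[𝓝 z] fun z => ∑ μ,
      (|(frameMatrix x s z).det|⁻¹ * frameMatrix x s z k μ) • (f μ ∘ φ.symm) z := by
    intro k z hz
    filter_upwards [(isOpen_extChartAt_target x).mem_nhds (hKmem z hz).1] with z' hz'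
    exact if_pos hz'
  have hgs : ∀ k, ContDiff ℝ 1 (g k) := by
    intro k
    refine contDiff_iff_contDiffAt.2 fun z => ?_
    by_cases hz : z ∈ φ '' K
    · obtain ⟨hzt, hzK⟩ := hKmem z hz
      have hdet := det_frameMatrix_ne_zero hzt (P.orthonormal _ _ (hs.mem _ (hKU hzK)))
      refine ContDiffAt.congr_of_eventuallyEq (ContDiffAt.sum fun μ _ => ?_) (hgin k z hz)
      refine ContDiffAt.smul (ContDiffAt.mul (ContDiffAt.inv ?_ (abs_ne_zero.2 hdet)) ?_) ?_
      · exact (contDiffAt_abs hdet).comp z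
          ((hs.contDiffAt_det_frameMatrix hzt (hKU hzK)).of_le (by simp))
      · exact (hs.contDiffAt_frameMatrix hzt (hKU hzK) k μ).of_le (by simp)
      · exact (contDiffAt_comp_extChartAt_symm hs.isOpen (hf μ) hzt (hKU hzK)).of_le (by simp)
    · exact contDiffAt_const.congr_of_eventuallyEq (hgloc k z hz)
  have hgc : ∀ k, HasCompactSupport (g k) := fun k => HasCompactSupport.intro hK' (hg0 k)
  have hint := fun k => integral_fderiv_apply_eq_zero (hgs k) (hgc k) (EuclideanSpace.single k 1)
  -- The Euclidean divergence of `g` is the density times the covariant divergence, so the integral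
  -- over `M` becomes one of partial derivatives.
  have hkey : ∀ z ∈ φ.target, ∑ k, fderiv ℝ (g k) z (EuclideanSpace.single k 1) =
      volumeDensity x z • frameDivergence cov s f (φ.symm z) := by
    intro z hzt
    by_cases hz : z ∈ φ '' K
    · obtain ⟨-, hzK⟩ := hKmem z hz
      have hzU := hKU hzK
      have ho := P.orthonormal _ _ (hs.mem _ hzU)
      obtain ⟨D, hD, hDv⟩ := hasFDerivAt_abs_det_inv (A := frameMatrix x s) (z := z)
        (fun i j => (hs.contDiffAt_frameMatrix hzt hzU i j).differentiableAt (by simp))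
        (det_frameMatrix_ne_zero hzt ho)
      have h1 : ∀ k, fderiv ℝ (g k) z (EuclideanSpace.single k 1) = ∑ μ,
          ((|(frameMatrix x s z).det|⁻¹ * frameMatrix x s z k μ) •
            fderiv ℝ (f μ ∘ φ.symm) z (EuclideanSpace.single k 1) +
          (|(frameMatrix x s z).det|⁻¹ *
            fderiv ℝ (fun y => frameMatrix x s y k μ) z (EuclideanSpace.single k 1) +
            frameMatrix x s z k μ * D (EuclideanSpace.single k 1)) • (f μ ∘ φ.symm) z) := by
        intro k
        have h2 : HasFDerivAt (g k) _ z := HasFDerivAt.congr_of_eventuallyEq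
          (HasFDerivAt.fun_sum fun μ _ => (hD.mul
            ((hs.contDiffAt_frameMatrix hzt hzU k μ).differentiableAt (by simp)).hasFDerivAt).smul
            ((contDiffAt_comp_extChartAt_symm hs.isOpen (hf μ) hzt hzU).differentiableAt
              (by simp)).hasFDerivAt) (hgin k z hz)
        rw [h2.fderiv, sum_apply]
        rfl
      simp only [h1, hDv]
      rw [Finset.sum_comm, frameDivergence, volumeDensity_eq_inv hzt ho, Finset.smul_sum]
      refine Finset.sum_congr rfl fun μ _ => ?_
      rw [Finset.sum_add_distrib, smul_add]
      congr 1
      · have h3 := sum_apply_smul_map_single (fderiv ℝ (f μ ∘ φ.symm) z)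
          (coordField x (fun y => s y μ) z)
        rw [fderiv_coordField hzt (((hf μ).contMDiffAt (hs.isOpen.mem_nhds
          hzU)).mdifferentiableAt (by simp))] at h3
        rw [← h3, Finset.smul_sum]
        exact Finset.sum_congr rfl fun k _ => mul_smul _ _ _
      · rw [← Finset.sum_smul, ← sum_fderiv_frameMatrix hcov hs hzt hzU, smul_smul, Finset.mul_sum]
        refine congrArg (· • _) (Finset.sum_congr rfl fun k _ => ?_)
        ring
    · rw [hdiv0 _ (hnot z hz hzt), smul_zero]
      refine Finset.sum_eq_zero fun k _ => ?_
      rw [(hgloc k z hz).fderiv_eq]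
      simp
  have hzero : ∀ z ∉ φ.target, ∑ k, fderiv ℝ (g k) z (EuclideanSpace.single k 1) = 0 := by
    intro z hz
    refine Finset.sum_eq_zero fun k _ => ?_
    rw [(hgloc k z fun h => hz (hKmem z h).1).fderiv_eq]
    simp
  have hmeas := (isOpen_extChartAt_target (I := 𝓡 n) x).measurableSet
  have hsum := integrable_finsetSum Finset.univ fun k _ => (hint k).1
  have h5 := integral_eq_integral_chart P hdivc x (fun y hy => hdiv0 y fun h => hy (hKx h))
    ((integrableOn_congr_fun hkey hmeas).1 hsum.integrableOn)
  refine ⟨h5.1, h5.2.trans ?_⟩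
  rw [← setIntegral_congr_fun hmeas hkey, setIntegral_eq_integral_of_forall_compl_eq_zero hzero,
    integral_finsetSum _ fun k _ => (hint k).1]
  exact Finset.sum_eq_zero fun k _ => (hint k).2

end Divergence

/-! ### Formal adjoints -/

section Pairing

variable {n : ℕ} {M : Type*} [TopologicalSpace M] [ChartedSpace (EuclideanSpace ℝ (Fin n)) M]
  [IsManifold (𝓡 n) ∞ M] [RiemannianBundle (fun x : M => TangentSpace (𝓡 n) x)]
  {cov : CovariantDerivative (𝓡 n) (EuclideanSpace ℝ (Fin n))
    (TangentSpace (𝓡 n) : M → Type _)}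
  {G : Subgroup (Matrix.specialOrthogonalGroup (Fin n) ℝ)} {P : ParallelReduction cov G}

theorem HasCompactSupp.of_forall_notMem {V : Type*} [NormedAddCommGroup V]
    {ψ : FrameFun n M V} [T2Space M] {K : Set M} (hK : IsCompact K)
    (h : ∀ x ∉ K, ∀ u ∈ P.fiber x, ψ x u = 0) : HasCompactSupp P ψ :=
  hK.of_isClosed_subset isClosed_closure (closure_minimal
    (fun x ⟨u, hu, hne⟩ => by_contra fun hx => hne (h x hx u hu)) hK.isClosed)

variable {V : Type*} [NormedAddCommGroup V] [InnerProductSpace ℂ V]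
  {ρ : Representation ℂ G V} {ψ φ : FrameFun n M V}

theorem someFrame_mem (P : ParallelReduction cov G) (x : M) : someFrame P x ∈ P.fiber x := by
  obtain ⟨U, s, hs, hx⟩ := P.exists_section x
  exact Classical.epsilon_spec (p := fun u => u ∈ P.fiber x) ⟨s x, hs.mem x hx⟩

theorem pairing_eq (hρ : ∀ (g : G) (v w : V), ⟪ρ g v, ρ g w⟫_ℂ = ⟪v, w⟫_ℂ)
    (hψ : IsSection P ρ ψ) (hφ : IsSection P ρ φ) {x : M}
    {u : Fin n → TangentSpace (𝓡 n) x} (hu : u ∈ P.fiber x) :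
    pairing P ψ φ x = ⟪ψ x u, φ x u⟫_ℂ := by
  obtain ⟨_, ⟨g, hg, rfl⟩, he⟩ := P.transitive x u hu _ (someFrame_mem P x)
  have h1 := hψ.equivariant x u hu ⟨g, hg⟩
  have h2 := hφ.equivariant x u hu ⟨g, hg⟩
  rw [pairing, he]
  exact (congrArg₂ (fun a b => ⟪a, b⟫_ℂ) h1 h2).trans (hρ _ _ _)

theorem continuous_pairing (hρ : ∀ (g : G) (v w : V), ⟪ρ g v, ρ g w⟫_ℂ = ⟪v, w⟫_ℂ)
    (hψ : IsSection P ρ ψ) (hφ : IsSection P ρ φ) : Continuous (pairing P ψ φ) := by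
  refine continuous_iff_continuousAt.2 fun x => ?_
  obtain ⟨U, s, hs, hx⟩ := P.exists_section x
  have h1 : ContinuousOn (fun y => ⟪ψ y (s y), φ y (s y)⟫_ℂ) U :=
    (hψ.smooth U s hs).continuousOn.inner (𝕜 := ℂ) (hφ.smooth U s hs).continuousOn
  refine (h1.continuousAt (hs.isOpen.mem_nhds hx)).congr ?_
  filter_upwards [hs.isOpen.mem_nhds hx] with y hy
  exact (pairing_eq hρ hψ hφ (hs.mem y hy)).symm

theorem IsSection.sub (hψ : IsSection P ρ ψ) (hφ : IsSection P ρ φ) :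
    IsSection P ρ fun x u => ψ x u - φ x u where
  equivariant x u hu g := by
    rw [hψ.equivariant x u hu, hφ.equivariant x u hu, map_sub]
  smooth U s hs := (hψ.smooth U s hs).sub (hφ.smooth U s hs)

theorem IsSection.smul {χ : M → ℝ} (hχ : ContMDiff (𝓡 n) 𝓘(ℝ, ℝ) ∞ χ) (hψ : IsSection P ρ ψ) :
    IsSection P ρ fun x u => χ x • ψ x u where
  equivariant x u hu g := by
    rw [hψ.equivariant x u hu]
    exact (map_smul ((ρ g⁻¹).restrictScalars ℝ) _ _).symm
  smooth U s hs := hχ.contMDiffOn.smul (hψ.smooth U s hs)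

variable {V' : Type*} [NormedAddCommGroup V'] [InnerProductSpace ℂ V'] {ρ' : Representation ℂ G V'}
  {D : FrameFun n M V → FrameFun n M V'} {A A' : FrameFun n M V' → FrameFun n M V}

/-- Formal adjoints are unique. -/
theorem IsFormalAdjoint.eq [T2Space M] [SecondCountableTopology M] [MeasurableSpace M]
    [BorelSpace M] (hρ : ∀ (g : G) (v w : V), ⟪ρ g v, ρ g w⟫_ℂ = ⟪v, w⟫_ℂ)
    (hA : IsFormalAdjoint P ρ ρ' D A) (hA' : IsFormalAdjoint P ρ ρ' D A') {φ : FrameFun n M V'}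
    (hφ : IsSection P ρ' φ) {x : M} {u : Fin n → TangentSpace (𝓡 n) x} (hu : u ∈ P.fiber x) :
    A φ x u = A' φ x u := by
  have := isOpenPosMeasure_riemannianVolume P
  have := isLocallyFiniteMeasure_riemannianVolume P
  have hs := hA.isSection φ hφ
  have hs' := hA'.isSection φ hφ
  have hδ := hs.sub hs'
  obtain ⟨χ⟩ : Nonempty (SmoothBumpFunction (𝓡 n) x) := inferInstance
  have hψ := hδ.smul χ.contMDiff
  -- The test section is the difference of the two adjoints, cut off near `x`. The pairing with the
  -- difference then has the integrand `χ |Aφ - A'φ|²`.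
  set ψ : FrameFun n M V := fun x u => χ x • (A φ x u - A' φ x u) with hψdef
  have hψ0 : ∀ y ∉ tsupport χ, ∀ u ∈ P.fiber y, ψ y u = 0 := fun y hy u _ => by
    simp only [hψdef, image_eq_zero_of_notMem_tsupport hy, zero_smul]
  have hψc : HasCompactSupp P ψ := HasCompactSupp.of_forall_notMem χ.hasCompactSupport hψ0
  have hpc : ∀ {φ : FrameFun n M V}, HasCompactSupport (pairing P ψ φ) := fun {φ} =>
    HasCompactSupport.intro χ.hasCompactSupport fun y hy => by
      rw [pairing, hψ0 y hy _ (someFrame_mem P y), inner_zero_left]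
  have hpi : ∀ {φ : FrameFun n M V}, IsSection P ρ φ →
      Integrable (pairing P ψ φ) (riemannianVolume n M) := fun hφ =>
    (continuous_pairing hρ hψ hφ).integrable_of_hasCompactSupport hpc
  have h1 : ∫ y, pairing P ψ (fun x u => A φ x u - A' φ x u) y ∂(riemannianVolume n M) = 0 := by
    have h2 := (hA.integral_eq φ ψ hφ hψ hψc).symm.trans (hA'.integral_eq φ ψ hφ hψ hψc)
    rw [← sub_eq_zero, ← integral_sub (hpi hs) (hpi hs')] at h2
    refine Eq.trans (integral_congr_ae (Eventually.of_forall fun y => ?_)) h2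
    simp only [pairing, inner_sub_right]
  have h3 : ∀ y, (pairing P ψ (fun x u => A φ x u - A' φ x u) y).re =
      χ y * ‖A φ y (someFrame P y) - A' φ y (someFrame P y)‖ ^ 2 := by
    intro y
    simp only [pairing, hψdef]
    rw [← Complex.coe_smul, inner_smul_left, inner_self_eq_norm_sq_to_K]
    simp [← Complex.ofReal_pow, ← Complex.ofReal_mul]
  by_contra hne
  have h4 : pairing P ψ (fun x u => A φ x u - A' φ x u) x = ⟪ψ x u, A φ x u - A' φ x u⟫_ℂ :=
    pairing_eq hρ hψ hδ hu
  have h5 : (pairing P ψ (fun x u => A φ x u - A' φ x u) x).re ≠ 0 := by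
    rw [h4]
    simp only [hψdef, χ.eq_one, one_smul]
    rw [inner_self_eq_norm_sq_to_K]
    have := norm_ne_zero_iff.2 (sub_ne_zero.2 hne)
    simpa [← Complex.ofReal_pow] using this
  -- If the adjoints differed at `x`, a continuous nonnegative function, nonzero at `x`, would have
  -- integral zero.
  have h6 := Continuous.integral_pos_of_hasCompactSupport_nonneg_nonzero
    (μ := riemannianVolume n M)
    (f := fun y => (pairing P ψ (fun x u => A φ x u - A' φ x u) y).re)
    (Complex.continuous_re.comp (continuous_pairing hρ hψ hδ))
    (hpc.comp_left (g := Complex.re) rfl)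
    (fun y => (mul_nonneg χ.nonneg (sq_nonneg _)).trans_eq (h3 y).symm) h5
  have h7 := integral_re (𝕜 := ℂ) (hpi hδ)
  rw [h1] at h7
  exact h6.ne' (h7.trans (by simp))

end Pairing

/-! ### Green's formula and the existence of formal adjoints -/

section Existence

theorem inner_toRepresentation {n : ℕ}
    {G : Subgroup (Matrix.specialOrthogonalGroup (Fin n) ℝ)}
    {V : Type*} [NormedAddCommGroup V] [InnerProductSpace ℂ V] {ρ : Representation ℂ G V}
    {W : Subrepresentation ((complexRep G).tprod ρ)}
    (hρ : ∀ (g : G) (v w : V), ⟪ρ g v, ρ g w⟫_ℂ = ⟪v, w⟫_ℂ) (g : G)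
    (v w : W.toSubmodule) : ⟪W.toRepresentation g v, W.toRepresentation g w⟫_ℂ = ⟪v, w⟫_ℂ :=
  inner_tprod hρ g v w

variable {n : ℕ} {M : Type*} [TopologicalSpace M] [ChartedSpace (EuclideanSpace ℝ (Fin n)) M]
  [IsManifold (𝓡 n) ∞ M] [RiemannianBundle (fun x : M => TangentSpace (𝓡 n) x)]
  {cov : CovariantDerivative (𝓡 n) (EuclideanSpace ℝ (Fin n))
    (TangentSpace (𝓡 n) : M → Type _)}
  {G : Subgroup (Matrix.specialOrthogonalGroup (Fin n) ℝ)} {P : ParallelReduction cov G}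
  {V : Type*} [NormedAddCommGroup V] [InnerProductSpace ℂ V] [FiniteDimensional ℂ V]
  {ρ : Representation ℂ G V} {W : Subrepresentation ((complexRep G).tprod ρ)}
  {L : Matrix (Fin n) (Fin n) ℝ →L[ℝ] (V →L[ℂ] V)}
  {U : Set M} {s : ∀ y : M, Fin n → TangentSpace (𝓡 n) y}
  {ψ : FrameFun n M V} {φ : FrameFun n M W.toSubmodule}

/-- The components in the frame `s` of the contraction of the sections `ψ` and `φ`. -/
def contraction (s : ∀ y : M, Fin n → TangentSpace (𝓡 n) y) (ψ : FrameFun n M V)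
    (φ : FrameFun n M W.toSubmodule) (μ : Fin n) (y : M) : ℂ :=
  ⟪ψ y (s y), contr μ (φ y (s y) : TSpace n ⊗[ℂ] V)⟫_ℂ

theorem contMDiffOn_contr (hφ : IsSection P W.toRepresentation φ)
    (hs : IsLocalSection P.fiber U s) (μ : Fin n) :
    ContMDiffOn (𝓡 n) 𝓘(ℝ, V) ∞ (fun y => contr μ (φ y (s y) : TSpace n ⊗[ℂ] V)) U :=
  (((LinearMap.toContinuousLinearMap (contr μ ∘ₗ W.toSubmodule.subtype)).restrictScalars
    ℝ).contMDiff).comp_contMDiffOn (hφ.smooth U s hs)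

theorem contMDiffOn_contraction (hψ : IsSection P ρ ψ) (hφ : IsSection P W.toRepresentation φ)
    (hs : IsLocalSection P.fiber U s) (μ : Fin n) :
    ContMDiffOn (𝓡 n) 𝓘(ℝ, ℂ) ∞ (contraction s ψ φ μ) U := by
  have h1 : ContDiff ℝ ∞ fun p : V × V => ⟪p.1, p.2⟫_ℂ := contDiff_inner
  exact h1.contMDiff.comp_contMDiffOn ((hψ.smooth U s hs).prodMk_space
    (contMDiffOn_contr hφ hs μ))

theorem frameDivergence_sum {F ι : Type*} [NormedAddCommGroup F] [NormedSpace ℝ F]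
    {f : Fin n → M → F} {x : M} (t : Finset ι) {g : ι → Fin n → M → F}
    (hg : ∀ i μ, MDifferentiableAt (𝓡 n) 𝓘(ℝ, F) (g i μ) x)
    (h : ∀ μ, f μ =ᶠ[𝓝 x] fun y => ∑ i ∈ t, g i μ y) :
    frameDivergence cov s f x = ∑ i ∈ t, frameDivergence cov s (g i) x := by
  simp only [frameDivergence]
  rw [Finset.sum_comm]
  refine Finset.sum_congr rfl fun μ _ => ?_
  rw [mvfderiv_congr (h μ), (h μ).self_of_nhds, mvfderiv_finset_sum t fun i => hg i μ,
    Finset.smul_sum, Finset.sum_add_distrib]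

variable [IsContMDiffRiemannianBundle (𝓡 n) ∞ (EuclideanSpace ℝ (Fin n))
  (fun x : M => TangentSpace (𝓡 n) x)]

/-- The Stein-Weiss operator and its codifferential are adjoint up to a divergence. -/
theorem pairing_sub_pairing (hL : HasFDerivWithinAt (onMatrices ρ) L (matSet G) 1)
    (hcov : IsLeviCivita cov) [T2Space M]
    (hρ : ∀ (g : G) (v w : V), ⟪ρ g v, ρ g w⟫_ℂ = ⟪v, w⟫_ℂ)
    (hψ : IsSection P ρ ψ) (hφ : IsSection P W.toRepresentation φ)
    (hs : IsLocalSection P.fiber U s) {x : M} (hx : x ∈ U) :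
    pairing P (steinWeiss P ρ W ψ) φ x -
      pairing P ψ (codifferential P W.toRepresentation W.toSubmodule.subtype φ) x =
      frameDivergence cov s (contraction s ψ φ) x := by
  obtain ⟨L', hL', hj⟩ := exists_hasFDerivWithinAt_of_embedding (V' := W.toSubmodule)
    (ρ' := W.toRepresentation) hL W.toSubmodule.subtype
    W.toSubmodule.orthogonalProjectionOnto.toLinearMap
    (fun w => Submodule.orthogonalProjectionOnto_mem_subspace_eq_self w) (fun g w => rfl)
  have hY : ∀ μ, connectionForm cov s x (s x μ) ∈ lieAlg G := fun μ =>
    P.connectionForm_mem U s hs x hx _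
  rw [pairing_eq (inner_toRepresentation hρ) (isSection_steinWeiss hcov hL hρ W hψ) hφ
    (hs.mem x hx), pairing_eq hρ hψ (isSection_codifferential hcov hL' (fun g w => rfl) hφ)
    (hs.mem x hx)]
  have h1 : ⟪steinWeiss P ρ W ψ x (s x), φ x (s x)⟫_ℂ =
      ∑ μ, ⟪localDeriv cov L ψ s x (s x μ), contr μ (φ x (s x) : TSpace n ⊗[ℂ] V)⟫_ℂ := by
    rw [steinWeiss, Submodule.inner_orthogonalProjectionOnto_eq_of_mem_right, inner_eq_sum_contr]
    simp only [contr_nabla, covDeriv_eq hL hψ hs hx]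
  have h2 : ∀ μ, contr μ (W.toSubmodule.subtype
      (covDeriv P W.toRepresentation φ x (s x) μ)) =
      mvfderiv (𝓡 n) (fun y => contr μ (φ y (s y) : TSpace n ⊗[ℂ] V)) x (s x μ) +
      (∑ ν, connectionForm cov s x (s x μ) μ ν • contr ν (φ x (s x) : TSpace n ⊗[ℂ] V) +
        L (connectionForm cov s x (s x μ)) (contr μ (φ x (s x) : TSpace n ⊗[ℂ] V))) := by
    intro μ
    have h3 := mvfderiv_clm_comp ((LinearMap.toContinuousLinearMap
      (contr μ ∘ₗ W.toSubmodule.subtype)).restrictScalars ℝ) (hφ.mdifferentiableAt hs hx) (s x μ)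
    rw [covDeriv_eq hL' hφ hs hx, localDeriv, map_add, map_add, hj _ (hY μ), contr_tensorAct]
    exact congrArg₂ _ h3.symm rfl
  have h3 : ∀ μ, mvfderiv (𝓡 n) (contraction s ψ φ μ) x (s x μ) =
      ⟪ψ x (s x), mvfderiv (𝓡 n) (fun y => contr μ (φ y (s y) : TSpace n ⊗[ℂ] V)) x (s x μ)⟫_ℂ +
      ⟪mvfderiv (𝓡 n) (fun y => ψ y (s y)) x (s x μ),
        contr μ (φ x (s x) : TSpace n ⊗[ℂ] V)⟫_ℂ := by
    intro μ
    have h4 := ((contMDiffOn_contraction hψ hφ hs μ).contMDiffAt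
      (hs.isOpen.mem_nhds hx)).mdifferentiableAt (by simp)
    have h5 := (((contMDiffOn_contr hφ hs μ).contMDiffAt
      (hs.isOpen.mem_nhds hx)).mdifferentiableAt (by simp))
    have h6 := (hasDerivAt_comp_curve (hψ.mdifferentiableAt hs hx) (s x μ)).inner ℂ
      (hasDerivAt_comp_curve h5 (s x μ))
    rw [curve_zero] at h6
    exact mvfderiv_eq_of_hasDerivAt h4 h6
  rw [h1, codifferential, inner_neg_right, sub_neg_eq_add, inner_sum, ← Finset.sum_add_distrib,
    frameDivergence]
  simp only [h2, h3, localDeriv, inner_add_left, inner_add_right,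
    inner_apply_eq_neg hρ hL (hY _)]
  -- The `T` part of the connection acting on `φ` is the zeroth-order term of the divergence. The
  -- `V` parts cancel because `L` is skew-Hermitian on the Lie algebra.
  have h7 : ∑ μ, ⟪ψ x (s x), ∑ ν, connectionForm cov s x (s x μ) μ ν •
      contr ν (φ x (s x) : TSpace n ⊗[ℂ] V)⟫_ℂ =
      ∑ μ, (∑ ν, connectionForm cov s x (s x ν) ν μ) • contraction s ψ φ μ x := by
    simp only [inner_sum, Finset.sum_smul, contraction]
    rw [Finset.sum_comm]
    refine Finset.sum_congr rfl fun μ _ => Finset.sum_congr rfl fun ν _ => ?_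
    rw [← Complex.coe_smul, inner_smul_right, Complex.real_smul]
  simp only [Finset.sum_add_distrib, h7, Finset.sum_neg_distrib]
  ring

/-- Separate integrability is not required: if one function is not integrable, neither is the other,
and both integrals are `0` by convention. -/
theorem integral_eq_of_integrable_sub {α : Type*} [MeasurableSpace α] {m : Measure α} {a b : α → ℂ}
    (h : Integrable (fun x => a x - b x) m) (h0 : ∫ x, (a x - b x) ∂m = 0) :
    ∫ x, a x ∂m = ∫ x, b x ∂m := by
  by_cases hb : Integrable b m
  · have ha : Integrable a m := (h.add hb).congr (Eventually.of_forall fun x => by simp)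
    rwa [integral_sub ha hb, sub_eq_zero] at h0
  · have ha : ¬Integrable a m := fun ha =>
      hb ((ha.sub h).congr (Eventually.of_forall fun x => by simp))
    rw [integral_undef ha, integral_undef hb]

variable [T2Space M] [SecondCountableTopology M] [MeasurableSpace M] [BorelSpace M]

/-- Two sections, one of which has a small compact support, satisfy Green's formula. -/
theorem integral_pairing_sub_of_support_subset
    (hL : HasFDerivWithinAt (onMatrices ρ) L (matSet G) 1)
    (hcov : IsLeviCivita cov) (hρ : ∀ (g : G) (v w : V), ⟪ρ g v, ρ g w⟫_ℂ = ⟪v, w⟫_ℂ)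
    (hψ : IsSection P ρ ψ) (hφ : IsSection P W.toRepresentation φ)
    (hs : IsLocalSection P.fiber U s) (x : M)
    {K : Set M} (hK : IsCompact K) (hKU : K ⊆ U) (hKx : K ⊆ (extChartAt (𝓡 n) x).source)
    (h0 : ∀ y ∉ K, ∀ u ∈ P.fiber y, ψ y u = 0) (hU : ∀ y ∉ U, ∀ u, ψ y u = 0) :
    Integrable (fun y => pairing P (steinWeiss P ρ W ψ) φ y -
      pairing P ψ (codifferential P W.toRepresentation W.toSubmodule.subtype φ) y)
      (riemannianVolume n M) ∧
    ∫ y, (pairing P (steinWeiss P ρ W ψ) φ y -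
      pairing P ψ (codifferential P W.toRepresentation W.toSubmodule.subtype φ) y)
      ∂(riemannianVolume n M) = 0 := by
  -- Outside `U` the value `s y` need not be a frame of the reduction, which is why `hU` concerns
  -- all frames.
  have hc0 : ∀ μ, ∀ y ∉ K, contraction s ψ φ μ y = 0 := fun μ y hy => by
    have h1 : ψ y (s y) = 0 := by
      by_cases hyU : y ∈ U
      · exact h0 y hy _ (hs.mem y hyU)
      · exact hU y hyU _
    rw [contraction, h1, inner_zero_left]
  have h1 := integral_frameDivergence hcov hs x hK hKU hKx
    (fun μ => contMDiffOn_contraction hψ hφ hs μ) hc0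
  have h2 : (fun y => pairing P (steinWeiss P ρ W ψ) φ y -
      pairing P ψ (codifferential P W.toRepresentation W.toSubmodule.subtype φ) y) =
      frameDivergence cov s (contraction s ψ φ) := by
    funext y
    by_cases hy : y ∈ K
    · exact pairing_sub_pairing hL hcov hρ hψ hφ hs (hKU hy)
    -- Off `K` the section `s` may be undefined, so the pairing is computed in another frame; both
    -- divergences vanish there.
    · obtain ⟨U', s', hs', hy'⟩ := P.exists_section y
      rw [pairing_sub_pairing hL hcov hρ hψ hφ hs' hy', frameDivergence_eq_zero fun μ => ?_,
        frameDivergence_eq_zero fun μ => ?_]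
      · filter_upwards [hK.isClosed.isOpen_compl.mem_nhds hy] with z hz
        exact hc0 μ z hz
      · filter_upwards [hK.isClosed.isOpen_compl.mem_nhds hy, hs'.isOpen.mem_nhds hy'] with z hz hz'
        rw [contraction, h0 z hz _ (hs'.mem z hz'), inner_zero_left]
  rw [h2]
  exact h1

/-- The codifferential is the formal adjoint of the Stein-Weiss operator. -/
theorem isFormalAdjoint_codifferential (hL : HasFDerivWithinAt (onMatrices ρ) L (matSet G) 1)
    (hcov : IsLeviCivita cov) (hρ : ∀ (g : G) (v w : V), ⟪ρ g v, ρ g w⟫_ℂ = ⟪v, w⟫_ℂ)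
    (W : Subrepresentation ((complexRep G).tprod ρ)) :
    IsFormalAdjoint P ρ W.toRepresentation (steinWeiss P ρ W)
      (codifferential P W.toRepresentation W.toSubmodule.subtype) where
  isSection φ hφ := by
    obtain ⟨L', hL', -⟩ := exists_hasFDerivWithinAt_of_embedding (V' := W.toSubmodule)
      (ρ' := W.toRepresentation) hL W.toSubmodule.subtype
      W.toSubmodule.orthogonalProjectionOnto.toLinearMap
      (fun w => Submodule.orthogonalProjectionOnto_mem_subspace_eq_self w) (fun g w => rfl)
    exact isSection_codifferential hcov hL' (fun g w => rfl) hφ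
  integral_eq φ ψ hφ hψ hψc := by
    have : LocallyCompactSpace M := ChartedSpace.locallyCompactSpace (EuclideanSpace ℝ (Fin n)) M
    choose U s hs hU using P.exists_section
    obtain ⟨χ, hχ⟩ := SmoothPartitionOfUnity.exists_isSubordinate (𝓡 n)
      (isClosed_univ (X := M)) (fun x => U x ∩ (extChartAt (𝓡 n) x).source)
      (fun x => (hs x).isOpen.inter (isOpen_extChartAt_source x))
      (fun x _ => Set.mem_iUnion.2 ⟨x, hU x, mem_extChartAt_source x⟩)
    set K := closure {x : M | ∃ u ∈ P.fiber x, ψ x u ≠ 0} with hK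
    have hψ0 : ∀ y ∉ K, ∀ u ∈ P.fiber y, ψ y u = 0 := fun y hy u hu => by
      by_contra h
      exact hy (subset_closure ⟨u, hu, h⟩)
    -- Only finitely many cut-off functions meet the compact support of `ψ`, so the decomposition of
    -- `ψ` is a finite sum.
    have hχK : {i | (Function.support (χ i) ∩ K).Nonempty}.Finite :=
      χ.locallyFinite.finite_nonempty_inter_compact hψc
    set t := hχK.toFinset with ht
    have hψi : ∀ i, IsSection P ρ fun x u => χ i x • ψ x u := fun i => hψ.smul (χ i).contMDiff
    have hi := fun i => integral_pairing_sub_of_support_subset hL hcov hρ (hψi i) hφ (hs i) i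
      (hψc.inter_left (isClosed_tsupport (χ i)))
      (fun y hy => (hχ i hy.1).1) (fun y hy => (hχ i hy.1).2)
      (fun y hy u hu => by
        by_cases hyχ : y ∈ tsupport (χ i)
        · rw [hψ0 y (fun hyK => hy ⟨hyχ, hyK⟩) u hu, smul_zero]
        · rw [image_eq_zero_of_notMem_tsupport hyχ, zero_smul])
      (fun y hy u => by
        rw [image_eq_zero_of_notMem_tsupport fun h => hy (hχ i h).1, zero_smul])
    -- Both sides are divergences in one frame around `y`. Locally the contraction of `ψ` is the sum
    -- of those of the `χ i • ψ`, so the derivatives of the cut-off functions need not be tracked.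
    have hsum : ∀ y, pairing P (steinWeiss P ρ W ψ) φ y -
        pairing P ψ (codifferential P W.toRepresentation W.toSubmodule.subtype φ) y =
        ∑ i ∈ t, (pairing P (steinWeiss P ρ W fun x u => χ i x • ψ x u) φ y -
          pairing P (fun x u => χ i x • ψ x u)
            (codifferential P W.toRepresentation W.toSubmodule.subtype φ) y) := by
      intro y
      have hy := hU y
      rw [pairing_sub_pairing hL hcov hρ hψ hφ (hs y) hy, Finset.sum_congr rfl fun i _ =>
        pairing_sub_pairing hL hcov hρ (hψi i) hφ (hs y) hy]
      refine frameDivergence_sum t (fun i μ => ((contMDiffOn_contraction (hψi i) hφ (hs y)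
        μ).contMDiffAt ((hs y).isOpen.mem_nhds hy)).mdifferentiableAt (by simp)) fun μ => ?_
      filter_upwards [(hs y).isOpen.mem_nhds hy] with z hz
      have h1 : ∀ i, contraction (s y) (fun x u => χ i x • ψ x u) φ μ z =
          (χ i z : ℂ) * contraction (s y) ψ φ μ z := fun i => by
        rw [contraction, contraction, ← Complex.coe_smul, inner_smul_left, Complex.conj_ofReal]
      rw [Finset.sum_congr rfl fun i _ => h1 i, ← Finset.sum_mul]
      by_cases hzK : z ∈ K
      · have h2 : ∑ i ∈ t, χ i z = 1 := χ.sum_finsupport' z (Set.mem_univ z) fun i hi => by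
          rw [ht, Set.Finite.mem_toFinset]
          exact ⟨z, (χ.mem_finsupport z).1 hi, hzK⟩
        rw [← Complex.ofReal_sum, h2, Complex.ofReal_one, one_mul]
      · rw [contraction, hψ0 z hzK _ ((hs y).mem z hz), inner_zero_left, mul_zero]
    refine integral_eq_of_integrable_sub ?_ ?_
    · simp only [hsum]
      exact integrable_finsetSum t fun i _ => (hi i).1
    · simp only [hsum]
      rw [integral_finsetSum t fun i _ => (hi i).1]
      exact Finset.sum_eq_zero fun i _ => (hi i).2

end Existence

end Weitzenboeck

end
-- The universal Weitzenböck formula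
theorem mainTheorem4
    {n : ℕ} {M : Type*} [TopologicalSpace M] [T2Space M] [SecondCountableTopology M]
    [ChartedSpace (EuclideanSpace ℝ (Fin n)) M] [IsManifold (𝓡 n) ∞ M]
    [RiemannianBundle (fun x : M => TangentSpace (𝓡 n) x)]
    [IsContMDiffRiemannianBundle (𝓡 n) ∞ (EuclideanSpace ℝ (Fin n))
      (fun x : M => TangentSpace (𝓡 n) x)]
    [MeasurableSpace M] [BorelSpace M]
    (cov : CovariantDerivative (𝓡 n) (EuclideanSpace ℝ (Fin n))
      (TangentSpace (𝓡 n) : M → Type _))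
    (hcov : Weitzenboeck.IsLeviCivita cov)
    (G : Subgroup (Matrix.specialOrthogonalGroup (Fin n) ℝ))
    (hG_closed : IsClosed (Weitzenboeck.matSet G))
    (hG_conn : Weitzenboeck.IsPathConnectedGroup G)
    (P : Weitzenboeck.ParallelReduction cov G)
    {V : Type*} [NormedAddCommGroup V] [InnerProductSpace ℂ V] [FiniteDimensional ℂ V]
    (ρ : Representation ℂ G V) (hρ : Weitzenboeck.IsUnitaryRep ρ) (hρ_irr : ρ.IsIrreducible)
    {ι : Type*} [Fintype ι]
    (W : ι → Subrepresentation ((Weitzenboeck.complexRep G).tprod ρ))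
    (hW : Weitzenboeck.IsIrreducibleDecomposition W)
    (h : Submodule ℝ (Matrix (Fin n) (Fin n) ℝ)) (hh : Weitzenboeck.IsIdeal G h)
    {d : ℕ} (X : Fin d → Matrix (Fin n) (Fin n) ℝ) (hX : Weitzenboeck.IsOrthonormalBasis h X) :
    -- the Stein-Weiss operators map sections to sections and have formal adjoints
    (∀ i ψ, Weitzenboeck.IsSection P ρ ψ →
      Weitzenboeck.IsSection P (W i).toRepresentation (Weitzenboeck.steinWeiss P ρ (W i) ψ)) ∧
    (∀ i, ∃ A, Weitzenboeck.IsFormalAdjoint P ρ (W i).toRepresentation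
      (Weitzenboeck.steinWeiss P ρ (W i)) A) ∧
    -- the conformal weight operator has one (real) eigenvalue on each summand if the holonomy
    -- representation is irreducible or the decomposition is multiplicity free
    (((Weitzenboeck.realRep G).IsIrreducible ∨
        ∀ i j, i ≠ j →
          IsEmpty (Representation.Equiv (W i).toRepresentation (W j).toRepresentation)) →
      ∃! b : ι → ℝ, Weitzenboeck.IsConformalWeights h W b) ∧
    -- the universal Weitzenböck formula
    ∀ b : ι → ℝ, Weitzenboeck.IsConformalWeights h W b →
      ∀ A : ∀ i, Weitzenboeck.FrameFun n M (W i).toSubmodule → Weitzenboeck.FrameFun n M V,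
        (∀ i, Weitzenboeck.IsFormalAdjoint P ρ (W i).toRepresentation
          (Weitzenboeck.steinWeiss P ρ (W i)) (A i)) →
        ∀ ψ, Weitzenboeck.IsSection P ρ ψ → ∀ x, ∀ u ∈ P.fiber x,
          Weitzenboeck.curvatureEndo cov ρ X ψ x u =
            -∑ i, (b i : ℂ) • A i (Weitzenboeck.steinWeiss P ρ (W i) ψ) x u := by
  obtain ⟨L, hL⟩ := hρ.exists_hasFDerivWithinAt
  have hmem : ((Weitzenboeck.realRep G).IsIrreducible ∨ ∀ i j, i ≠ j →
      IsEmpty (Representation.Equiv (W i).toRepresentation (W j).toRepresentation)) →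
      ∀ i, ∀ w ∈ (W i).toSubmodule, Weitzenboeck.conformalWeightOp h ρ w ∈ (W i).toSubmodule := by
    rintro (hreal | hmf) i w hw
    · exact Weitzenboeck.conformalWeightOp_mem_of_irreducible hG_closed hG_conn hh hX hL hρ_irr
        hreal (W i) hw
    · exact Weitzenboeck.conformalWeightOp_mem_of_multiplicity_free hG_closed hG_conn hh hX hL
        hρ.inner_map hW hmf i hw
  refine ⟨fun i ψ hψ => Weitzenboeck.isSection_steinWeiss hcov hL hρ.inner_map (W i) hψ,
    fun i => ⟨_, Weitzenboeck.isFormalAdjoint_codifferential hL hcov hρ.inner_map (W i)⟩,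
    fun hcase => Weitzenboeck.existsUnique_conformalWeights hG_closed hG_conn hh hX hρ hW
      (hmem hcase), fun b hb A hA ψ hψ x u hu => ?_⟩
  -- The formula holds with the codifferentials. The given `A i` agrees with the codifferential on
  -- the smooth section `T_i ψ`, by uniqueness of formal adjoints.
  rw [Weitzenboeck.curvatureEndo_eq hcov hG_closed hG_conn hL hρ.inner_map hW hh hX hb hψ hu]
  refine congrArg Neg.neg (Finset.sum_congr rfl fun i _ => congrArg _ ?_)
  exact (Weitzenboeck.isFormalAdjoint_codifferential hL hcov hρ.inner_map (W i)).eq hρ.inner_map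
    (hA i) (Weitzenboeck.isSection_steinWeiss hcov hL hρ.inner_map (W i) hψ) hu
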